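/- Let $n\ge 1$ be an integer, $a>-1$ and $b>-n$ real numbers, and let $\mathbb B_n=\{z\in\mathbb C^n:|z|<1\}$ be the Euclidean unit ball. Let $\mu_{a,b}$ be the probability measure $$d\mu_{a,b}(z)=\frac{(n-1)!}{\pi^n\,\beta(a+1,b+n)}\,|z|^{2b}(1-|z|^2)^a\,d\lambda_n(z)$$ on $\mathbb B_n$, where $\lambda_n$ is Lebesgue measure on $\mathbb C^n$ and $\beta(s,t)=\Gamma(s)\Gamma(t)/\Gamma(s+t)$. For $1\le p<\infty$ let $\mathcal A^p_{a,b}(\mathbb B_n)$ be the space of holomorphic functions on $\mathbb B_n$ that belong to $L^p(\mathbb B_n,d\mu_{a,b})$, with the $L^p(\mu_{a,b})$-norm. Theorem 2.7 (duality). Let $1<p<\infty$ and $\frac1p+\frac1q=1$. Then the topological dual of $\mathcal A^p_{a,b}(\mathbb B_n)$ is $\mathcal A^q_{a,b}(\mathbb B_n)$ under the integral pairing $$\langle f,g\rangle_{a,b}=\int_{\mathbb B_n} f(z)\,\overline{g(z)}\,d\mu_{a,b}(z),\qquad f\in\mathcal A^p_{a,b}(\mathbb B_n),\ g\in\mathcal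 A^q_{a,b}(\mathbb B_n).$$ That is, $f\bar g$ is $\mu_{a,b}$-integrable for all such $f,g$, and $g\mapsto\langle\,\cdot\,,g\rangle_{a,b}$ is a conjugate-linear bijection from $\mathcal A^q_{a,b}(\mathbb B_n)$ onto the space of bounded linear functionals on $\mathcal A^p_{a,b}(\mathbb B_n)$ which is bounded and has a bounded inverse (so the two norms are equivalent). -/

import Mathlib

open MeasureTheory
open scoped ENNReal ComplexConjugate

noncomputable section

/-- The probability measure `μ_{a,b}` on the open unit ball of `ℂⁿ`, regarded as a measure on `ℂⁿ`
that gives no mass to the complement of the ball. Its density with respect to Lebesgue measure is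
`(n-1)! / (π ^ n β(a+1, b+n)) |z| ^ (2b) (1 - |z|²) ^ a`. -/
def bergmanMeasure (n : ℕ) (a b : ℝ) : Measure (EuclideanSpace ℂ (Fin n)) :=
  (volume.restrict (Metric.ball 0 1)).withDensity fun z =>
    ENNReal.ofReal (((n - 1).factorial : ℝ) /
      (Real.pi ^ n * ProbabilityTheory.beta (a + 1) (b + n)) *
        ‖z‖ ^ (2 * b) * (1 - ‖z‖ ^ 2) ^ a)

/-- The Bergman-type space `𝒜^p_{a,b}` of the unit ball of `ℂⁿ`, with the norm of `L^p(μ_{a,b})`: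
the elements of `L^p(μ_{a,b})` that are represented by a function holomorphic on the ball. -/
def bergmanSpace (n : ℕ) (a b : ℝ) (p : ℝ≥0∞) :
    Submodule ℂ (Lp ℂ p (bergmanMeasure n a b)) where
  carrier := {f | ∃ F : EuclideanSpace ℂ (Fin n) → ℂ,
    DifferentiableOn ℂ F (Metric.ball 0 1) ∧ f =ᵐ[bergmanMeasure n a b] F}
  add_mem' := by
    rintro f g ⟨F, hF, hfF⟩ ⟨G, hG, hgG⟩
    exact ⟨F + G, hF.add hG, (Lp.coeFn_add f g).trans (hfF.add hgG)⟩
  zero_mem' := ⟨0, differentiableOn_const 0, Lp.coeFn_zero ℂ p _⟩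
  smul_mem' := by
    rintro c f ⟨F, hF, hfF⟩
    exact ⟨c • F, hF.const_smul c, (Lp.coeFn_smul c f).trans (hfF.const_smul c)⟩

end

noncomputable section

open Metric Set Real

/-! ### Averages over the unit circle -/

section CircleAverage

/-! The pairing is bounded by Hölder, so what must be shown is that it is injective and exhausts the
dual with control of norms. Everything rests on the Bergman projection `bergmanProj`, the integral
operator P with kernel K(⟨w,z⟩): it fixes holomorphic functions, it is symmetric for the pairing,
and it is bounded on L^q(μ) for 1 < q < ∞. Given a functional φ on 𝒜^p, Hahn–Banach extends it to
L^p without increasing the norm, the Riesz theorem represents the extension by some h in L^q, and g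
= P(h̄) satisfies ⟨f,g⟩ = ⟨Pf,h̄⟩ = φ(f) with ‖g‖ ≤ C‖φ‖. If ⟨·,g⟩ = 0, testing on the functions
K(⟨z,·⟩) gives g = Pg = 0.

The kernel comes from homogeneous expansions. As μ is rotation invariant, integrating f against
⟨w,z⟩^k sees only the degree k component f_k and returns a multiple of f_k(z). The multiple is
computed once for the Gaussian, by the reproducing property of exp⟨w,z⟩ in Fock space, and polar
coordinates carry it over to every radial density. The inverse multiples are, up to a constant, the
coefficients of K (`integral_inner_pow_mul_bergmanMeasure`, `bergmanProj_eq_self`).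

Boundedness is Schur's test with weights (1-|z|)^(-s), which needs ∫ |K(⟨w,z⟩)| (1-|w|)^(-ε) dμ(w) ≤
C (1-|z|)^(-ε) for 0 < ε < a+1 (`exists_lintegral_kernelFun_le`). Since a and b are real, K is a
superposition rather than a single power of 1/(1-x): its Gamma quotients are a polynomial in k times
a Beta integral, so |K(x)| is at most an integral over u in (0,1) of multiples of |1-ux|^(-N), and N
may be taken even. Then |1-⟨w,y⟩|^(-N) is the squared modulus of a holomorphic function, its radial
integral is an explicit power series (`integral_div_norm_one_sub_inner_le`), and two one-dimensional
integrals remain. -/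

theorem circleAverage_comp_mul {g : ℂ → ℂ} {u : ℂ} (hu : ‖u‖ = 1) :
    circleAverage (fun t => g (t * u)) 0 1 = circleAverage g 0 1 := by
  rw [circleAverage_eq_integral_add (f := g) u.arg]
  simp only [circleAverage]
  congr 2
  ext θ
  congr 1
  have : u = Complex.exp (u.arg * Complex.I) := by
    conv_lhs => rw [← Complex.norm_mul_exp_arg_mul_I u, hu]
    simp
  conv_lhs => rw [this]
  simp [circleMap, add_mul, Complex.exp_add]

theorem circleAverage_comm {F : ℂ → ℂ → ℂ}
    (hF : Continuous fun p : ℝ × ℝ => F (circleMap 0 1 p.1) (circleMap 0 1 p.2)) :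
    circleAverage (fun s => circleAverage (fun t => F s t) 0 1) 0 1 =
      circleAverage (fun t => circleAverage (fun s => F s t) 0 1) 0 1 := by
  have h2 : (0 : ℝ) ≤ 2 * π := by positivity
  simp only [circleAverage, intervalIntegral.integral_smul]
  congr 2
  simp only [intervalIntegral.integral_of_le h2]
  apply integral_integral_swap
  rw [Measure.prod_restrict]
  exact (hF.continuousOn.integrableOn_compact (isCompact_Icc.prod isCompact_Icc)).mono_set
    (prod_mono Ioc_subset_Icc_self Ioc_subset_Icc_self)

theorem norm_circleAverage_le {g : ℂ → ℂ} {M : ℝ} (h : ∀ t : ℂ, ‖t‖ = 1 → ‖g t‖ ≤ M) :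
    ‖circleAverage g 0 1‖ ≤ M := by
  have h2 : (0 : ℝ) < 2 * π := by positivity
  rw [circleAverage, norm_smul, norm_inv, Real.norm_of_nonneg h2.le, inv_mul_le_iff₀ h2]
  calc _ ≤ M * |2 * π - 0| := intervalIntegral.norm_integral_le_of_norm_le_const
          fun θ _ => h _ (by simp)
    _ = _ := by rw [sub_zero, abs_of_pos h2, mul_comm]

theorem continuous_circleAverage {X : Type*} [TopologicalSpace X] {F : X → ℂ → ℂ}
    (hF : Continuous fun p : X × ℝ => F p.1 (circleMap 0 1 p.2)) :
    Continuous fun x => circleAverage (F x) 0 1 := by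
  apply Continuous.const_smul
  exact intervalIntegral.continuous_parametric_intervalIntegral_of_continuous' hF _ _

theorem circleAverage_const_mul (c : ℂ) (g : ℂ → ℂ) :
    circleAverage (fun t => c * g t) 0 1 = c * circleAverage g 0 1 :=
  circleAverage_fun_smul (𝕜 := ℂ) (a := c) (f := g)

end CircleAverage

/-! ### Homogeneous expansion of a holomorphic function on the ball -/

section HomogeneousComponents

variable {E : Type*} [NormedAddCommGroup E] [NormedSpace ℂ E]

/-- The homogeneous component of degree `k` of a function that is holomorphic near `0`. -/
def homComp (f : E → ℂ) (k : ℕ) (w : E) : ℂ :=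
  (k.factorial : ℂ)⁻¹ * iteratedDeriv k (fun t : ℂ => f (t • w)) 0

variable {f : E → ℂ} (hf : DifferentiableOn ℂ f (ball 0 1))

include hf in
theorem DifferentiableOn.comp_line {z v : E} {s : Set ℂ} (h : ∀ t ∈ s, ‖z + t • v‖ < 1) :
    DifferentiableOn ℂ (fun t : ℂ => f (z + t • v)) s := by
  refine hf.comp (g := f) (f := fun t : ℂ => z + t • v) (by fun_prop) fun t ht => ?_
  simpa using h t ht

include hf in
theorem hasSum_homComp {z : E} (hz : z ∈ ball (0 : E) 1) :
    HasSum (fun k => homComp f k z) (f z) := by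
  have hz' : ‖z‖ < 1 := by simpa using hz
  have h0 := norm_nonneg z
  have hd : DifferentiableOn ℂ (fun t : ℂ => f (t • z)) (ball 0 (2 / (1 + ‖z‖))) := by
    have := hf.comp_line (z := 0) (v := z) (s := ball 0 (2 / (1 + ‖z‖))) ?_
    · simpa using this
    intro t ht
    rw [zero_add, norm_smul]
    rw [mem_ball_zero_iff, lt_div_iff₀ (by positivity)] at ht
    nlinarith [norm_nonneg t]
  have h1 : (1 : ℂ) ∈ ball (0 : ℂ) (2 / (1 + ‖z‖)) := by
    rw [mem_ball_zero_iff, norm_one, lt_div_iff₀ (by positivity)]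
    linarith
  simpa [homComp] using Complex.hasSum_taylorSeries_on_ball hd h1

include hf in
-- Cauchy's formula on the circle of radius 1/R, rescaled to the unit circle. Any R > ‖w‖ keeps the
-- points (t/R)w in the ball, so one R can serve a whole family of points w.
theorem homComp_eq_circleAverage (k : ℕ) {w : E} {R : ℝ} (hR : ‖w‖ < R) :
    homComp f k w = R ^ k * circleAverage (fun t : ℂ => (t ^ k)⁻¹ * f ((t / R) • w)) 0 1 := by
  have hR0 : 0 < R := (norm_nonneg w).trans_lt hR
  have hRc : (R : ℂ) ≠ 0 := by exact_mod_cast hR0.ne'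
  have hd : DifferentiableOn ℂ (fun t : ℂ => f (t • w)) (closedBall 0 R⁻¹) := by
    have := hf.comp_line (z := 0) (v := w) (s := closedBall 0 R⁻¹) ?_
    · simpa using this
    intro t ht
    rw [zero_add, norm_smul]
    rw [mem_closedBall_zero_iff] at ht
    calc ‖t‖ * ‖w‖ ≤ R⁻¹ * ‖w‖ := by gcongr
      _ < 1 := by rwa [inv_mul_lt_iff₀ hR0, mul_one]
  have key := hd.circleIntegral_one_div_sub_center_pow_smul (inv_pos.2 hR0) k
  have h2 : circleAverage (fun t : ℂ => (t ^ k)⁻¹ * f (t • w)) 0 R⁻¹ = homComp f k w := by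
    rw [circleAverage_eq_circleIntegral (inv_pos.2 hR0).ne', homComp]
    have : (fun z : ℂ => (z - 0)⁻¹ • ((z ^ k)⁻¹ * f (z • w))) =
        fun z => (1 / (z - 0) ^ (k + 1)) • f (z • w) := by
      ext z
      simp [pow_succ]
      ring
    rw [this, key, smul_smul, smul_eq_mul]
    congr 1
    have := Complex.two_pi_I_ne_zero
    field_simp
  rw [← h2, circleAverage_eq_circleAverage_zero_one, ← circleAverage_const_mul]
  congr 1
  ext t
  push_cast
  rw [add_zero, mul_pow, mul_inv, inv_pow, inv_inv, mul_comm (R : ℂ)⁻¹ t, ← div_eq_mul_inv t]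
  ring

include hf in
theorem homComp_smul (k : ℕ) (t : ℂ) (ht : t ≠ 0) (w : E) :
    homComp f k (t • w) = t ^ k * homComp f k w := by
  have ht' : 0 < ‖t‖ := norm_pos_iff.2 ht
  have htc : (‖t‖ : ℂ) ≠ 0 := by exact_mod_cast ht'.ne'
  have hR : ‖w‖ < ‖w‖ + 1 := by linarith
  have hR' : ‖t • w‖ < ‖t‖ * (‖w‖ + 1) := by
    rw [norm_smul]; gcongr
  have hu : ‖t / ‖t‖‖ = 1 := by simp [ht]
  rw [homComp_eq_circleAverage hf k hR, homComp_eq_circleAverage hf k hR',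
    ← circleAverage_comp_mul (u := t / ‖t‖) hu
      (g := fun s => (s ^ k)⁻¹ * f ((s / ((‖w‖ + 1 : ℝ) : ℂ)) • w))]
  rw [← mul_assoc, ← circleAverage_const_mul, ← circleAverage_const_mul]
  congr 1
  ext s
  have h1 : ((‖w‖ + 1 : ℝ) : ℂ) ≠ 0 := by exact_mod_cast (by positivity : ‖w‖ + 1 ≠ 0)
  rw [smul_smul]
  have : s / ((‖t‖ * (‖w‖ + 1) : ℝ) : ℂ) * t = s * (t / ‖t‖) / ((‖w‖ + 1 : ℝ) : ℂ) := by
    push_cast at h1 ⊢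
    field_simp
  rw [this]
  push_cast
  rw [mul_pow, mul_pow, div_pow, mul_inv, inv_div]
  field_simp

theorem norm_div_smul_lt {t : ℂ} (ht : ‖t‖ = 1) (w : E) :
    ‖(t / ((1 + 2 * ‖w‖ : ℝ) : ℂ)) • w‖ ≤ 1 / 2 := by
  have h0 := norm_nonneg w
  rw [norm_smul, norm_div, ht, Complex.norm_real, Real.norm_of_nonneg (by positivity),
    div_mul_eq_mul_div, div_le_iff₀ (by positivity)]
  linarith

include hf in
-- The radius 1 + 2‖w‖ depends continuously on w and keeps every sample point in the closed ball of
-- radius 1/2, where f is bounded; continuity and polynomial growth of the component follow.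
theorem homComp_eq_circleAverage' (k : ℕ) (w : E) :
    homComp f k w = (1 + 2 * ‖w‖ : ℝ) ^ k *
      circleAverage (fun t : ℂ => (t ^ k)⁻¹ * f ((t / (1 + 2 * ‖w‖ : ℝ)) • w)) 0 1 := by
  have h0 := norm_nonneg w
  exact_mod_cast homComp_eq_circleAverage hf k (w := w) (R := 1 + 2 * ‖w‖) (by linarith)

include hf in
theorem norm_homComp_le [FiniteDimensional ℂ E] (k : ℕ) :
    ∃ M : ℝ, 0 ≤ M ∧ ∀ w, ‖homComp f k w‖ ≤ M * (1 + 2 * ‖w‖) ^ k := by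
  have : ProperSpace E := FiniteDimensional.proper_rclike ℂ E
  obtain ⟨M, hM⟩ := (isCompact_closedBall (0 : E) (1 / 2)).exists_bound_of_continuousOn
    (hf.continuousOn.mono (closedBall_subset_ball (by norm_num)))
  refine ⟨M, (norm_nonneg _).trans (hM 0 (by simp)), fun w => ?_⟩
  have h0 := norm_nonneg w
  rw [homComp_eq_circleAverage' hf, norm_mul, norm_pow, Complex.norm_real,
    Real.norm_of_nonneg (by positivity), mul_comm]
  gcongr
  refine norm_circleAverage_le fun t ht => ?_
  rw [norm_mul, norm_inv, norm_pow, ht]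
  simpa using hM _ (mem_closedBall_zero_iff.2 (norm_div_smul_lt ht w))

include hf in
theorem continuous_comp_div_smul (k : ℕ) {X : Type*} [TopologicalSpace X] {u : X → E} {v : X → ℝ}
    (hu : Continuous u) (hv : Continuous v) {R : X → ℝ} (hR : Continuous R)
    (huR : ∀ x, ‖u x‖ < R x) :
    Continuous fun x : X => ((circleMap 0 1 (v x)) ^ k)⁻¹ * f ((circleMap 0 1 (v x) / R x) • u x) := by
  have hR0 : ∀ x, (R x : ℂ) ≠ 0 := fun x => by
    exact_mod_cast ((norm_nonneg _).trans_lt (huR x)).ne'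
  have hc : Continuous fun x => circleMap 0 1 (v x) := by fun_prop
  refine ((hc.pow k).inv₀ fun x => by simp).mul ?_
  refine hf.continuousOn.comp_continuous (by fun_prop (disch := exact hR0 _)) fun x => ?_
  have h := huR x
  have hp := (norm_nonneg _).trans_lt h
  rw [mem_ball_zero_iff, norm_smul, norm_div, Complex.norm_real, Real.norm_of_nonneg hp.le]
  simp only [norm_circleMap_zero, abs_one]
  rwa [div_mul_eq_mul_div, one_mul, div_lt_one hp]

include hf in
theorem continuous_homComp (k : ℕ) : Continuous (homComp f k) := by
  have : homComp f k = fun w => ((1 + 2 * ‖w‖ : ℝ) : ℂ) ^ k *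
      circleAverage (fun t : ℂ => (t ^ k)⁻¹ * f ((t / (1 + 2 * ‖w‖ : ℝ)) • w)) 0 1 :=
    funext fun w => homComp_eq_circleAverage' hf k w
  rw [this]
  refine Continuous.mul (by fun_prop) (continuous_circleAverage ?_)
  exact continuous_comp_div_smul hf k (X := E × ℝ) (u := Prod.fst) (v := Prod.snd)
    (R := fun x => 1 + 2 * ‖x.1‖) (by fun_prop) (by fun_prop) (by fun_prop)
    fun x => by have := norm_nonneg x.1; linarith

include hf in
-- Mean value property along the complex line z + tv. Instead of proving the component entire, it is
-- written as a circle average of f with a single radius R > ‖z‖ + ‖v‖; after swapping the averages,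
-- the mean value property is applied to f itself, inside the ball.
theorem circleAverage_homComp_mul_exp (k : ℕ) (z v : E) (c : ℂ) :
    circleAverage (fun t : ℂ => homComp f k (z + t • v) * Complex.exp (-(t * c))) 0 1 =
      homComp f k z := by
  set R : ℝ := ‖z‖ + ‖v‖ + 1 with hR
  have hz0 := norm_nonneg z
  have hv0 := norm_nonneg v
  have hRp : 0 < R := by positivity
  have hlt : ∀ t : ℂ, ‖t‖ ≤ 1 → ‖z + t • v‖ < R := fun t ht => by
    calc ‖z + t • v‖ ≤ ‖z‖ + ‖t‖ * ‖v‖ := by rw [← norm_smul]; exact norm_add_le _ _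
      _ ≤ ‖z‖ + 1 * ‖v‖ := by gcongr
      _ < R := by rw [hR]; linarith
  have h1 : circleAverage (fun t : ℂ => homComp f k (z + t • v) * Complex.exp (-(t * c))) 0 1 =
      circleAverage (fun t : ℂ => R ^ k * circleAverage (fun s : ℂ => (s ^ k)⁻¹ *
        f ((s / R) • (z + t • v)) * Complex.exp (-(t * c))) 0 1) 0 1 := by
    refine circleAverage_congr_sphere fun t ht => ?_
    have ht' : ‖t‖ = 1 := by simpa using ht
    rw [homComp_eq_circleAverage hf k (hlt t ht'.le), mul_assoc, mul_comm (circleAverage _ _ _),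
      ← circleAverage_const_mul]
    congr 2
    ext s
    ring
  rw [h1, circleAverage_const_mul, circleAverage_comm, homComp_eq_circleAverage hf k (w := z) (R := R)
    (by rw [hR]; linarith)]
  · congr 1
    refine circleAverage_congr_sphere fun s hs => ?_
    have hs' : ‖s‖ = 1 := by simpa using hs
    have hassoc : (fun t : ℂ => (s ^ k)⁻¹ * f ((s / R) • (z + t • v)) * Complex.exp (-(t * c))) =
        fun t => (s ^ k)⁻¹ * (f ((s / R) • (z + t • v)) * Complex.exp (-(t * c))) := by
      ext t
      ring
    rw [hassoc, circleAverage_const_mul]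
    congr 1
    have hd : DiffContOnCl ℂ (fun t : ℂ => f ((s / R) • (z + t • v)) * Complex.exp (-(t * c)))
        (ball 0 |1|) := by
      apply DifferentiableOn.diffContOnCl
      rw [abs_one, closure_ball _ one_ne_zero]
      refine DifferentiableOn.mul ?_ (by fun_prop)
      have := hf.comp_line (z := (s / (R : ℂ)) • z) (v := (s / (R : ℂ)) • v) (s := closedBall 0 1) ?_
      · simpa [smul_smul, mul_comm] using this
      intro t ht
      rw [smul_comm, ← smul_add, norm_smul, norm_div, hs', Complex.norm_real,
        Real.norm_of_nonneg hRp.le, one_div, inv_mul_lt_iff₀ hRp, mul_one]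
      exact hlt t (by simpa using ht)
    simpa using hd.circleAverage
  · have := continuous_comp_div_smul hf k (X := ℝ × ℝ) (u := fun p => z + circleMap 0 1 p.1 • v)
      (v := Prod.snd) (R := fun _ => R) (by fun_prop) (by fun_prop) (by fun_prop)
      fun x => hlt _ (by simp)
    exact this.mul (by fun_prop)

end HomogeneousComponents

/-! ### Rotation averages and polar coordinates in ℂⁿ -/

section Polar

variable {n : ℕ}

theorem finrank_real_euclideanSpace_complex (n : ℕ) :
    Module.finrank ℝ (EuclideanSpace ℂ (Fin n)) = 2 * n := by
  rw [← Module.finrank_mul_finrank ℝ ℂ (EuclideanSpace ℂ (Fin n)), Complex.finrank_real_complex,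
    finrank_euclideanSpace_fin]

theorem measurePreserving_unit_smul {u : ℂ} (hu : ‖u‖ = 1) :
    MeasurePreserving (fun w : EuclideanSpace ℂ (Fin n) => u • w) := by
  have hu0 : u ≠ 0 := by rintro rfl; simp at hu
  let e : EuclideanSpace ℂ (Fin n) ≃ₗᵢ[ℝ] EuclideanSpace ℂ (Fin n) :=
    { toFun := fun w => u • w
      invFun := fun w => u⁻¹ • w
      map_add' := smul_add u
      map_smul' := fun r w => smul_comm u r w
      left_inv := fun w => inv_smul_smul₀ hu0 w
      right_inv := fun w => smul_inv_smul₀ hu0 w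
      norm_map' := fun w => by simp [norm_smul, hu] }
  exact e.measurePreserving

/-- Each rotation w ↦ e^{iθ}w preserves Lebesgue measure, so averaging over θ and Fubini change
nothing. -/
theorem integral_eq_integral_circleAverage {F : EuclideanSpace ℂ (Fin n) → ℂ}
    (hF : Integrable F) : ∫ w, F w = ∫ w, circleAverage (fun t => F (t • w)) 0 1 := by
  have h2 : (0 : ℝ) < 2 * π := by positivity
  have hmp : MeasurePreserving
      (fun p : ℝ × EuclideanSpace ℂ (Fin n) => (p.1, circleMap 0 1 p.1 • p.2))
      ((volume.restrict (Ioc 0 (2 * π))).prod volume)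
      ((volume.restrict (Ioc 0 (2 * π))).prod volume) := by
    refine MeasurePreserving.skew_product (MeasurePreserving.id _)
      (g := fun θ w => circleMap 0 1 θ • w) ?_ ?_
    · exact Continuous.measurable (by unfold Function.uncurry; fun_prop)
    · exact Filter.Eventually.of_forall fun θ => (measurePreserving_unit_smul (by simp)).map_eq
  have hint : Integrable (fun p : ℝ × EuclideanSpace ℂ (Fin n) => F (circleMap 0 1 p.1 • p.2))
      ((volume.restrict (Ioc 0 (2 * π))).prod volume) :=
    hmp.integrable_comp_of_integrable (hF.comp_snd (volume.restrict (Ioc 0 (2 * π))))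
  simp only [circleAverage, intervalIntegral.integral_of_le h2.le]
  rw [integral_smul, ← integral_integral_swap hint]
  have : ∀ θ : ℝ, ∫ w, F (circleMap 0 1 θ • w) = ∫ w, F w := fun θ => by
    have hu : ‖circleMap 0 1 θ‖ = 1 := by simp
    have hu0 : circleMap 0 1 θ ≠ 0 := by intro h; rw [h] at hu; simp at hu
    exact (measurePreserving_unit_smul hu).integral_comp
      (Homeomorph.smulOfNeZero _ hu0).measurableEmbedding F
  simp [this, h2.le, ← mul_assoc, pi_ne_zero]

/-- The spherical factor does not depend on ψ: knowing the integral for one radial function with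
nonzero moment determines it for all others. The product formula needs no integrability assumption.
-/
theorem integral_homogeneous_mul_radial (hn : 1 ≤ n) {Θ : EuclideanSpace ℂ (Fin n) → ℂ} {m : ℕ}
    (hΘ : ∀ t : ℝ, 0 < t → ∀ w, Θ ((t : ℂ) • w) = t ^ m * Θ w) (ψ : ℝ → ℂ) :
    ∫ w, Θ w * ψ ‖w‖ =
      (∫ s : sphere (0 : EuclideanSpace ℂ (Fin n)) 1, Θ s ∂(volume.toSphere)) *
        ∫ r in Ioi (0 : ℝ), (r : ℂ) ^ (2 * n - 1 + m) * ψ r := by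
  have : Nonempty (Fin n) := ⟨⟨0, hn⟩⟩
  set μ : Measure (EuclideanSpace ℂ (Fin n)) := volume
  calc ∫ w, Θ w * ψ ‖w‖ ∂μ
      = ∫ w : ({(0)}ᶜ : Set (EuclideanSpace ℂ (Fin n))), Θ w.1 * ψ ‖w.1‖ ∂(μ.comap (↑)) := by
        rw [integral_subtype_comap (measurableSet_singleton _).compl fun w => Θ w * ψ ‖w‖,
          restrict_compl_singleton]
    _ = ∫ x, Θ x.1 * ((x.2 : ℝ) ^ m * ψ x.2)
          ∂μ.toSphere.prod (.volumeIoiPow (Module.finrank ℝ (EuclideanSpace ℂ (Fin n)) - 1)) := by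
      rw [← μ.measurePreserving_homeomorphUnitSphereProd.integral_comp
        (Homeomorph.measurableEmbedding _)]
      refine integral_congr_ae (Filter.Eventually.of_forall fun x => ?_)
      have hx : 0 < ‖x.1‖ := norm_pos_iff.2 x.2
      have h : x.1 = (‖x.1‖ : ℂ) • (‖x.1‖⁻¹ • x.1) := by
        rw [Complex.coe_smul, smul_inv_smul₀ hx.ne']
      simp only [homeomorphUnitSphereProd_apply_snd_coe, homeomorphUnitSphereProd_apply_fst_coe]
      conv_lhs => rw [h, hΘ _ hx]
      rw [← h]
      ring
    _ = (∫ s, Θ s ∂μ.toSphere) * ∫ x : Ioi (0 : ℝ), ((x : ℝ) ^ m * ψ x : ℂ)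
          ∂.volumeIoiPow (Module.finrank ℝ (EuclideanSpace ℂ (Fin n)) - 1) :=
      integral_prod_mul (L := ℂ)
        (fun s : sphere (0 : EuclideanSpace ℂ (Fin n)) 1 => Θ s) (fun x : Ioi (0 : ℝ) => ((x : ℝ) ^ m * ψ x : ℂ))
    _ = _ := by
      congr 1
      simp only [Measure.volumeIoiPow, ENNReal.ofReal]
      rw [integral_withDensity_eq_integral_smul,
        integral_subtype_comap measurableSet_Ioi fun a : ℝ =>
          Real.toNNReal (a ^ (Module.finrank ℝ (EuclideanSpace ℂ (Fin n)) - 1)) • ((a : ℂ) ^ m * ψ a),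
        setIntegral_congr_fun measurableSet_Ioi fun x hx => ?_]
      · rw [NNReal.smul_def, Real.coe_toNNReal _ (pow_nonneg (le_of_lt hx) _),
          finrank_real_euclideanSpace_complex, Complex.real_smul]
        push_cast
        ring
      · exact (measurable_subtype_coe.pow_const _).real_toNNReal

end Polar

/-! ### Reproducing formulas for the Gaussian weight -/

section Gaussian

variable {n : ℕ}

theorem integrable_exp_neg_sq_div_four :
    Integrable fun w : EuclideanSpace ℂ (Fin n) => Real.exp (-‖w‖ ^ 2 / 4) := by
  -- A non-integrable function would have Bochner integral 0, contradicting the positive closed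
  -- form.
  by_contra h
  have := GaussianFourier.integral_rexp_neg_mul_sq_norm (V := EuclideanSpace ℂ (Fin n))
    (b := 1 / 4) (by norm_num)
  have e : (fun w : EuclideanSpace ℂ (Fin n) => Real.exp (-(1 / 4) * ‖w‖ ^ 2)) =
      fun w => Real.exp (-‖w‖ ^ 2 / 4) := by
    ext w; congr 1; ring
  rw [e, integral_undef h] at this
  exact absurd this (by positivity)

theorem gaussian_integral_pos : 0 < ∫ w : EuclideanSpace ℂ (Fin n), Real.exp (-‖w‖ ^ 2) := by
  have := GaussianFourier.integral_rexp_neg_mul_sq_norm (V := EuclideanSpace ℂ (Fin n))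
    (b := 1) (by norm_num)
  simp only [neg_mul, one_mul] at this
  rw [this]
  positivity

theorem exists_pow_mul_exp_le (k : ℕ) {a : ℝ} (ha : 0 ≤ a) :
    ∃ C : ℝ, 0 ≤ C ∧ ∀ x : ℝ, 0 ≤ x →
      (a + 2 * x) ^ k * Real.exp (a * x) * Real.exp (-x ^ 2) ≤ C * Real.exp (-x ^ 2 / 4) := by
  refine ⟨k.factorial * Real.exp (a + (2 + a) ^ 2), by positivity, fun x hx => ?_⟩
  have h1 := Real.pow_div_factorial_le_exp (a + 2 * x) (by positivity) k
  rw [div_le_iff₀ (by positivity)] at h1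
  calc (a + 2 * x) ^ k * Real.exp (a * x) * Real.exp (-x ^ 2)
      ≤ Real.exp (a + 2 * x) * k.factorial * Real.exp (a * x) * Real.exp (-x ^ 2) := by gcongr
    _ = k.factorial * Real.exp (a + 2 * x + a * x + -x ^ 2) := by
      rw [Real.exp_add (a + 2 * x + a * x), Real.exp_add (a + 2 * x)]; ring
    _ ≤ k.factorial * Real.exp (a + (2 + a) ^ 2 + -x ^ 2 / 4) := by
      refine mul_le_mul_of_nonneg_left (Real.exp_le_exp.2 ?_) (by positivity)
      nlinarith [sq_nonneg (2 + a - x)]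
    _ = _ := by rw [Real.exp_add]; ring

theorem integral_circleAverage_comm {F : EuclideanSpace ℂ (Fin n) → ℂ → ℂ}
    (hF : Continuous fun p : EuclideanSpace ℂ (Fin n) × ℝ => F p.1 (circleMap 0 1 p.2)) {C : ℝ}
    (hC : ∀ w t, ‖t‖ = 1 → ‖F w t‖ ≤ C * Real.exp (-‖w‖ ^ 2 / 4)) :
    ∫ w, circleAverage (F w) 0 1 = circleAverage (fun t => ∫ w, F w t) 0 1 := by
  have h2 : (0 : ℝ) < 2 * π := by positivity
  simp only [circleAverage, intervalIntegral.integral_of_le h2.le]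
  rw [integral_smul, integral_integral_swap]
  refine Integrable.mono' ((integrable_exp_neg_sq_div_four.const_mul C).comp_fst
    (volume.restrict (Ioc 0 (2 * π)))) hF.aestronglyMeasurable ?_
  exact Filter.Eventually.of_forall fun p => hC _ _ (by simp)

variable {f : EuclideanSpace ℂ (Fin n) → ℂ} (hf : DifferentiableOn ℂ f (ball 0 1))

include hf in
-- The reproducing property of Fock space. Translating by z completes the square and turns exp⟨w,z⟩
-- exp(-|w|²) into exp(-⟨z,v⟩) exp(-|v|²). The first factor is holomorphic in v, so averaging over v
-- ↦ tv leaves only the value at v = 0.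
theorem integral_homComp_mul_exp_inner (k : ℕ) (z : EuclideanSpace ℂ (Fin n)) :
    ∫ w, homComp f k w * Complex.exp (inner ℂ w z) * Real.exp (-‖w‖ ^ 2) =
      homComp f k z * (∫ w : EuclideanSpace ℂ (Fin n), Real.exp (-‖w‖ ^ 2) : ℝ) := by
  obtain ⟨M, hM0, hM⟩ := norm_homComp_le hf k
  obtain ⟨C, hC0, hC⟩ := exists_pow_mul_exp_le k (a := 1 + 2 * ‖z‖) (by positivity)
  have hcont := continuous_homComp hf k
  rw [← integral_add_left_eq_self _ z]
  have h1 : ∀ v : EuclideanSpace ℂ (Fin n), homComp f k (z + v) * Complex.exp (inner ℂ (z + v) z) *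
      (Real.exp (-‖z + v‖ ^ 2) : ℂ) =
      homComp f k (z + v) * Complex.exp (-inner ℂ z v) * (Real.exp (-‖v‖ ^ 2) : ℂ) := by
    intro v
    rw [mul_assoc, mul_assoc]
    congr 1
    rw [Complex.ofReal_exp, Complex.ofReal_exp, ← Complex.exp_add, ← Complex.exp_add]
    congr 1
    push_cast
    rw [← Complex.coe_algebraMap, ← inner_self_eq_norm_sq_to_K (𝕜 := ℂ) (z + v),
      ← inner_self_eq_norm_sq_to_K (𝕜 := ℂ) v, inner_add_left, inner_add_left, inner_add_right,
      inner_add_right]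
    ring
  simp only [h1]
  have hint : Integrable fun v : EuclideanSpace ℂ (Fin n) =>
      homComp f k (z + v) * Complex.exp (-inner ℂ z v) * (Real.exp (-‖v‖ ^ 2) : ℂ) := by
    refine Integrable.mono' (integrable_exp_neg_sq_div_four.const_mul (M * C))
      (Continuous.aestronglyMeasurable (by fun_prop)) (Filter.Eventually.of_forall fun v => ?_)
    have hv := norm_nonneg v
    have hz := norm_nonneg z
    rw [norm_mul, norm_mul, Complex.norm_real, Real.norm_of_nonneg (Real.exp_pos _).le, mul_assoc M]
    refine le_trans ?_ (mul_le_mul_of_nonneg_left (hC _ hv) hM0)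
    rw [← mul_assoc, ← mul_assoc]
    gcongr
    · refine (hM _).trans (mul_le_mul_of_nonneg_left (pow_le_pow_left₀ (by positivity) ?_ _) hM0)
      linarith [norm_add_le z v]
    · rw [Complex.norm_exp]
      gcongr
      refine (Complex.re_le_norm _).trans ?_
      rw [norm_neg]
      refine (norm_inner_le_norm _ _).trans ?_
      gcongr
      linarith
  rw [integral_eq_integral_circleAverage hint]
  have h2 : ∀ v : EuclideanSpace ℂ (Fin n), circleAverage (fun t : ℂ => homComp f k (z + t • v) *
      Complex.exp (-inner ℂ z (t • v)) * (Real.exp (-‖t • v‖ ^ 2) : ℂ)) 0 1 =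
      homComp f k z * (Real.exp (-‖v‖ ^ 2) : ℂ) := by
    intro v
    rw [← circleAverage_homComp_mul_exp hf k z v (inner ℂ z v), mul_comm, ← circleAverage_const_mul]
    refine circleAverage_congr_sphere fun t ht => ?_
    have ht' : ‖t‖ = 1 := by simpa using ht
    simp only [inner_smul_right, norm_smul, ht', one_mul]
    ring
  simp only [h2]
  rw [integral_const_mul, integral_complex_ofReal]

theorem circleAverage_inv_pow_mul_exp (k : ℕ) (c : ℂ) :
    circleAverage (fun t : ℂ => (t ^ k)⁻¹ * Complex.exp (t * c)) 0 1 = c ^ k / k.factorial := by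
  -- The Cauchy formula with R = 1 requires a point of norm less than 1; evaluating exp(2ct) at 1/2
  -- gives exp(ct) on the circle.
  have := homComp_eq_circleAverage (f := fun t : ℂ => Complex.exp (2 * c * t)) (by fun_prop) k
    (w := (1 / 2 : ℂ)) (R := 1) (by norm_num)
  simp only [homComp, Complex.ofReal_one, one_pow, one_mul, div_one, smul_eq_mul] at this
  have e : ∀ t : ℂ, 2 * c * (t * (1 / 2)) = c * t := fun t => by ring
  simp only [e, iteratedDeriv_cexp_const_mul] at this
  simp only [mul_comm c] at this
  rw [← this]
  simp
  ring

include hf in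
-- Replace z by tz in the exponential formula and take the k-th Fourier coefficient in t: the
-- exponential contributes ⟨w,z⟩^k / k!, while the right side is already homogeneous of degree k.
theorem integral_homComp_mul_inner_pow_mul_exp (k : ℕ) (z : EuclideanSpace ℂ (Fin n)) :
    ∫ w, homComp f k w * (inner ℂ w z) ^ k * Real.exp (-‖w‖ ^ 2) =
      k.factorial * homComp f k z * (∫ w : EuclideanSpace ℂ (Fin n), Real.exp (-‖w‖ ^ 2) : ℝ) := by
  obtain ⟨M, hM0, hM⟩ := norm_homComp_le hf k
  obtain ⟨C, hC0, hC⟩ := exists_pow_mul_exp_le k (a := 1 + ‖z‖) (by positivity)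
  have hcont := continuous_homComp hf k
  have h1 : ∀ w : EuclideanSpace ℂ (Fin n),
      circleAverage (fun t : ℂ => (t ^ k)⁻¹ * (homComp f k w * Complex.exp (inner ℂ w (t • z)) *
        Real.exp (-‖w‖ ^ 2))) 0 1 =
      (k.factorial : ℂ)⁻¹ * (homComp f k w * (inner ℂ w z) ^ k * Real.exp (-‖w‖ ^ 2)) := by
    intro w
    have : (fun t : ℂ => (t ^ k)⁻¹ * (homComp f k w * Complex.exp (inner ℂ w (t • z)) *
        Real.exp (-‖w‖ ^ 2))) = fun t => (homComp f k w * Real.exp (-‖w‖ ^ 2)) *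
          ((t ^ k)⁻¹ * Complex.exp (t * inner ℂ w z)) := by
      ext t
      rw [inner_smul_right]
      ring
    rw [this, circleAverage_const_mul, circleAverage_inv_pow_mul_exp]
    ring
  have h2 := integral_circleAverage_comm (n := n) (C := M * C)
    (F := fun w t => (t ^ k)⁻¹ * (homComp f k w * Complex.exp (inner ℂ w (t • z)) *
        Real.exp (-‖w‖ ^ 2))) ?_ ?_
  · simp only [h1] at h2
    rw [integral_const_mul, inv_mul_eq_iff_eq_mul₀ (by exact_mod_cast k.factorial_ne_zero)] at h2
    rw [h2, mul_assoc]
    congr 1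
    rw [← circleAverage_const (homComp f k z *
      (∫ w : EuclideanSpace ℂ (Fin n), Real.exp (-‖w‖ ^ 2) : ℝ)) 0 1]
    refine circleAverage_congr_sphere fun t ht => ?_
    have ht' : t ≠ 0 := by rintro rfl; simp at ht
    rw [integral_const_mul, integral_homComp_mul_exp_inner hf, homComp_smul hf k t ht']
    field_simp
  · have hc : Continuous fun x : EuclideanSpace ℂ (Fin n) × ℝ => circleMap 0 1 x.2 := by fun_prop
    exact ((hc.pow k).inv₀ fun x => by simp).mul (by fun_prop)
  · intro w t ht
    have hw := norm_nonneg w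
    have hz := norm_nonneg z
    rw [norm_mul, norm_mul, norm_mul, Complex.norm_real, Real.norm_of_nonneg (Real.exp_pos _).le,
      mul_assoc M, norm_inv, norm_pow, ht, one_pow, inv_one, one_mul]
    refine le_trans ?_ (mul_le_mul_of_nonneg_left (hC _ hw) hM0)
    rw [← mul_assoc, ← mul_assoc]
    gcongr
    · refine (hM _).trans ?_
      gcongr
      linarith
    · rw [Complex.norm_exp]
      gcongr
      refine (Complex.re_le_norm _).trans ?_
      refine (norm_inner_le_norm _ _).trans ?_
      rw [norm_smul, ht, mul_comm]
      gcongr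
      linarith

end Gaussian

/-! ### Transfer from the Gaussian to arbitrary radial weights -/

section RadialMeasures

variable {n : ℕ}

/-- The factor by which integration against the `k`-th power of the inner product over the unit
sphere multiplies a homogeneous holomorphic polynomial of degree `k`. -/
def angularConst (n k : ℕ) : ℝ :=
  2 * (∫ w : EuclideanSpace ℂ (Fin n), Real.exp (-‖w‖ ^ 2)) * k.factorial / (n - 1 + k).factorial

theorem integral_pow_mul_exp_neg_sq (hn : 1 ≤ n) (k : ℕ) :
    ∫ r in Ioi (0 : ℝ), (r : ℂ) ^ (2 * n - 1 + 2 * k) * (Real.exp (-r ^ 2) : ℂ) =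
      (n - 1 + k).factorial / 2 := by
  have h := integral_rpow_mul_exp_neg_rpow (p := 2) (q := (2 * n - 1 + 2 * k : ℕ)) (by norm_num)
    (by have : (0 : ℝ) ≤ (2 * n - 1 + 2 * k : ℕ) := by positivity
        linarith)
  have e : (((2 * n - 1 + 2 * k : ℕ) : ℝ) + 1) / 2 = ((n - 1 + k : ℕ) : ℝ) + 1 := by
    obtain ⟨m, rfl⟩ := Nat.exists_eq_add_of_le hn
    have : 2 * (1 + m) - 1 + 2 * k = 1 + 2 * m + 2 * k := by omega
    rw [this, Nat.add_sub_cancel_left]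
    push_cast
    ring
  rw [e, Real.Gamma_nat_eq_factorial] at h
  have h2 : ∫ r in Ioi (0 : ℝ), (r : ℂ) ^ (2 * n - 1 + 2 * k) * (Real.exp (-r ^ 2) : ℂ) =
      ((∫ r in Ioi (0 : ℝ), r ^ ((2 * n - 1 + 2 * k : ℕ) : ℝ) * Real.exp (-r ^ (2 : ℝ)) : ℝ) : ℂ) := by
    rw [← integral_complex_ofReal]
    refine setIntegral_congr_fun measurableSet_Ioi fun r hr => ?_
    rw [Real.rpow_natCast, Real.rpow_two]
    push_cast
    rfl
  rw [h2, h]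
  push_cast
  ring

variable {f : EuclideanSpace ℂ (Fin n) → ℂ} (hf : DifferentiableOn ℂ f (ball 0 1))

include hf in
-- Under positive real scaling ⟨w,z⟩^k f_k(w) is homogeneous of degree 2k, so its integrals against
-- ψ and against the Gaussian share one spherical factor. The Gaussian integral determines that
-- factor, with radial moment (n-1+k)!/2 in the denominator of `angularConst`.
theorem integral_inner_pow_mul_homComp (hn : 1 ≤ n) (k : ℕ) (z : EuclideanSpace ℂ (Fin n))
    (ψ : ℝ → ℂ) :
    ∫ w, inner ℂ w z ^ k * homComp f k w * ψ ‖w‖ =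
      angularConst n k * homComp f k z * ∫ r in Ioi (0 : ℝ), (r : ℂ) ^ (2 * n - 1 + 2 * k) * ψ r := by
  have hΘ : ∀ t : ℝ, 0 < t → ∀ w : EuclideanSpace ℂ (Fin n),
      inner ℂ ((t : ℂ) • w) z ^ k * homComp f k ((t : ℂ) • w) =
        t ^ (2 * k) * (inner ℂ w z ^ k * homComp f k w) := by
    intro t ht w
    rw [homComp_smul hf k _ (by exact_mod_cast ht.ne'), inner_smul_left, Complex.conj_ofReal]
    ring
  have h1 := integral_homogeneous_mul_radial hn
    (Θ := fun w => inner ℂ w z ^ k * homComp f k w) (m := 2 * k) hΘ (fun r => (Real.exp (-r ^ 2) : ℂ))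
  rw [integral_pow_mul_exp_neg_sq hn] at h1
  have h2 := integral_homComp_mul_inner_pow_mul_exp hf k z
  simp only [mul_comm (homComp f k _)] at h2
  rw [h2] at h1
  rw [integral_homogeneous_mul_radial hn
    (Θ := fun w => inner ℂ w z ^ k * homComp f k w) (m := 2 * k) hΘ ψ]
  congr 1
  have h3 : ((n - 1 + k).factorial : ℂ) ≠ 0 := by exact_mod_cast Nat.factorial_ne_zero _
  rw [angularConst]
  push_cast
  field_simp
  rw [mul_div_assoc', eq_div_iff two_ne_zero] at h1
  rw [← h1]
  ring

include hf in
-- Since ⟨tw,z⟩^k = t^(-k)⟨w,z⟩^k for |t| = 1, the rotation average extracts the degree k component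
-- of f. The vanishing of ψ beyond radius 1 removes the region where nothing is known about f.
theorem integral_inner_pow_mul (hn : 1 ≤ n) (k : ℕ) (z : EuclideanSpace ℂ (Fin n))
    {ψ : ℝ → ℝ} (hψ : ∀ r, 1 ≤ r → ψ r = 0)
    (hint : Integrable fun w : EuclideanSpace ℂ (Fin n) => f w * ψ ‖w‖) :
    ∫ w, inner ℂ w z ^ k * (f w * ψ ‖w‖) =
      angularConst n k * (∫ r in Ioi (0 : ℝ), r ^ (2 * n - 1 + 2 * k) * ψ r : ℝ) *
        homComp f k z := by
  have hF : Integrable fun w : EuclideanSpace ℂ (Fin n) => inner ℂ w z ^ k * (f w * ψ ‖w‖) := by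
    refine Integrable.mono' (hint.norm.const_mul (‖z‖ ^ k))
      ((Continuous.aestronglyMeasurable (by fun_prop)).mul hint.aestronglyMeasurable)
      (Filter.Eventually.of_forall fun w => ?_)
    rcases lt_or_ge ‖w‖ 1 with hw | hw
    · rw [norm_mul, norm_pow]
      gcongr
      refine (norm_inner_le_norm _ _).trans ?_
      nlinarith [norm_nonneg z]
    · simp [hψ _ hw]
  have h1 : ∀ w : EuclideanSpace ℂ (Fin n),
      circleAverage (fun t : ℂ => inner ℂ (t • w) z ^ k * (f (t • w) * ψ ‖t • w‖)) 0 1 =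
        inner ℂ w z ^ k * homComp f k w * ψ ‖w‖ := by
    intro w
    have h2 : circleAverage (fun t : ℂ => inner ℂ (t • w) z ^ k * (f (t • w) * ψ ‖t • w‖)) 0 1 =
        circleAverage (fun t : ℂ => (inner ℂ w z ^ k * ψ ‖w‖) *
          ((t ^ k)⁻¹ * f ((t / (1 : ℝ)) • w))) 0 1 := by
      refine circleAverage_congr_sphere fun t ht => ?_
      have ht' : ‖t‖ = 1 := by simpa using ht
      have hc : conj t = t⁻¹ := (Complex.inv_eq_conj ht').symm
      simp only [inner_smul_left, norm_smul, ht', one_mul, hc, Complex.ofReal_one, div_one, mul_pow,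
        inv_pow]
      ring
    rw [h2, circleAverage_const_mul]
    rcases lt_or_ge ‖w‖ 1 with hw | hw
    · rw [homComp_eq_circleAverage hf k hw]
      simp
      ring
    · simp [hψ _ hw]
  rw [integral_eq_integral_circleAverage hF]
  simp only [h1]
  rw [integral_inner_pow_mul_homComp hf hn k z fun r => (ψ r : ℂ), ← integral_complex_ofReal]
  push_cast
  ring

end RadialMeasures

/-! ### Homogeneous components of powers of the geometric kernel -/

section GeometricSeries

theorem homComp_zero_right {E : Type*} [NormedAddCommGroup E] [NormedSpace ℂ E] (f : E → ℂ)
    (k : ℕ) : homComp f k 0 = 0 ^ k * f 0 := by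
  rcases k with _ | k
  · simp [homComp]
  · simp [homComp, iteratedDeriv_const]

theorem homComp_comp_clm {E : Type*} [NormedAddCommGroup E] [NormedSpace ℂ E] {g : ℂ → ℂ}
    (hg : DifferentiableOn ℂ g (ball 0 1)) (L : E →L[ℂ] ℂ) (k : ℕ) (w : E) :
    homComp (fun w => g (L w)) k w = L w ^ k * homComp g k 1 := by
  have h1 : homComp (fun w => g (L w)) k w = homComp g k (L w) := by simp [homComp]
  rw [h1]
  -- `homComp_smul` only covers nonzero scalars, so the kernel of L is treated by hand.
  by_cases h : L w = 0
  · rw [h, homComp_zero_right]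
    rcases k with _ | k
    · simp [homComp]
    · simp
  · simpa using homComp_smul hg k (L w) h 1

theorem differentiableOn_one_div_one_sub_pow (a : ℕ) :
    DifferentiableOn ℂ (fun x : ℂ => 1 / (1 - x) ^ (a + 1)) (ball 0 1) := by
  refine DifferentiableOn.div (by fun_prop) (by fun_prop) fun x hx => pow_ne_zero _ ?_
  intro h
  rw [mem_ball_zero_iff, ← sub_eq_zero.1 h, norm_one] at hx
  exact lt_irrefl _ hx

theorem homComp_one_div_one_sub_pow (a k : ℕ) :
    homComp (fun x : ℂ => 1 / (1 - x) ^ (a + 1)) k 1 = (a + k).choose a := by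
  have h := (Complex.one_div_one_sub_pow_hasFPowerSeriesOnBall_zero a).factorial_smul 1 k
  have hk : (k.factorial : ℂ) ≠ 0 := by exact_mod_cast k.factorial_ne_zero
  rw [homComp, inv_mul_eq_iff_eq_mul₀ hk]
  simp only [smul_eq_mul, mul_one, iteratedDeriv_eq_iteratedFDeriv]
  rw [← h]
  simp [FormalMultilinearSeries.ofScalars]

theorem homComp_one_div_one_sub_inner_pow {n : ℕ} (a k : ℕ) (y w : EuclideanSpace ℂ (Fin n)) :
    homComp (fun w => 1 / (1 - inner ℂ y w) ^ (a + 1)) k w =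
      ((a + k).choose a) * inner ℂ y w ^ k := by
  have := homComp_comp_clm (differentiableOn_one_div_one_sub_pow a) (innerSL ℂ y) k w
  simp only [innerSL_apply_apply, homComp_one_div_one_sub_pow] at this
  rw [this, mul_comm]

end GeometricSeries

/-! ### Radial integrals of even powers of 1/|1-⟨y,w⟩| -/

section SquareKernel

theorem choose_add_le_pow (a k : ℕ) : (a + k).choose a ≤ (k + 1) ^ a := by
  induction a with
  | zero => simp
  | succ a ih =>
    have h := Nat.add_one_mul_choose_eq (a + k) a
    refine Nat.le_of_mul_le_mul_right (c := a + 1) ?_ (Nat.succ_pos a)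
    have e : a + 1 + k = (a + k).succ := by omega
    rw [e, ← h, pow_succ, mul_assoc, mul_comm]
    refine Nat.mul_le_mul ih ?_
    nlinarith [Nat.zero_le (a * k)]

/-- Growth count in k: the squared binomial is at most of order k^(2a), `angularConst` decays like
k^(-(n-1)), and i! times the binomial on the right is at least (k+1)^i, where i = 2a-(n-1). -/
theorem sq_choose_mul_angularConst_le {n a i : ℕ} (h : 2 * a = (n - 1) + i) (k : ℕ) :
    ((a + k).choose a : ℝ) ^ 2 * angularConst n k ≤
      2 * (∫ w : EuclideanSpace ℂ (Fin n), Real.exp (-‖w‖ ^ 2)) * i.factorial *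
        (i + k).choose i := by
  have hG := gaussian_integral_pos (n := n)
  set G := ∫ w : EuclideanSpace ℂ (Fin n), Real.exp (-‖w‖ ^ 2)
  have h1 : ((a + k).choose a : ℝ) ≤ ((k : ℝ) + 1) ^ a := by exact_mod_cast choose_add_le_pow a k
  have h2 : (k.factorial : ℝ) * ((k : ℝ) + 1) ^ (n - 1) ≤ (n - 1 + k).factorial := by
    rw [add_comm (n - 1)]
    exact_mod_cast Nat.factorial_mul_pow_le_factorial
  have h3 : (k.factorial : ℝ) * ((k : ℝ) + 1) ^ i ≤ (k + i).factorial := by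
    exact_mod_cast Nat.factorial_mul_pow_le_factorial
  have h4 : ((i + k).choose i : ℝ) * i.factorial * k.factorial = (k + i).factorial := by
    rw [add_comm k i]
    have := Nat.choose_mul_factorial_mul_factorial (Nat.le_add_right i k)
    rw [Nat.add_sub_cancel_left] at this
    exact_mod_cast this
  have hk : (0 : ℝ) < k.factorial := by positivity
  have h5 : ((k : ℝ) + 1) ^ i ≤ (i + k).choose i * i.factorial := by
    rw [← h4, mul_comm (k.factorial : ℝ)] at h3
    exact le_of_mul_le_mul_right h3 hk
  rw [angularConst, mul_div_assoc']
  rw [div_le_iff₀ (by positivity)]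
  calc ((a + k).choose a : ℝ) ^ 2 * (2 * G * k.factorial)
      ≤ (((k : ℝ) + 1) ^ a) ^ 2 * (2 * G * k.factorial) := by gcongr
    _ = 2 * G * ((k : ℝ) + 1) ^ i * (k.factorial * ((k : ℝ) + 1) ^ (n - 1)) := by
      rw [← pow_mul, mul_comm a 2, h, pow_add]; ring
    _ ≤ 2 * G * ((i + k).choose i * i.factorial) * (n - 1 + k).factorial := by gcongr
    _ = _ := by ring

variable {n : ℕ}

theorem norm_inner_lt_one {y w : EuclideanSpace ℂ (Fin n)} (hy : ‖y‖ < 1) (hw : ‖w‖ < 1) :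
    ‖inner ℂ y w‖ < 1 :=
  (norm_inner_le_norm _ _).trans_lt (mul_lt_one_of_nonneg_of_lt_one_left (norm_nonneg _) hy hw.le)

theorem one_sub_ne_zero_of_norm_lt {x : ℂ} (hx : ‖x‖ < 1) : 1 - x ≠ 0 := by
  intro h
  rw [← sub_eq_zero.1 h, norm_one] at hx
  exact lt_irrefl _ hx

/-- The integrand is the product of f = (1-⟨y,w⟩)^(-(a+1)), its conjugate and ψ. Expanding the
conjugate in powers of ⟨w,y⟩ and applying `integral_inner_pow_mul` to f gives a series of radial
moments with squared binomial coefficients. Comparing coefficients with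
`sq_choose_mul_angularConst_le` and resumming under the radial integral gives the right side. -/
theorem integral_div_norm_one_sub_inner_le (hn : 1 ≤ n) {a i : ℕ} (h : 2 * a = (n - 1) + i)
    {ψ : ℝ → ℝ} (hψ : ∀ r, 1 ≤ r → ψ r = 0) (hψ0 : ∀ r, 0 ≤ ψ r)
    (hint : Integrable fun w : EuclideanSpace ℂ (Fin n) => ψ ‖w‖)
    {y : EuclideanSpace ℂ (Fin n)} (hy : ‖y‖ < 1) :
    ∫ w : EuclideanSpace ℂ (Fin n), ψ ‖w‖ / ‖1 - inner ℂ y w‖ ^ (2 * (a + 1)) ≤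
      2 * (∫ w : EuclideanSpace ℂ (Fin n), Real.exp (-‖w‖ ^ 2)) * i.factorial *
        ∫ r in Ioi (0 : ℝ), r ^ (2 * n - 1) * ψ r / (1 - (r * ‖y‖) ^ 2) ^ (i + 1) := by
  have : Nonempty (Fin n) := ⟨⟨0, hn⟩⟩
  set f : EuclideanSpace ℂ (Fin n) → ℂ := fun w => 1 / (1 - inner ℂ y w) ^ (a + 1) with hf_def
  have hy0 := norm_nonneg y
  have hf : DifferentiableOn ℂ f (ball 0 1) := by
    have hd : DifferentiableOn ℂ (fun w : EuclideanSpace ℂ (Fin n) => innerSL ℂ y w) (ball 0 1) :=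
      (innerSL ℂ y).differentiable.differentiableOn
    refine (differentiableOn_one_div_one_sub_pow a).comp hd fun w hw => ?_
    simpa using norm_inner_lt_one hy (by simpa using hw)
  have hfm : Measurable f := by
    have : Continuous fun w : EuclideanSpace ℂ (Fin n) => inner ℂ y w := by fun_prop
    exact measurable_const.div ((measurable_const.sub this.measurable).pow_const _)
  have hfb : ∀ w : EuclideanSpace ℂ (Fin n), ‖w‖ < 1 → ‖f w‖ ≤ 1 / (1 - ‖y‖) ^ (a + 1) := by
    intro w hw
    rw [hf_def, norm_div, norm_one, norm_pow]
    have h1 : 1 - ‖y‖ ≤ ‖1 - inner ℂ y w‖ := by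
      have h2 := norm_sub_norm_le (1 : ℂ) (inner ℂ y w)
      have h3 : ‖inner ℂ y w‖ ≤ ‖y‖ * ‖w‖ := norm_inner_le_norm _ _
      rw [norm_one] at h2
      nlinarith
    have : 0 < 1 - ‖y‖ := by linarith
    gcongr
  have hfint : Integrable fun w : EuclideanSpace ℂ (Fin n) => f w * ψ ‖w‖ := by
    refine Integrable.mono' (hint.const_mul (1 / (1 - ‖y‖) ^ (a + 1)))
      (hfm.aestronglyMeasurable.mul
        (Complex.continuous_ofReal.comp_aestronglyMeasurable hint.aestronglyMeasurable))
      (Filter.Eventually.of_forall fun w => ?_)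
    rw [norm_mul, Complex.norm_real, Real.norm_of_nonneg (hψ0 _)]
    rcases lt_or_ge ‖w‖ 1 with hw | hw
    · exact mul_le_mul_of_nonneg_right (hfb w hw) (hψ0 _)
    · simp [hψ _ hw]
  have hradial : IntegrableOn (fun r : ℝ => r ^ (2 * n - 1) * ψ r) (Ioi 0) := by
    have := (integrable_fun_norm_addHaar (volume : Measure (EuclideanSpace ℂ (Fin n)))).1 hint
    rwa [finrank_real_euclideanSpace_complex] at this
  -- expansion of the left-hand side
  have hsum1 : ∀ w : EuclideanSpace ℂ (Fin n), HasSum (fun k : ℕ => ((a + k).choose a : ℂ) *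
      (inner ℂ w y ^ k * (f w * ψ ‖w‖))) ((ψ ‖w‖ / ‖1 - inner ℂ y w‖ ^ (2 * (a + 1)) : ℝ) : ℂ) := by
    intro w
    rcases lt_or_ge ‖w‖ 1 with hw | hw
    · have h1 := (hasSum_choose_mul_geometric_of_norm_lt_one a (norm_inner_lt_one hw hy)).mul_right
        (f w * ψ ‖w‖)
      have e1 : 1 / (1 - inner ℂ w y) ^ (a + 1) * (f w * ψ ‖w‖) =
          ((ψ ‖w‖ / ‖1 - inner ℂ y w‖ ^ (2 * (a + 1)) : ℝ) : ℂ) := by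
        have h2 : (1 - inner ℂ w y) = conj (1 - inner ℂ y w) := by simp
        have h3 := one_sub_ne_zero_of_norm_lt (norm_inner_lt_one hy hw)
        rw [h2, hf_def, pow_mul, ← Complex.normSq_eq_norm_sq]
        push_cast
        rw [Complex.normSq_eq_conj_mul_self]
        have h4 : conj (1 - inner ℂ y w) ≠ 0 := (map_ne_zero _).2 h3
        rw [mul_pow]
        field_simp
      rw [e1] at h1
      refine h1.congr_fun fun k => ?_
      rw [add_comm k a, mul_assoc]
    · simp [hψ _ hw, hasSum_zero]
  have hterm : ∀ k : ℕ, ∀ w : EuclideanSpace ℂ (Fin n), ‖((a + k).choose a : ℂ) *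
      (inner ℂ w y ^ k * (f w * ψ ‖w‖))‖ ≤
        (((k + a).choose a : ℝ) * ‖y‖ ^ k) * ‖f w * (ψ ‖w‖ : ℂ)‖ := by
    intro k w
    rcases lt_or_ge ‖w‖ 1 with hw | hw
    · rw [norm_mul, norm_mul, norm_pow, ← mul_assoc, add_comm a k]
      simp only [Complex.norm_natCast]
      gcongr
      refine (norm_inner_le_norm _ _).trans ?_
      nlinarith
    · simp [hψ _ hw]
  have htint : ∀ k : ℕ, Integrable fun w : EuclideanSpace ℂ (Fin n) => ((a + k).choose a : ℂ) *
      (inner ℂ w y ^ k * (f w * ψ ‖w‖)) := fun k =>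
    Integrable.mono' (hfint.norm.const_mul _)
      (((Continuous.aestronglyMeasurable (by fun_prop)).mul hfint.aestronglyMeasurable).const_mul _)
      (Filter.Eventually.of_forall (hterm k))
  have hgeo : Summable fun k : ℕ => ((k + a).choose a : ℝ) * ‖y‖ ^ k :=
    (hasSum_choose_mul_geometric_of_norm_lt_one a
      (by rwa [norm_norm] : ‖(‖y‖ : ℝ)‖ < 1)).summable
  have hL := hasSum_integral_of_summable_integral_norm htint (by
    refine Summable.of_nonneg_of_le (fun k => integral_nonneg fun _ => norm_nonneg _) (fun k => ?_)
      (hgeo.mul_right (∫ w : EuclideanSpace ℂ (Fin n), ‖f w * (ψ ‖w‖ : ℂ)‖))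
    rw [← integral_const_mul]
    exact integral_mono (htint k).norm (hfint.norm.const_mul _) (hterm k))
  simp only [fun w => (hsum1 w).tsum_eq, integral_complex_ofReal, integral_const_mul,
    integral_inner_pow_mul hf hn _ y hψ hfint] at hL
  have hL' : HasSum (fun k : ℕ => ((a + k).choose a : ℝ) ^ 2 * angularConst n k *
      (‖y‖ ^ (2 * k) * ∫ r in Ioi (0 : ℝ), r ^ (2 * n - 1 + 2 * k) * ψ r))
      (∫ w : EuclideanSpace ℂ (Fin n), ψ ‖w‖ / ‖1 - inner ℂ y w‖ ^ (2 * (a + 1))) := by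
    rw [← Complex.hasSum_ofReal]
    refine hL.congr_fun fun k => ?_
    have hyy : inner ℂ y y = ((‖y‖ : ℝ) : ℂ) ^ 2 := inner_self_eq_norm_sq_to_K y
    rw [hf_def, homComp_one_div_one_sub_inner_pow, hyy]
    push_cast
    ring
  -- expansion of the right-hand side
  have hpow : ∀ k : ℕ, ∀ r ∈ Ioi (0 : ℝ), ‖((i + k).choose i : ℝ) *
      (‖y‖ ^ (2 * k) * (r ^ (2 * n - 1 + 2 * k) * ψ r))‖ ≤
        (((k + i).choose i : ℝ) * (‖y‖ ^ 2) ^ k) * ‖r ^ (2 * n - 1) * ψ r‖ := by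
    intro k r hr0
    have hr0' : 0 < r := hr0
    rcases lt_or_ge r 1 with hr | hr
    · have h1 : r ^ (2 * n - 1 + 2 * k) ≤ r ^ (2 * n - 1) :=
        pow_le_pow_of_le_one hr0'.le hr.le (Nat.le_add_right _ _)
      have h2 := hψ0 r
      rw [Real.norm_of_nonneg (by positivity), Real.norm_of_nonneg (by positivity), ← mul_assoc,
        ← pow_mul, add_comm i k]
      gcongr
    · simp [hψ _ hr]
  have hrint : ∀ k : ℕ, IntegrableOn (fun r : ℝ => ((i + k).choose i : ℝ) *
      (‖y‖ ^ (2 * k) * (r ^ (2 * n - 1 + 2 * k) * ψ r))) (Ioi 0) := by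
    intro k
    refine Integrable.mono' (hradial.norm.const_mul _) ?_
      ((ae_restrict_mem measurableSet_Ioi).mono (hpow k))
    have h1 : AEStronglyMeasurable (fun r : ℝ => r ^ (2 * k) * (r ^ (2 * n - 1) * ψ r))
        (volume.restrict (Ioi 0)) :=
      (Continuous.aestronglyMeasurable (by fun_prop)).mul hradial.aestronglyMeasurable
    have h2 : (fun r : ℝ => r ^ (2 * n - 1 + 2 * k) * ψ r) =
        fun r => r ^ (2 * k) * (r ^ (2 * n - 1) * ψ r) := by
      ext r
      rw [pow_add]
      ring
    have h3 := (h1.const_mul (‖y‖ ^ (2 * k))).const_mul ((i + k).choose i : ℝ)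
    refine h3.congr (Filter.Eventually.of_forall fun r => ?_)
    simp only [congrFun h2 r]
  have hy2 : ‖(‖y‖ ^ 2 : ℝ)‖ < 1 := by
    rw [Real.norm_of_nonneg (by positivity)]
    nlinarith
  have hR := hasSum_integral_of_summable_integral_norm hrint (by
    refine Summable.of_nonneg_of_le (fun k => integral_nonneg fun _ => norm_nonneg _) (fun k => ?_)
      ((hasSum_choose_mul_geometric_of_norm_lt_one i hy2).summable.mul_right
        (∫ r in Ioi (0 : ℝ), ‖r ^ (2 * n - 1) * ψ r‖))
    rw [← integral_const_mul]
    exact setIntegral_mono_on (hrint k).norm (hradial.norm.const_mul _) measurableSet_Ioi (hpow k))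
  have hR1 : ∀ r ∈ Ioi (0 : ℝ), ∑' k : ℕ, ((i + k).choose i : ℝ) *
      (‖y‖ ^ (2 * k) * (r ^ (2 * n - 1 + 2 * k) * ψ r)) =
      r ^ (2 * n - 1) * ψ r / (1 - (r * ‖y‖) ^ 2) ^ (i + 1) := by
    intro r hr0
    have hr0' : 0 < r := hr0
    rcases lt_or_ge r 1 with hr | hr
    · have h1 : ‖((r * ‖y‖) ^ 2 : ℝ)‖ < 1 := by
        rw [Real.norm_of_nonneg (by positivity)]
        have : r * ‖y‖ < 1 := mul_lt_one_of_nonneg_of_lt_one_left hr0'.le hr hy.le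
        have : 0 ≤ r * ‖y‖ := by positivity
        nlinarith
      have h2 := (hasSum_choose_mul_geometric_of_norm_lt_one i h1).mul_right (r ^ (2 * n - 1) * ψ r)
      rw [one_div_mul_eq_div] at h2
      rw [← h2.tsum_eq]
      refine tsum_congr fun k => ?_
      rw [add_comm k i]
      ring
    · simp [hψ _ hr]
  rw [setIntegral_congr_fun measurableSet_Ioi hR1] at hR
  simp only [integral_const_mul] at hR
  refine hasSum_le (fun k => ?_) hL' (hR.mul_left _)
  rw [← mul_assoc (2 * (∫ w : EuclideanSpace ℂ (Fin n), Real.exp (-‖w‖ ^ 2)) * i.factorial)]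
  refine mul_le_mul_of_nonneg_right (sq_choose_mul_angularConst_le h k) (mul_nonneg (by positivity) ?_)
  exact setIntegral_nonneg measurableSet_Ioi fun r hr =>
    mul_nonneg (pow_nonneg (le_of_lt hr) _) (hψ0 r)

end SquareKernel

/-! ### A one-dimensional integral estimate -/

section OneDimensional

theorem lintegral_rpow_Ioo {r : ℝ} (hr : -1 < r) {c : ℝ} (hc : 0 ≤ c) :
    ∫⁻ v in Ioo 0 c, ENNReal.ofReal (v ^ r) = ENNReal.ofReal (c ^ (r + 1) / (r + 1)) := by
  rw [← ofReal_integral_eq_lintegral_ofReal]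
  · rw [← integral_Ioc_eq_integral_Ioo, ← intervalIntegral.integral_of_le hc,
      integral_rpow (Or.inl hr), zero_rpow (by linarith), sub_zero]
  · have := (intervalIntegral.intervalIntegrable_rpow' (a := 0) (b := c) hr).1
    exact this.mono_set Ioo_subset_Ioc_self
  · filter_upwards [ae_restrict_mem measurableSet_Ioo] with v hv
    exact rpow_nonneg hv.1.le _

theorem lintegral_rpow_Ioo_le {t : ℝ} (ht : 0 < t) {c : ℝ} (hc : 0 < c) (hc1 : c ≤ 1) :
    ∫⁻ v in Ioo c 1, ENNReal.ofReal (v ^ (-1 - t)) ≤ ENNReal.ofReal (c ^ (-t) / t) := by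
  rw [← ofReal_integral_eq_lintegral_ofReal]
  · apply ENNReal.ofReal_le_ofReal
    rw [← integral_Ioc_eq_integral_Ioo, ← intervalIntegral.integral_of_le hc1,
      integral_rpow (Or.inr ⟨by linarith, by rw [uIcc_of_le hc1]; exact fun h => by linarith [h.1]⟩),
      one_rpow]
    have e : -1 - t + 1 = -t := by ring
    rw [e, div_neg, ← neg_div]
    gcongr
    linarith
  · have : IntervalIntegrable (fun v : ℝ => v ^ (-1 - t)) volume c 1 :=
      intervalIntegral.intervalIntegrable_rpow
        (Or.inr (by rw [uIcc_of_le hc1]; exact fun h => by linarith [h.1]))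
    exact this.1.mono_set Ioo_subset_Ioc_self
  · filter_upwards [ae_restrict_mem measurableSet_Ioo] with v hv
    exact rpow_nonneg (hc.le.trans hv.1.le) _

theorem rpow_le_two_rpow_abs {v : ℝ} (h1 : 1 / 2 ≤ v) (h2 : v ≤ 1) (s : ℝ) :
    v ^ s ≤ 2 ^ |s| := by
  have hv : 0 < v := by linarith
  rcases le_total 0 s with hs | hs
  · exact (rpow_le_one hv.le h2 hs).trans (one_le_rpow (by norm_num) (abs_nonneg s))
  · calc v ^ s ≤ (1 / 2) ^ s := rpow_le_rpow_of_nonpos (by norm_num) h1 hs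
      _ = 2 ^ |s| := by
        rw [abs_of_nonpos hs, one_div, inv_rpow (by norm_num), rpow_neg (by norm_num)]

/-- Put τ = 1-x. For v < 1/2 only v^(A-1) matters. For v ≥ 1/2 with 1-v < τ, the last factor is at
most τ^(-(s+1+t)), and integrating (1-v)^s supplies τ^(s+1). For 1-v ≥ τ, replacing 1-xv by the
smaller 1-v leaves (1-v)^(-1-t), whose integral is at most τ^(-t)/t. -/
theorem exists_lintegral_rpow_mul_one_sub_rpow_le {A s t : ℝ} (hA : 0 < A) (hs : -1 < s)
    (ht : 0 < t) : ∃ C : ℝ, 0 < C ∧ ∀ x : ℝ, 0 ≤ x → x < 1 →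
      ∫⁻ v in Ioo (0 : ℝ) 1,
        ENNReal.ofReal (v ^ (A - 1) * (1 - v) ^ s * (1 - x * v) ^ (-(s + 1 + t))) ≤
      ENNReal.ofReal (C * (1 - x) ^ (-t)) := by
  set C₁ : ℝ := 2 ^ |s| * 2 ^ |-(s + 1 + t)| with hC₁
  set C₂ : ℝ := 2 ^ |A - 1| with hC₂
  have hC₁0 : 0 < C₁ := by positivity
  have hC₂0 : 0 < C₂ := by positivity
  have hs1 : 0 < s + 1 := by linarith
  -- One summand for each of the three regions; the first, a bounded contribution, is absorbed
  -- because τ^(-t) ≥ 1.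
  refine ⟨C₁ / A + C₂ / (s + 1) + C₂ / t, by positivity, fun x hx0 hx1 => ?_⟩
  set τ : ℝ := 1 - x with hτ
  have hτ0 : 0 < τ := by linarith
  have hτ1 : τ ≤ 1 := by linarith
  have hpt : ∀ v ∈ Ioo (0 : ℝ) 1,
      v ^ (A - 1) * (1 - v) ^ s * (1 - x * v) ^ (-(s + 1 + t)) ≤
        C₁ * v ^ (A - 1) + (C₂ * τ ^ (-(s + 1 + t)) * (Ioo 0 τ).indicator (fun y => y ^ s) (1 - v) +
          C₂ * (Ico τ 1).indicator (fun y => y ^ (-1 - t)) (1 - v)) := by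
    intro v hv
    obtain ⟨hv0, hv1⟩ := hv
    have hv1' : 0 < 1 - v := by linarith
    have hxv : 1 - v ≤ 1 - x * v := by nlinarith
    have hxv' : τ ≤ 1 - x * v := by rw [hτ]; nlinarith
    have hxv0 : 0 < 1 - x * v := by linarith
    have hxv1 : 1 - x * v ≤ 1 := by nlinarith
    have hi1 : 0 ≤ (Ioo 0 τ).indicator (fun y : ℝ => y ^ s) (1 - v) :=
      indicator_apply_nonneg fun h => rpow_nonneg h.1.le _
    have hi2 : 0 ≤ (Ico τ 1).indicator (fun y : ℝ => y ^ (-1 - t)) (1 - v) :=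
      indicator_apply_nonneg fun h => rpow_nonneg (hτ0.le.trans h.1) _
    rcases lt_or_ge v (1 / 2) with hvh | hvh
    · refine le_add_of_le_of_nonneg ?_ (by positivity)
      calc v ^ (A - 1) * (1 - v) ^ s * (1 - x * v) ^ (-(s + 1 + t))
          ≤ v ^ (A - 1) * 2 ^ |s| * 2 ^ |-(s + 1 + t)| := by
            gcongr
            · exact rpow_le_two_rpow_abs (by linarith) (by linarith) _
            · exact rpow_le_two_rpow_abs (by nlinarith) (by linarith) _
        _ = _ := by rw [hC₁]; ring
    · refine le_add_of_nonneg_of_le (by positivity) ?_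
      have hvA := rpow_le_two_rpow_abs hvh hv1.le (A - 1)
      rcases lt_or_ge (1 - v) τ with hvt | hvt
      · refine le_add_of_le_of_nonneg ?_ (by positivity)
        rw [indicator_of_mem (by exact ⟨hv1', hvt⟩)]
        have : (1 - x * v) ^ (-(s + 1 + t)) ≤ τ ^ (-(s + 1 + t)) :=
          rpow_le_rpow_of_nonpos hτ0 hxv' (by linarith)
        calc v ^ (A - 1) * (1 - v) ^ s * (1 - x * v) ^ (-(s + 1 + t))
            ≤ C₂ * (1 - v) ^ s * τ ^ (-(s + 1 + t)) := by gcongr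
          _ = _ := by ring
      · refine le_add_of_nonneg_of_le (by positivity) ?_
        rw [indicator_of_mem (by exact ⟨hvt, by linarith⟩)]
        have : (1 - x * v) ^ (-(s + 1 + t)) ≤ (1 - v) ^ (-(s + 1 + t)) :=
          rpow_le_rpow_of_nonpos hv1' hxv (by linarith)
        calc v ^ (A - 1) * (1 - v) ^ s * (1 - x * v) ^ (-(s + 1 + t))
            ≤ C₂ * (1 - v) ^ s * (1 - v) ^ (-(s + 1 + t)) := by gcongr
          _ = C₂ * (1 - v) ^ (-1 - t) := by
            rw [mul_assoc, ← rpow_add hv1']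
            congr 2
            ring
  have hflip : ∀ g : ℝ → ℝ≥0∞,
      ∫⁻ v in Ioo (0 : ℝ) 1, g (1 - v) = ∫⁻ v in Ioo (0 : ℝ) 1, g v := by
    intro g
    rw [← lintegral_indicator measurableSet_Ioo, ← lintegral_indicator measurableSet_Ioo,
      ← lintegral_sub_left_eq_self _ (1 : ℝ)]
    congr 1
    ext v
    have : 1 - v ∈ Ioo (0 : ℝ) 1 ↔ v ∈ Ioo (0 : ℝ) 1 :=
      ⟨fun h => ⟨by linarith [h.2], by linarith [h.1]⟩, fun h => ⟨by linarith [h.2], by linarith [h.1]⟩⟩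
    by_cases h : v ∈ Ioo (0 : ℝ) 1
    · simp [indicator_of_mem h, indicator_of_mem (this.2 h)]
    · simp [indicator_of_notMem h, indicator_of_notMem (mt this.1 h)]
  have hm1 : Measurable ((Ioo 0 τ).indicator fun y : ℝ => y ^ s) :=
    (measurable_id.pow_const s).indicator measurableSet_Ioo
  have hm2 : Measurable ((Ico τ 1).indicator fun y : ℝ => y ^ (-1 - t)) :=
    (measurable_id.pow_const _).indicator measurableSet_Ico
  have hI1 : ∫⁻ v in Ioo (0 : ℝ) 1, ENNReal.ofReal ((Ioo 0 τ).indicator (fun y => y ^ s) (1 - v)) ≤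
      ENNReal.ofReal (τ ^ (s + 1) / (s + 1)) := by
    rw [hflip fun v => ENNReal.ofReal ((Ioo 0 τ).indicator (fun y => y ^ s) v)]
    rw [← lintegral_rpow_Ioo hs hτ0.le, ← lintegral_indicator measurableSet_Ioo,
      ← lintegral_indicator measurableSet_Ioo]
    refine lintegral_mono fun v => ?_
    by_cases h : v ∈ Ioo 0 τ <;> by_cases h' : v ∈ Ioo (0 : ℝ) 1 <;> simp [h, h']
  have hI2 : ∫⁻ v in Ioo (0 : ℝ) 1,
      ENNReal.ofReal ((Ico τ 1).indicator (fun y => y ^ (-1 - t)) (1 - v)) ≤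
      ENNReal.ofReal (τ ^ (-t) / t) := by
    rw [hflip fun v => ENNReal.ofReal ((Ico τ 1).indicator (fun y => y ^ (-1 - t)) v)]
    refine le_trans ?_ (lintegral_rpow_Ioo_le ht hτ0 hτ1)
    rw [setLIntegral_congr (Ioo_ae_eq_Ico (a := τ) (b := (1 : ℝ))),
      ← lintegral_indicator measurableSet_Ico, ← lintegral_indicator measurableSet_Ioo]
    refine lintegral_mono fun v => ?_
    by_cases h : v ∈ Ico τ 1 <;> by_cases h' : v ∈ Ioo (0 : ℝ) 1 <;> simp [h, h']
  have hI0 := lintegral_rpow_Ioo (r := A - 1) (by linarith) zero_le_one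
  rw [one_rpow, sub_add_cancel] at hI0
  have hτt : 1 ≤ τ ^ (-t) := one_le_rpow_of_pos_of_le_one_of_nonpos hτ0 hτ1 (by linarith)
  have hτp : 0 ≤ τ ^ (-(s + 1 + t)) := rpow_nonneg hτ0.le _
  calc ∫⁻ v in Ioo (0 : ℝ) 1,
        ENNReal.ofReal (v ^ (A - 1) * (1 - v) ^ s * (1 - x * v) ^ (-(s + 1 + t)))
      ≤ ∫⁻ v in Ioo (0 : ℝ) 1, (ENNReal.ofReal C₁ * ENNReal.ofReal (v ^ (A - 1)) +
          (ENNReal.ofReal (C₂ * τ ^ (-(s + 1 + t))) *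
            ENNReal.ofReal ((Ioo 0 τ).indicator (fun y => y ^ s) (1 - v)) +
          ENNReal.ofReal C₂ *
            ENNReal.ofReal ((Ico τ 1).indicator (fun y => y ^ (-1 - t)) (1 - v)))) := by
        refine setLIntegral_mono' measurableSet_Ioo fun v hv => ?_
        refine (ENNReal.ofReal_le_ofReal (hpt v hv)).trans ?_
        rw [← ENNReal.ofReal_mul hC₁0.le, ← ENNReal.ofReal_mul (by positivity),
          ← ENNReal.ofReal_mul hC₂0.le]
        exact ENNReal.ofReal_add_le.trans (by gcongr; exact ENNReal.ofReal_add_le)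
    _ ≤ ENNReal.ofReal C₁ * ENNReal.ofReal (1 / A) +
          (ENNReal.ofReal (C₂ * τ ^ (-(s + 1 + t))) * ENNReal.ofReal (τ ^ (s + 1) / (s + 1)) +
          ENNReal.ofReal C₂ * ENNReal.ofReal (τ ^ (-t) / t)) := by
        have hm1' : Measurable fun v : ℝ =>
            ENNReal.ofReal ((Ioo 0 τ).indicator (fun y => y ^ s) (1 - v)) :=
          (hm1.comp (measurable_const.sub measurable_id)).ennreal_ofReal
        have hm2' : Measurable fun v : ℝ =>
            ENNReal.ofReal ((Ico τ 1).indicator (fun y => y ^ (-1 - t)) (1 - v)) :=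
          (hm2.comp (measurable_const.sub measurable_id)).ennreal_ofReal
        rw [lintegral_add_left (by fun_prop), lintegral_add_left (hm1'.const_mul _),
          lintegral_const_mul _ (by fun_prop), lintegral_const_mul _ hm1',
          lintegral_const_mul _ hm2', hI0]
        gcongr
    _ = ENNReal.ofReal (C₁ / A + (C₂ / (s + 1) * τ ^ (-t) + C₂ / t * τ ^ (-t))) := by
        rw [← ENNReal.ofReal_mul hC₁0.le, ← ENNReal.ofReal_mul (by positivity),
          ← ENNReal.ofReal_mul hC₂0.le, ← ENNReal.ofReal_add (by positivity) (by positivity),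
          ← ENNReal.ofReal_add (by positivity) (by positivity)]
        congr 1
        have : τ ^ (-(s + 1 + t)) * τ ^ (s + 1) = τ ^ (-t) := by
          rw [← rpow_add hτ0]; congr 1; ring
        rw [← this]
        ring
    _ ≤ _ := by
        apply ENNReal.ofReal_le_ofReal
        have : C₁ / A ≤ C₁ / A * τ ^ (-t) := le_mul_of_one_le_right (by positivity) hτt
        linarith

end OneDimensional

/-! ### The Beta integral -/

section BetaIntegral

open ProbabilityTheory

/-- This is the total mass one of the Beta distribution, multiplied through by its normalizing
constant. -/
theorem lintegral_rpow_mul_one_sub_rpow {α β : ℝ} (hα : 0 < α) (hβ : 0 < β) :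
    ∫⁻ u in Ioo (0 : ℝ) 1, ENNReal.ofReal (u ^ (α - 1) * (1 - u) ^ (β - 1)) =
      ENNReal.ofReal (beta α β) := by
  have hb := beta_pos hα hβ
  have h := lintegral_betaPDF_eq_one hα hβ
  rw [lintegral_betaPDF] at h
  simp only [mul_assoc] at h
  simp only [ENNReal.ofReal_mul (one_div_pos.2 hb).le] at h
  rw [lintegral_const_mul _ (by fun_prop)] at h
  calc _ = ENNReal.ofReal (beta α β) * (ENNReal.ofReal (1 / beta α β) *
      ∫⁻ u in Ioo (0 : ℝ) 1, ENNReal.ofReal (u ^ (α - 1) * (1 - u) ^ (β - 1))) := by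
        rw [← mul_assoc, ← ENNReal.ofReal_mul hb.le, mul_one_div_cancel hb.ne', ENNReal.ofReal_one,
          one_mul]
    _ = _ := by rw [h, mul_one]

theorem rpow_mul_one_sub_rpow_nonneg {α β u : ℝ} (hu : u ∈ Ioo (0 : ℝ) 1) :
    0 ≤ u ^ α * (1 - u) ^ β :=
  mul_nonneg (rpow_nonneg hu.1.le _) (rpow_nonneg (by linarith [hu.2]) _)

theorem integrableOn_rpow_mul_one_sub_rpow {α β : ℝ} (hα : 0 < α) (hβ : 0 < β) :
    IntegrableOn (fun u : ℝ => u ^ (α - 1) * (1 - u) ^ (β - 1)) (Ioo 0 1) := by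
  refine ⟨Measurable.aestronglyMeasurable (by fun_prop), ?_⟩
  rw [hasFiniteIntegral_iff_ofReal ((ae_restrict_mem measurableSet_Ioo).mono fun u hu =>
    rpow_mul_one_sub_rpow_nonneg hu), lintegral_rpow_mul_one_sub_rpow hα hβ]
  exact ENNReal.ofReal_lt_top

theorem integral_rpow_mul_one_sub_rpow {α β : ℝ} (hα : 0 < α) (hβ : 0 < β) :
    ∫ u in Ioo (0 : ℝ) 1, u ^ (α - 1) * (1 - u) ^ (β - 1) = beta α β := by
  rw [integral_eq_lintegral_of_nonneg_ae ((ae_restrict_mem measurableSet_Ioo).mono fun u hu =>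
    rpow_mul_one_sub_rpow_nonneg hu) (Measurable.aestronglyMeasurable (by fun_prop)),
    lintegral_rpow_mul_one_sub_rpow hα hβ, ENNReal.toReal_ofReal (beta_pos hα hβ).le]

end BetaIntegral

/-! ### Coefficients of the Bergman kernel and a pointwise bound -/

section KernelSeries

theorem Gamma_add_natCast {x : ℝ} (hx : 0 < x) (j : ℕ) :
    Gamma (x + j) = (∏ i ∈ Finset.range j, (x + i)) * Gamma x := by
  induction j with
  | zero => simp
  | succ j ih =>
    have : x + (j + 1 : ℕ) = x + j + 1 := by push_cast; ring
    rw [this, Real.Gamma_add_one (by positivity), ih, Finset.prod_range_succ]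
    ring

/-- The sequences that are linear combinations of `k ↦ (k + l).choose l` for `l ≤ d`. -/
def chooseSpan (d : ℕ) : Submodule ℝ (ℕ → ℝ) :=
  Submodule.span ℝ {q | ∃ l ≤ d, q = fun k => ((k + l).choose l : ℝ)}

/-- It rests on (β+k) C(k+l,l) = (l+1) C(k+l+1,l+1) + (β-l-1) C(k+l,l). Iterating places products of
linear factors in k in the span, whose generating functions are explicit. -/
theorem mul_mem_chooseSpan {d : ℕ} {q : ℕ → ℝ} (hq : q ∈ chooseSpan d) (β : ℝ) :
    (fun k => (β + k) * q k) ∈ chooseSpan (d + 1) := by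
  induction hq using Submodule.span_induction with
  | mem q hq =>
    obtain ⟨l, hl, rfl⟩ := hq
    have e : (fun k : ℕ => (β + k) * ((k + l).choose l : ℝ)) =
        ((l : ℝ) + 1) • (fun k : ℕ => ((k + (l + 1)).choose (l + 1) : ℝ)) +
          (β - l - 1) • fun k : ℕ => ((k + l).choose l : ℝ) := by
      ext k
      have h : ((k + l + 1 : ℕ) : ℝ) * ((k + l).choose l : ℝ) =
          ((k + (l + 1)).choose (l + 1) : ℝ) * (l + 1) := by
        exact_mod_cast Nat.add_one_mul_choose_eq (k + l) l
      push_cast at h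
      simp only [Pi.add_apply, Pi.smul_apply, smul_eq_mul]
      linear_combination h
    rw [e]
    exact add_mem (Submodule.smul_mem _ _ (Submodule.subset_span ⟨l + 1, by omega, rfl⟩))
      (Submodule.smul_mem _ _ (Submodule.subset_span ⟨l, by omega, rfl⟩))
  | zero =>
    have : (fun k : ℕ => (β + k) * (0 : ℕ → ℝ) k) = 0 := by ext; simp
    rw [this]
    exact zero_mem _
  | add q q' _ _ h h' =>
    convert add_mem h h' using 1
    ext k
    simp [mul_add]
  | smul c q _ h =>
    convert Submodule.smul_mem _ c h using 1
    ext k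
    simp only [Pi.smul_apply, smul_eq_mul]
    ring

theorem exists_hasSum_norm_le_of_mem_chooseSpan {d : ℕ} {q : ℕ → ℝ} (hq : q ∈ chooseSpan d) :
    ∃ C : ℝ, 0 ≤ C ∧ ∀ x : ℂ, ‖x‖ < 1 →
      ∃ s : ℂ, HasSum (fun k => (q k : ℂ) * x ^ k) s ∧ ‖s‖ ≤ C / ‖1 - x‖ ^ (d + 1) := by
  induction hq using Submodule.span_induction with
  | mem q hq =>
    obtain ⟨l, hl, rfl⟩ := hq
    -- The generating function has a pole of order l+1 only; since |1-x| ≤ 2, raising the order to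
    -- d+1 costs 2^(d-l).
    refine ⟨2 ^ (d - l), by positivity, fun x hx => ?_⟩
    refine ⟨1 / (1 - x) ^ (l + 1), ?_, ?_⟩
    · exact_mod_cast hasSum_choose_mul_geometric_of_norm_lt_one l hx
    · have h0 : 0 < ‖1 - x‖ := norm_pos_iff.2 (one_sub_ne_zero_of_norm_lt hx)
      have h2 : ‖1 - x‖ ≤ 2 := (norm_sub_le _ _).trans (by rw [norm_one]; linarith)
      rw [norm_div, norm_one, norm_pow, div_le_div_iff₀ (by positivity) (by positivity), one_mul]
      have : d + 1 = (d - l) + (l + 1) := by omega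
      rw [this, pow_add]
      gcongr
  | zero => exact ⟨0, le_rfl, fun x hx => ⟨0, by simp, by simp⟩⟩
  | add q q' _ _ h h' =>
    obtain ⟨C, hC0, hC⟩ := h
    obtain ⟨C', hC0', hC'⟩ := h'
    refine ⟨C + C', by positivity, fun x hx => ?_⟩
    obtain ⟨s, hs, hs'⟩ := hC x hx
    obtain ⟨t, ht, ht'⟩ := hC' x hx
    refine ⟨s + t, ?_, ?_⟩
    · simpa [add_mul] using hs.add ht
    · rw [add_div]
      exact (norm_add_le _ _).trans (add_le_add hs' ht')
  | smul c q _ h =>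
    obtain ⟨C, hC0, hC⟩ := h
    refine ⟨|c| * C, by positivity, fun x hx => ?_⟩
    obtain ⟨s, hs, hs'⟩ := hC x hx
    refine ⟨c * s, ?_, ?_⟩
    · simpa [mul_assoc] using hs.mul_left (c : ℂ)
    · rw [norm_mul, Complex.norm_real, Real.norm_eq_abs, mul_div_assoc]
      gcongr

/-- The Taylor coefficients of the weighted Bergman kernel, up to a constant factor. -/
def kernelCoeff (n : ℕ) (a B : ℝ) (k : ℕ) : ℝ :=
  (n - 1 + k).factorial / k.factorial * (Gamma (B + a + 1 + k) / Gamma (B + k))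

variable {n : ℕ} {a B : ℝ}

theorem kernelCoeff_pos (ha : -1 < a) (hB : 0 < B) (k : ℕ) : 0 < kernelCoeff n a B k := by
  have hk : (0 : ℝ) ≤ k := k.cast_nonneg
  have := Real.Gamma_pos_of_pos (s := B + a + 1 + k) (by linarith)
  have := Real.Gamma_pos_of_pos (s := B + k) (by linarith)
  unfold kernelCoeff
  positivity

/-- With σ = j-a-1 > 0, the quotient Γ(B+a+1+k)/Γ(B+k) equals Γ(B+k+j)/Γ(B+k), a product of j linear
factors in k, times Beta(B+a+1+k, σ)/Γ(σ). The factor (n-1+k)!/k! contributes the remaining degree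
n-1. So the non-integer power growth is a polynomial tempered by a Beta integral. -/
theorem exists_kernelCoeff_eq (ha : -1 < a) (hB : 0 < B) {j : ℕ} (hj : a + 1 < j) :
    ∃ q ∈ chooseSpan (n - 1 + j), (∀ k, 0 ≤ q k) ∧ ∀ k : ℕ,
      kernelCoeff n a B k =
        q k * ∫ u in Ioo (0 : ℝ) 1, u ^ (B + a + 1 + k - 1) * (1 - u) ^ (j - a - 1 - 1) := by
  have hσ : 0 < j - a - 1 := by linarith
  have hΓσ := Real.Gamma_pos_of_pos hσ
  have hspan : ∀ j : ℕ, (fun k : ℕ => ((k + (n - 1)).choose (n - 1) : ℝ) *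
      ∏ i ∈ Finset.range j, (B + k + i)) ∈ chooseSpan (n - 1 + j) := by
    intro j
    induction j with
    | zero =>
      simp only [Finset.range_zero, Finset.prod_empty, mul_one]
      exact Submodule.subset_span ⟨n - 1, le_rfl, rfl⟩
    | succ j ih =>
      have e : (fun k : ℕ => ((k + (n - 1)).choose (n - 1) : ℝ) *
          ∏ i ∈ Finset.range (j + 1), (B + k + i)) = fun k : ℕ => (B + j + k) *
            (((k + (n - 1)).choose (n - 1) : ℝ) * ∏ i ∈ Finset.range j, (B + k + i)) := by
        ext k
        rw [Finset.prod_range_succ]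
        ring
      rw [e]
      exact mul_mem_chooseSpan ih (B + j)
  refine ⟨_, Submodule.smul_mem _ ((n - 1).factorial / Gamma (j - a - 1)) (hspan j), fun k => ?_,
    fun k => ?_⟩
  · simp only [Pi.smul_apply, smul_eq_mul]
    have : 0 ≤ ∏ i ∈ Finset.range j, (B + k + i) := Finset.prod_nonneg fun i _ => by positivity
    positivity
  · have hk : (0 : ℝ) ≤ k := k.cast_nonneg
    have hA : 0 < B + a + 1 + k := by linarith
    rw [integral_rpow_mul_one_sub_rpow hA hσ, ProbabilityTheory.beta]
    have e1 : B + a + 1 + k + (j - a - 1) = B + k + j := by ring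
    rw [e1, Gamma_add_natCast (by positivity) j, kernelCoeff]
    have h1 := Real.Gamma_pos_of_pos (s := B + k) (by linarith)
    have h2 : 0 < ∏ i ∈ Finset.range j, (B + k + i) := Finset.prod_pos fun i _ => by positivity
    have h3 : ((k + (n - 1)).choose (n - 1) : ℝ) * (n - 1).factorial * k.factorial =
        (n - 1 + k).factorial := by
      have := Nat.choose_mul_factorial_mul_factorial (Nat.le_add_left (n - 1) k)
      rw [Nat.add_sub_cancel, add_comm k (n - 1)] at this
      rw [add_comm k (n - 1)]
      exact_mod_cast this
    rw [← h3]
    simp only [Pi.smul_apply, smul_eq_mul]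
    field_simp

/-- The function `x ↦ ∑ₖ cₖ xᵏ` on the unit disc, extended by zero, where the `cₖ` are the Taylor
coefficients of the Bergman kernel up to a constant factor. -/
def kernelFun (n : ℕ) (a B : ℝ) : ℂ → ℂ :=
  (ball 0 1).indicator fun x => ∑' k, (kernelCoeff n a B k : ℂ) * x ^ k

theorem kernelFun_of_norm_lt {x : ℂ} (hx : ‖x‖ < 1) :
    kernelFun n a B x = ∑' k, (kernelCoeff n a B k : ℂ) * x ^ k :=
  indicator_of_mem (by simpa using hx) _

theorem rpow_add_natCast_mul_le {A σ u : ℝ} (hu : u ∈ Ioo (0 : ℝ) 1) (k : ℕ) :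
    u ^ (A + k - 1) * (1 - u) ^ σ ≤ u ^ (A - 1) * (1 - u) ^ σ := by
  have h1 : (0 : ℝ) ≤ (1 - u) ^ σ := rpow_nonneg (by linarith [hu.2]) _
  have hk : (0 : ℝ) ≤ k := k.cast_nonneg
  exact mul_le_mul_of_nonneg_right
    (rpow_le_rpow_of_exponent_ge hu.1 hu.2.le (by linarith)) h1

theorem summable_kernelCoeff_mul_pow (ha : -1 < a) (hB : 0 < B) {r : ℝ} (hr0 : 0 ≤ r)
    (hr : r < 1) : Summable fun k => kernelCoeff n a B k * r ^ k := by
  obtain ⟨j, hj⟩ := exists_nat_gt (a + 1)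
  obtain ⟨q, hq, hq0, hqk⟩ := exists_kernelCoeff_eq ha hB hj
  obtain ⟨C, hC0, hC⟩ := exists_hasSum_norm_le_of_mem_chooseSpan hq
  have hA : 0 < B + a + 1 := by linarith
  have hσ : 0 < j - a - 1 := by linarith
  obtain ⟨s, hs, -⟩ := hC r (by rwa [Complex.norm_real, Real.norm_of_nonneg hr0])
  have h1 : Summable fun k => q k * r ^ k := by
    refine hs.summable.norm.congr fun k => ?_
    rw [norm_mul, norm_pow, Complex.norm_real, Complex.norm_real, Real.norm_of_nonneg hr0,
      Real.norm_of_nonneg (hq0 k)]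
  refine Summable.of_nonneg_of_le
    (fun k => mul_nonneg (kernelCoeff_pos ha hB k).le (by positivity)) (fun k => ?_)
    (h1.mul_right (∫ u in Ioo (0 : ℝ) 1, u ^ (B + a + 1 - 1) * (1 - u) ^ (j - a - 1 - 1)))
  have hk : (0 : ℝ) ≤ k := k.cast_nonneg
  rw [hqk, mul_right_comm]
  refine mul_le_mul_of_nonneg_left ?_ (mul_nonneg (hq0 k) (by positivity))
  exact setIntegral_mono_on (integrableOn_rpow_mul_one_sub_rpow (by linarith) hσ)
    (integrableOn_rpow_mul_one_sub_rpow hA hσ) measurableSet_Ioo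
    fun u hu => rpow_add_natCast_mul_le hu k

/-- In the Beta integral for the k-th coefficient, u^k combines with x^k, so summing under the
integral gives the generating function of q at ux, bounded by a pole of order n+j at 1. -/
theorem exists_enorm_kernelFun_le (hn : 1 ≤ n) (ha : -1 < a) (hB : 0 < B) {j : ℕ}
    (hj : a + 1 < j) : ∃ C : ℝ, 0 ≤ C ∧ ∀ x : ℂ, ‖x‖ < 1 → ‖kernelFun n a B x‖ₑ ≤
      ∫⁻ u in Ioo (0 : ℝ) 1, ENNReal.ofReal
        (u ^ (B + a + 1 - 1) * (1 - u) ^ (j - a - 1 - 1) * (C / ‖1 - u * x‖ ^ (n + j))) := by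
  obtain ⟨q, hq, hq0, hqk⟩ := exists_kernelCoeff_eq ha hB hj
  obtain ⟨C, hC0, hC⟩ := exists_hasSum_norm_le_of_mem_chooseSpan hq
  have hA : 0 < B + a + 1 := by linarith
  have hσ : 0 < j - a - 1 := by linarith
  have hd : n - 1 + j + 1 = n + j := by omega
  rw [hd] at hC
  refine ⟨C, hC0, fun x hx => ?_⟩
  set w : ℝ → ℝ := fun u => u ^ (B + a + 1 - 1) * (1 - u) ^ (j - a - 1 - 1) with hw
  have hwint : IntegrableOn w (Ioo 0 1) := integrableOn_rpow_mul_one_sub_rpow hA hσ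
  have hF : ∀ k : ℕ, IntegrableOn (fun u : ℝ => (q k : ℂ) * x ^ k *
      ((u ^ (B + a + 1 + k - 1) * (1 - u) ^ (j - a - 1 - 1) : ℝ) : ℂ)) (Ioo 0 1) := fun k => by
    have hk : (0 : ℝ) ≤ k := k.cast_nonneg
    exact (integrableOn_rpow_mul_one_sub_rpow (by linarith) hσ).ofReal.const_mul _
  have hbound : ∀ k : ℕ, ∀ u ∈ Ioo (0 : ℝ) 1, ‖(q k : ℂ) * x ^ k *
      ((u ^ (B + a + 1 + k - 1) * (1 - u) ^ (j - a - 1 - 1) : ℝ) : ℂ)‖ ≤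
        ‖(q k : ℂ) * x ^ k‖ * w u := by
    intro k u hu
    rw [norm_mul _ (Complex.ofReal _), Complex.norm_real,
      Real.norm_of_nonneg (rpow_mul_one_sub_rpow_nonneg hu)]
    exact mul_le_mul_of_nonneg_left (rpow_add_natCast_mul_le hu k) (norm_nonneg _)
  obtain ⟨s, hs, -⟩ := hC x hx
  have hsum := hasSum_integral_of_summable_integral_norm hF (by
    refine Summable.of_nonneg_of_le (fun k => integral_nonneg fun _ => norm_nonneg _) (fun k => ?_)
      (hs.summable.norm.mul_right (∫ u in Ioo (0 : ℝ) 1, w u))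
    rw [← integral_const_mul]
    exact setIntegral_mono_on (hF k).norm (hwint.const_mul _) measurableSet_Ioo (hbound k))
  have hker : kernelFun n a B x = ∫ u in Ioo (0 : ℝ) 1, ∑' k : ℕ, (q k : ℂ) * x ^ k *
      ((u ^ (B + a + 1 + k - 1) * (1 - u) ^ (j - a - 1 - 1) : ℝ) : ℂ) := by
    rw [← hsum.tsum_eq, kernelFun_of_norm_lt hx]
    refine tsum_congr fun k => ?_
    rw [integral_const_mul, integral_complex_ofReal, hqk]
    push_cast
    ring
  rw [hker]
  refine (enorm_integral_le_lintegral_enorm _).trans (setLIntegral_mono' measurableSet_Ioo ?_)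
  intro u hu
  have hux : ‖(u : ℂ) * x‖ < 1 := by
    rw [norm_mul, Complex.norm_real, Real.norm_of_nonneg hu.1.le]
    exact mul_lt_one_of_nonneg_of_lt_one_left hu.1.le hu.2 hx.le
  obtain ⟨t, ht, ht'⟩ := hC _ hux
  have he : ∑' k : ℕ, (q k : ℂ) * x ^ k *
      ((u ^ (B + a + 1 + k - 1) * (1 - u) ^ (j - a - 1 - 1) : ℝ) : ℂ) = t * (w u : ℂ) := by
    rw [← (ht.mul_right (w u : ℂ)).tsum_eq]
    refine tsum_congr fun k => ?_
    have : u ^ (B + a + 1 + k - 1) = u ^ (B + a + 1 - 1) * u ^ k := by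
      rw [← rpow_natCast, ← rpow_add hu.1]
      congr 1
      ring
    rw [this, hw]
    push_cast
    ring
  have hw0 : 0 ≤ w u := rpow_mul_one_sub_rpow_nonneg hu
  rw [he, ← ofReal_norm, norm_mul, Complex.norm_real, Real.norm_of_nonneg hw0, mul_comm]
  exact ENNReal.ofReal_le_ofReal (mul_le_mul_of_nonneg_left ht' hw0)

end KernelSeries

/-! ### The measure as a radial density -/

section BergmanMeasure

/-- The radial density of `bergmanMeasure n a b`. -/
def bergmanDensity (n : ℕ) (a b : ℝ) : ℝ → ℝ :=
  (Ico 0 1).indicator fun r => ((n - 1).factorial : ℝ) /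
    (π ^ n * ProbabilityTheory.beta (a + 1) (b + n)) * r ^ (2 * b) * (1 - r ^ 2) ^ a

variable {n : ℕ} {a b : ℝ}

theorem bergmanDensity_of_one_le {r : ℝ} (hr : 1 ≤ r) : bergmanDensity n a b r = 0 :=
  indicator_of_notMem (fun h => absurd h.2 hr.not_gt) _

theorem measurable_bergmanDensity : Measurable (bergmanDensity n a b) :=
  Measurable.indicator (by fun_prop) measurableSet_Ico

theorem bergmanMeasure_eq_withDensity :
    bergmanMeasure n a b = volume.withDensity fun w => ENNReal.ofReal (bergmanDensity n a b ‖w‖) := by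
  rw [bergmanMeasure, ← withDensity_indicator measurableSet_ball]
  congr 1
  ext w
  by_cases hw : ‖w‖ < 1 <;> simp [indicator, bergmanDensity, hw]

theorem bergmanConst_pos (ha : -1 < a) (hb : -(n : ℝ) < b) : 0 < ((n - 1).factorial : ℝ) /
    (π ^ n * ProbabilityTheory.beta (a + 1) (b + n)) := by
  have := ProbabilityTheory.beta_pos (α := a + 1) (β := b + n) (by linarith) (by linarith)
  positivity

theorem bergmanDensity_nonneg (ha : -1 < a) (hb : -(n : ℝ) < b) (r : ℝ) :
    0 ≤ bergmanDensity n a b r := by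
  refine indicator_apply_nonneg fun hr => ?_
  have h1 := bergmanConst_pos ha hb
  have h2 : 0 ≤ 1 - r ^ 2 := by nlinarith [hr.1, hr.2]
  have := hr.1
  positivity

theorem one_sub_sq_rpow_le {r : ℝ} (hr : r ∈ Ioo (0 : ℝ) 1) (a : ℝ) :
    (1 - r ^ 2) ^ a ≤ 2 ^ |a| * (1 - r) ^ a := by
  have h1 : 0 < 1 - r := by linarith [hr.2]
  have h2 : 0 < 1 + r := by linarith [hr.1]
  have e : 1 - r ^ 2 = (1 + r) * (1 - r) := by ring
  rw [e, mul_rpow h2.le h1.le]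
  refine mul_le_mul_of_nonneg_right ?_ (rpow_nonneg h1.le _)
  calc (1 + r) ^ a ≤ (1 + r) ^ |a| :=
        rpow_le_rpow_of_exponent_le (by linarith [hr.1]) (le_abs_self a)
    _ ≤ 2 ^ |a| := rpow_le_rpow h2.le (by linarith [hr.2]) (abs_nonneg a)

/-- The factor r^(2n-1) from polar coordinates turns r^(2b) into r^(2(b+n)-1), integrable at 0
because b > -n; near 1, the bound replaces 1-r² by 1-r. -/
theorem exists_pow_mul_bergmanDensity_le (hn : 1 ≤ n) (ha : -1 < a) (hb : -(n : ℝ) < b) (ε : ℝ) :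
    ∃ C : ℝ, 0 < C ∧ ∀ r ∈ Ioo (0 : ℝ) 1,
      r ^ (2 * n - 1) * (bergmanDensity n a b r * (1 - r) ^ (-ε)) ≤
        C * (r ^ (2 * (b + n) - 1) * (1 - r) ^ (a - ε)) := by
  have h1 := bergmanConst_pos ha hb
  set c := ((n - 1).factorial : ℝ) / (π ^ n * ProbabilityTheory.beta (a + 1) (b + n)) with hc
  refine ⟨c * 2 ^ |a|, by positivity, fun r hr => ?_⟩
  have hr0 := hr.1
  have hr1 : 0 < 1 - r := by linarith [hr.2]
  rw [bergmanDensity, indicator_of_mem (by exact ⟨hr.1.le, hr.2⟩), ← hc]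
  have e1 : r ^ (2 * (b + n) - 1) = r ^ (2 * n - 1) * r ^ (2 * b) := by
    rw [← rpow_natCast, ← rpow_add hr0, Nat.cast_sub (by omega)]
    congr 1
    push_cast
    ring
  have e2 : (1 - r) ^ (a - ε) = (1 - r) ^ a * (1 - r) ^ (-ε) := by
    rw [← rpow_add hr1, sub_eq_add_neg a ε]
  rw [e1, e2]
  calc r ^ (2 * n - 1) * (c * r ^ (2 * b) * (1 - r ^ 2) ^ a * (1 - r) ^ (-ε))
      ≤ r ^ (2 * n - 1) * (c * r ^ (2 * b) * (2 ^ |a| * (1 - r) ^ a) * (1 - r) ^ (-ε)) := by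
        gcongr
        exact one_sub_sq_rpow_le hr a
    _ = _ := by ring

theorem integrable_bergmanDensity_mul (hn : 1 ≤ n) (ha : -1 < a) (hb : -(n : ℝ) < b) {ε : ℝ}
    (hε : ε < a + 1) :
    Integrable fun w : EuclideanSpace ℂ (Fin n) => bergmanDensity n a b ‖w‖ * (1 - ‖w‖) ^ (-ε) := by
  have : Nonempty (Fin n) := ⟨⟨0, hn⟩⟩
  rw [integrable_fun_norm_addHaar (volume : Measure (EuclideanSpace ℂ (Fin n)))
    (f := fun r => bergmanDensity n a b r * (1 - r) ^ (-ε)), finrank_real_euclideanSpace_complex]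
  obtain ⟨C, hC0, hC⟩ := exists_pow_mul_bergmanDensity_le hn ha hb ε
  have hm : Measurable fun r : ℝ => r ^ (2 * n - 1) • (bergmanDensity n a b r * (1 - r) ^ (-ε)) := by
    have := measurable_bergmanDensity (n := n) (a := a) (b := b)
    simp only [smul_eq_mul]
    fun_prop
  have h1 : IntegrableOn (fun r : ℝ => r ^ (2 * n - 1) • (bergmanDensity n a b r * (1 - r) ^ (-ε)))
      (Ioo 0 1) := by
    have h2 := (integrableOn_rpow_mul_one_sub_rpow (α := 2 * (b + n)) (β := a - ε + 1) (by linarith)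
      (by linarith)).const_mul C
    rw [add_sub_cancel_right] at h2
    refine Integrable.mono' h2 hm.aestronglyMeasurable
      ((ae_restrict_mem measurableSet_Ioo).mono fun r hr => ?_)
    have h3 : 0 < 1 - r := by linarith [hr.2]
    have h4 := bergmanDensity_nonneg (n := n) ha hb r
    have h5 := hr.1
    rw [smul_eq_mul, Real.norm_of_nonneg (by positivity)]
    exact hC r hr
  rw [← Ioo_union_Ici_eq_Ioi zero_lt_one]
  refine h1.union ((integrableOn_zero (s := Ici (1 : ℝ))).congr_fun (fun r hr => ?_) measurableSet_Ici)
  simp [bergmanDensity_of_one_le hr]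

theorem integrable_bergmanDensity (hn : 1 ≤ n) (ha : -1 < a) (hb : -(n : ℝ) < b) :
    Integrable fun w : EuclideanSpace ℂ (Fin n) => bergmanDensity n a b ‖w‖ := by
  simpa using integrable_bergmanDensity_mul hn ha hb (ε := 0) (by linarith)

theorem isFiniteMeasure_bergmanMeasure (hn : 1 ≤ n) (ha : -1 < a) (hb : -(n : ℝ) < b) :
    IsFiniteMeasure (bergmanMeasure n a b) := by
  rw [bergmanMeasure_eq_withDensity]
  exact isFiniteMeasure_withDensity_ofReal (integrable_bergmanDensity hn ha hb).2

theorem ae_bergmanMeasure_mem_ball : ∀ᵐ w ∂(bergmanMeasure n a b), ‖w‖ < 1 := by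
  have := (withDensity_absolutelyContinuous (volume.restrict (ball (0 : EuclideanSpace ℂ (Fin n)) 1))
    fun z => ENNReal.ofReal (((n - 1).factorial : ℝ) /
      (π ^ n * ProbabilityTheory.beta (a + 1) (b + n)) * ‖z‖ ^ (2 * b) * (1 - ‖z‖ ^ 2) ^ a)).ae_le
      (ae_restrict_mem measurableSet_ball)
  filter_upwards [this] with w hw
  simpa using hw

theorem lintegral_bergmanMeasure (F : EuclideanSpace ℂ (Fin n) → ℝ≥0∞) :
    ∫⁻ w, F w ∂(bergmanMeasure n a b) =
      ∫⁻ w, ENNReal.ofReal (bergmanDensity n a b ‖w‖) * F w := by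
  rw [bergmanMeasure_eq_withDensity, lintegral_withDensity_eq_lintegral_mul_non_measurable]
  · rfl
  · exact (measurable_bergmanDensity.comp measurable_norm).ennreal_ofReal
  · exact Filter.Eventually.of_forall fun _ => ENNReal.ofReal_lt_top

end BergmanMeasure

/-! ### Forelli–Rudin type estimate for the kernel -/

section KernelEstimate

variable {n : ℕ} {a b : ℝ}

theorem lintegral_div_norm_one_sub_inner_le (hn : 1 ≤ n) {m i : ℕ} (h : 2 * m = (n - 1) + i)
    {ψ : ℝ → ℝ} (hψ : ∀ r, 1 ≤ r → ψ r = 0) (hψ0 : ∀ r, 0 ≤ ψ r) (hψm : Measurable ψ)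
    (hint : Integrable fun w : EuclideanSpace ℂ (Fin n) => ψ ‖w‖)
    {y : EuclideanSpace ℂ (Fin n)} (hy : ‖y‖ < 1) :
    ∫⁻ w : EuclideanSpace ℂ (Fin n),
        ENNReal.ofReal (ψ ‖w‖ / ‖1 - inner ℂ w y‖ ^ (2 * (m + 1))) ≤
      ENNReal.ofReal (2 * (∫ w : EuclideanSpace ℂ (Fin n), Real.exp (-‖w‖ ^ 2)) * i.factorial) *
        ∫⁻ r in Ioo (0 : ℝ) 1, ENNReal.ofReal (r ^ (2 * n - 1) * ψ r / (1 - r * ‖y‖) ^ (i + 1)) := by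
  have hG := gaussian_integral_pos (n := n)
  have hy0 := norm_nonneg y
  have hsymm : ∀ w : EuclideanSpace ℂ (Fin n), ‖1 - inner ℂ w y‖ = ‖1 - inner ℂ y w‖ := by
    intro w
    rw [← RCLike.norm_conj, map_sub, map_one, inner_conj_symm]
  simp only [hsymm]
  have hint' : Integrable fun w : EuclideanSpace ℂ (Fin n) =>
      ψ ‖w‖ / ‖1 - inner ℂ y w‖ ^ (2 * (m + 1)) := by
    refine Integrable.mono' (hint.mul_const (1 / (1 - ‖y‖) ^ (2 * (m + 1)))) ?_
      (Filter.Eventually.of_forall fun w => ?_)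
    · refine Measurable.aestronglyMeasurable ?_
      have : Continuous fun w : EuclideanSpace ℂ (Fin n) => ‖1 - inner ℂ y w‖ ^ (2 * (m + 1)) := by
        fun_prop
      exact (hψm.comp measurable_norm).div this.measurable
    · have hψw := hψ0 ‖w‖
      rw [Real.norm_of_nonneg (by positivity), div_eq_mul_one_div]
      rcases lt_or_ge ‖w‖ 1 with hw | hw
      · have h1 : 1 - ‖y‖ ≤ ‖1 - inner ℂ y w‖ := by
          have h2 := norm_sub_norm_le (1 : ℂ) (inner ℂ y w)
          have h3 : ‖inner ℂ y w‖ ≤ ‖y‖ * ‖w‖ := norm_inner_le_norm _ _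
          rw [norm_one] at h2
          nlinarith
        have : 0 < 1 - ‖y‖ := by linarith
        gcongr
      · simp [hψ _ hw]
  rw [← ofReal_integral_eq_lintegral_ofReal hint'
    (Filter.Eventually.of_forall fun w => div_nonneg (hψ0 _) (by positivity))]
  refine (ENNReal.ofReal_le_ofReal (integral_div_norm_one_sub_inner_le hn h hψ hψ0 hint hy)).trans ?_
  rw [ENNReal.ofReal_mul (by positivity)]
  gcongr
  have hnn : ∀ r ∈ Ioi (0 : ℝ), 0 ≤ r ^ (2 * n - 1) * ψ r / (1 - (r * ‖y‖) ^ 2) ^ (i + 1) := by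
    intro r hr0
    have hr0' : 0 < r := hr0
    rcases lt_or_ge r 1 with hr | hr
    · have h1 : r * ‖y‖ < 1 := mul_lt_one_of_nonneg_of_lt_one_left hr0'.le hr hy.le
      have h2 : 0 ≤ r * ‖y‖ := by positivity
      have h3 : 0 ≤ 1 - (r * ‖y‖) ^ 2 := by nlinarith
      have := hψ0 r
      positivity
    · simp [hψ _ hr]
  rw [integral_eq_lintegral_of_nonneg_ae ((ae_restrict_mem measurableSet_Ioi).mono hnn)
    (Measurable.aestronglyMeasurable (by fun_prop))]
  refine ENNReal.ofReal_toReal_le.trans ?_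
  rw [← lintegral_indicator measurableSet_Ioi, ← lintegral_indicator measurableSet_Ioo]
  refine lintegral_mono fun r => ?_
  by_cases hr0 : r ∈ Ioi (0 : ℝ)
  · have hr0' : 0 < r := hr0
    rw [indicator_of_mem hr0]
    rcases lt_or_ge r 1 with hr | hr
    · rw [indicator_of_mem (by exact ⟨hr0, hr⟩)]
      have h1 : r * ‖y‖ < 1 := mul_lt_one_of_nonneg_of_lt_one_left hr0'.le hr hy.le
      have h2 : 0 ≤ r * ‖y‖ := by positivity
      have h3 : 1 - r * ‖y‖ ≤ 1 - (r * ‖y‖) ^ 2 := by nlinarith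
      have h4 : 0 < 1 - r * ‖y‖ := by linarith
      have := hψ0 r
      gcongr
    · simp [hψ _ hr]
  · simp [indicator_of_notMem hr0]

/-- The pointwise bound reduces the claim to integrals over w, over u from the Beta representation,
and over the radius r. The w-integral with y = uz leaves (1-ru|z|)^(-j); the u-integral lowers this
to (1-r|z|)^(-(a+1)); the r-integral against (1-r)^(a-ε) gives (1-|z|)^(-ε). -/
theorem exists_lintegral_kernelFun_le (hn : 1 ≤ n) (ha : -1 < a) (hb : -(n : ℝ) < b) {ε : ℝ}
    (hε0 : 0 < ε) (hε : ε < a + 1) :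
    ∃ C : ℝ, 0 < C ∧ ∀ z : EuclideanSpace ℂ (Fin n), ‖z‖ < 1 →
      ∫⁻ w, ‖kernelFun n a (b + n) (inner ℂ w z)‖ₑ * ENNReal.ofReal ((1 - ‖w‖) ^ (-ε))
        ∂(bergmanMeasure n a b) ≤ ENNReal.ofReal (C * (1 - ‖z‖) ^ (-ε)) := by
  obtain ⟨J, hJ⟩ := exists_nat_gt (a + 1)
  have hB : 0 < b + n := by linarith
  -- This choice makes n+j = 2(n+J) even, as the square-kernel bound requires, while keeping j >
  -- a+1.
  obtain ⟨j, hjdef⟩ : ∃ j, j = n + 2 * J := ⟨_, rfl⟩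
  have hj : a + 1 < j := by
    rw [hjdef]
    push_cast
    have : (0 : ℝ) ≤ n := n.cast_nonneg
    have : (0 : ℝ) ≤ J := J.cast_nonneg
    linarith
  obtain ⟨m, hm⟩ : ∃ m, n + j = 2 * (m + 1) := ⟨n + J - 1, by omega⟩
  obtain ⟨i, hi⟩ : ∃ i, j = i + 1 := ⟨j - 1, by omega⟩
  have hmi : 2 * m = (n - 1) + i := by omega
  obtain ⟨C₁, hC₁0, hC₁⟩ := exists_enorm_kernelFun_le hn ha hB hj
  obtain ⟨C₃, hC₃0, hC₃⟩ := exists_pow_mul_bergmanDensity_le hn ha hb ε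
  -- The exponents match the chain of integrations: s+1+t equals j for the u-integral here and a+1
  -- for the r-integral next.
  obtain ⟨C₄, hC₄0, hC₄⟩ := exists_lintegral_rpow_mul_one_sub_rpow_le (A := b + n + a + 1)
    (s := j - a - 1 - 1) (t := a + 1) (by linarith) (by linarith) (by linarith)
  obtain ⟨C₅, hC₅0, hC₅⟩ := exists_lintegral_rpow_mul_one_sub_rpow_le (A := 2 * (b + n))
    (s := a - ε) (t := ε) (by linarith) (by linarith) hε0
  set C₂ : ℝ := 2 * (∫ w : EuclideanSpace ℂ (Fin n), Real.exp (-‖w‖ ^ 2)) * i.factorial with hC₂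
  have hC₂0 : 0 < C₂ := by
    have := gaussian_integral_pos (n := n)
    positivity
  set W : ℝ → ℝ := fun u => u ^ (b + n + a + 1 - 1) * (1 - u) ^ (j - a - 1 - 1) with hW
  have hW0 : ∀ u ∈ Ioo (0 : ℝ) 1, 0 ≤ W u := fun u hu => rpow_mul_one_sub_rpow_nonneg hu
  have hWm : Measurable W := by fun_prop
  set ψ : ℝ → ℝ := fun r => bergmanDensity n a b r * (1 - r) ^ (-ε) with hψdef
  have hψ : ∀ r, 1 ≤ r → ψ r = 0 := fun r hr => by simp [hψdef, bergmanDensity_of_one_le hr]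
  have hψ0 : ∀ r, 0 ≤ ψ r := fun r => by
    rcases lt_or_ge r 1 with hr | hr
    · exact mul_nonneg (bergmanDensity_nonneg ha hb r) (rpow_nonneg (by linarith) _)
    · exact (hψ r hr).ge
  have hψm : Measurable ψ := by
    have := measurable_bergmanDensity (n := n) (a := a) (b := b)
    fun_prop
  have hψint := integrable_bergmanDensity_mul hn ha hb hε
  set P : ℝ → ℝ := fun r => r ^ (2 * (b + n) - 1) * (1 - r) ^ (a - ε) with hP
  have hP0 : ∀ r ∈ Ioo (0 : ℝ) 1, 0 ≤ P r := fun r hr => rpow_mul_one_sub_rpow_nonneg hr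
  -- The added 1 gives positivity, as C₁ is only known to be nonnegative.
  refine ⟨C₁ * C₂ * C₃ * C₄ * C₅ + 1, by positivity, fun z hz => ?_⟩
  have hz0 := norm_nonneg z
  have hstep1 : ∀ w : EuclideanSpace ℂ (Fin n), ENNReal.ofReal (bergmanDensity n a b ‖w‖) *
      (‖kernelFun n a (b + n) (inner ℂ w z)‖ₑ * ENNReal.ofReal ((1 - ‖w‖) ^ (-ε))) ≤
      ∫⁻ u in Ioo (0 : ℝ) 1, ENNReal.ofReal (C₁ * W u) *
        ENNReal.ofReal (ψ ‖w‖ / ‖1 - inner ℂ w ((u : ℂ) • z)‖ ^ (2 * (m + 1))) := by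
    intro w
    rcases lt_or_ge ‖w‖ 1 with hw | hw
    · calc _ = ‖kernelFun n a (b + n) (inner ℂ w z)‖ₑ * ENNReal.ofReal (ψ ‖w‖) := by
            rw [hψdef, ENNReal.ofReal_mul (bergmanDensity_nonneg ha hb _)]
            ring
        _ ≤ (∫⁻ u in Ioo (0 : ℝ) 1, ENNReal.ofReal
              (W u * (C₁ / ‖1 - u * inner ℂ w z‖ ^ (n + j)))) * ENNReal.ofReal (ψ ‖w‖) := by
            gcongr
            exact hC₁ _ (norm_inner_lt_one hw hz)
        _ = _ := by
            rw [← lintegral_mul_const' _ _ ENNReal.ofReal_ne_top]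
            refine setLIntegral_congr_fun measurableSet_Ioo fun u hu => ?_
            have h1 := hW0 u hu
            rw [← ENNReal.ofReal_mul (by positivity), ← ENNReal.ofReal_mul (by positivity), hm,
              inner_smul_right]
            congr 1
            ring
    · simp [bergmanDensity_of_one_le hw]
  have hmeas : Measurable (Function.uncurry fun (w : EuclideanSpace ℂ (Fin n)) (u : ℝ) =>
      ENNReal.ofReal (C₁ * W u) *
        ENNReal.ofReal (ψ ‖w‖ / ‖1 - inner ℂ w ((u : ℂ) • z)‖ ^ (2 * (m + 1)))) := by
    have h1 : Continuous fun p : EuclideanSpace ℂ (Fin n) × ℝ =>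
        ‖1 - inner ℂ p.1 ((p.2 : ℂ) • z)‖ ^ (2 * (m + 1)) := by fun_prop
    refine Measurable.mul ?_ (Measurable.ennreal_ofReal (Measurable.div ?_ h1.measurable))
    · exact ((hWm.comp measurable_snd).const_mul C₁).ennreal_ofReal
    · exact hψm.comp (measurable_norm.comp measurable_fst)
  have hstep2 : ∀ u ∈ Ioo (0 : ℝ) 1, ∫⁻ w : EuclideanSpace ℂ (Fin n), ENNReal.ofReal (C₁ * W u) *
        ENNReal.ofReal (ψ ‖w‖ / ‖1 - inner ℂ w ((u : ℂ) • z)‖ ^ (2 * (m + 1))) ≤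
      ∫⁻ r in Ioo (0 : ℝ) 1, ENNReal.ofReal (C₁ * C₂ * C₃) * (ENNReal.ofReal (P r) *
        ENNReal.ofReal (W u * (1 - (r * ‖z‖) * u) ^ (-((j - a - 1 - 1) + 1 + (a + 1))))) := by
    intro u hu
    have hWu := hW0 u hu
    have hnu : ‖(u : ℂ) • z‖ = u * ‖z‖ := by
      rw [norm_smul, Complex.norm_real, Real.norm_of_nonneg hu.1.le]
    have huz : ‖(u : ℂ) • z‖ < 1 := by
      rw [hnu]
      exact mul_lt_one_of_nonneg_of_lt_one_left hu.1.le hu.2 hz.le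
    rw [lintegral_const_mul' _ _ ENNReal.ofReal_ne_top]
    refine (mul_le_mul_right (lintegral_div_norm_one_sub_inner_le hn hmi hψ hψ0 hψm hψint huz) _).trans
      ?_
    rw [← hC₂, ← lintegral_const_mul' _ _ ENNReal.ofReal_ne_top,
      ← lintegral_const_mul' _ _ ENNReal.ofReal_ne_top]
    refine setLIntegral_mono' measurableSet_Ioo fun r hr => ?_
    have hPr := hP0 r hr
    have hru : r * (u * ‖z‖) < 1 := by
      rw [← hnu]
      exact mul_lt_one_of_nonneg_of_lt_one_left hr.1.le hr.2 huz.le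
    have hpos : 0 < 1 - r * (u * ‖z‖) := by linarith
    have e : (1 - (r * ‖z‖) * u) ^ (-(((j : ℝ) - a - 1 - 1) + 1 + (a + 1))) =
        1 / (1 - r * (u * ‖z‖)) ^ (i + 1) := by
      have e1 : ((j : ℝ) - a - 1 - 1) + 1 + (a + 1) = ((i + 1 : ℕ) : ℝ) := by
        rw [← hi]
        ring
      have e2 : 1 - (r * ‖z‖) * u = 1 - r * (u * ‖z‖) := by ring
      rw [e1, e2, rpow_neg hpos.le, rpow_natCast, one_div]
    rw [e, hnu, ← ENNReal.ofReal_mul hC₂0.le, ← ENNReal.ofReal_mul (by positivity),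
      ← ENNReal.ofReal_mul hPr, ← ENNReal.ofReal_mul (by positivity)]
    refine ENNReal.ofReal_le_ofReal ?_
    have h3 := hC₃ r hr
    calc C₁ * W u * (C₂ * (r ^ (2 * n - 1) * ψ r / (1 - r * (u * ‖z‖)) ^ (i + 1)))
        = C₁ * C₂ * (r ^ (2 * n - 1) * ψ r) * (W u * (1 / (1 - r * (u * ‖z‖)) ^ (i + 1))) := by ring
      _ ≤ C₁ * C₂ * (C₃ * P r) * (W u * (1 / (1 - r * (u * ‖z‖)) ^ (i + 1))) := by gcongr
      _ = _ := by ring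
  have hmeas2 : Measurable (Function.uncurry fun (u r : ℝ) =>
      ENNReal.ofReal (C₁ * C₂ * C₃) * (ENNReal.ofReal (P r) *
        ENNReal.ofReal (W u * (1 - (r * ‖z‖) * u) ^ (-((j - a - 1 - 1) + 1 + (a + 1)))))) := by
    unfold Function.uncurry
    fun_prop
  have hstep3 : ∀ r ∈ Ioo (0 : ℝ) 1, ∫⁻ u in Ioo (0 : ℝ) 1,
      ENNReal.ofReal (C₁ * C₂ * C₃) * (ENNReal.ofReal (P r) *
        ENNReal.ofReal (W u * (1 - (r * ‖z‖) * u) ^ (-((j - a - 1 - 1) + 1 + (a + 1))))) ≤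
      ENNReal.ofReal (C₁ * C₂ * C₃ * C₄) *
        ENNReal.ofReal (P r * (1 - ‖z‖ * r) ^ (-((a - ε) + 1 + ε))) := by
    intro r hr
    have hPr := hP0 r hr
    have hr1 : r * ‖z‖ < 1 := mul_lt_one_of_nonneg_of_lt_one_left hr.1.le hr.2 hz.le
    rw [lintegral_const_mul' _ _ ENNReal.ofReal_ne_top, lintegral_const_mul' _ _ ENNReal.ofReal_ne_top]
    refine (mul_le_mul_right (mul_le_mul_right (hC₄ (r * ‖z‖) (mul_nonneg hr.1.le hz0) hr1) _) _).trans
      (le_of_eq ?_)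
    rw [← ENNReal.ofReal_mul hPr, ← ENNReal.ofReal_mul (by positivity),
      ← ENNReal.ofReal_mul (by positivity)]
    congr 1
    have e : (a - ε) + 1 + ε = a + 1 := by ring
    rw [e, mul_comm r ‖z‖]
    ring
  rw [lintegral_bergmanMeasure]
  refine (lintegral_mono hstep1).trans ?_
  rw [lintegral_lintegral_swap hmeas.aemeasurable]
  refine (setLIntegral_mono' measurableSet_Ioo hstep2).trans ?_
  rw [lintegral_lintegral_swap hmeas2.aemeasurable]
  refine (setLIntegral_mono' measurableSet_Ioo hstep3).trans ?_
  rw [lintegral_const_mul' _ _ ENNReal.ofReal_ne_top]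
  refine (mul_le_mul_right (hC₅ ‖z‖ hz0 hz) _).trans ?_
  rw [← ENNReal.ofReal_mul (by positivity)]
  refine ENNReal.ofReal_le_ofReal ?_
  rw [← mul_assoc]
  refine mul_le_mul_of_nonneg_right (by linarith) (rpow_nonneg (by linarith) _)

end KernelEstimate

/-! ### Regularity of the kernel function on the disc -/

section KernelFun

variable {n : ℕ} {a B : ℝ}

theorem differentiableOn_kernelFun (ha : -1 < a) (hB : 0 < B) :
    DifferentiableOn ℂ (kernelFun n a B) (ball 0 1) := by
  have h : DifferentiableOn ℂ (fun x : ℂ => ∑' k, (kernelCoeff n a B k : ℂ) * x ^ k) (ball 0 1) := by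
    intro x hx
    obtain ⟨r, hxr, hr1⟩ := exists_between (mem_ball_zero_iff.1 hx)
    have hd := Complex.differentiableOn_tsum_of_summable_norm (U := ball (0 : ℂ) r)
      (F := fun k x => (kernelCoeff n a B k : ℂ) * x ^ k)
      (summable_kernelCoeff_mul_pow (n := n) ha hB ((norm_nonneg x).trans hxr.le) hr1)
      (fun k => by fun_prop) isOpen_ball (fun k w hw => by
        rw [norm_mul, norm_pow, Complex.norm_real,
          Real.norm_of_nonneg (kernelCoeff_pos ha hB k).le]
        have := (kernelCoeff_pos (n := n) ha hB k).le
        have := (mem_ball_zero_iff.1 hw).le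
        gcongr)
    exact (hd.differentiableAt (isOpen_ball.mem_nhds (mem_ball_zero_iff.2 hxr))).differentiableWithinAt
  exact h.congr fun x hx => indicator_of_mem hx _

theorem measurable_kernelFun (ha : -1 < a) (hB : 0 < B) : Measurable (kernelFun n a B) := by
  classical
  have h := (differentiableOn_kernelFun (n := n) ha hB).continuousOn
  have e : kernelFun n a B = (ball 0 1).piecewise (kernelFun n a B) 0 := by
    ext x
    by_cases hx : x ∈ ball (0 : ℂ) 1 <;> simp [piecewise, hx, kernelFun]
  rw [e]
  exact h.measurable_piecewise continuousOn_const measurableSet_ball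

theorem kernelFun_conj (x : ℂ) : kernelFun n a B (conj x) = conj (kernelFun n a B x) := by
  by_cases hx : ‖x‖ < 1
  · rw [kernelFun_of_norm_lt hx, kernelFun_of_norm_lt (by simpa using hx), Complex.conj_tsum]
    simp
  · simp [kernelFun, hx]

theorem exists_norm_kernelFun_le (ha : -1 < a) (hB : 0 < B) {ρ : ℝ} (hρ : ρ < 1) :
    ∃ M : ℝ, 0 ≤ M ∧ ∀ x : ℂ, ‖x‖ ≤ ρ →
      ‖kernelFun n a B x‖ ≤ M ∧ ‖deriv (kernelFun n a B) x‖ ≤ M := by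
  have h := differentiableOn_kernelFun (n := n) ha hB
  have hs : closedBall (0 : ℂ) ρ ⊆ ball 0 1 := closedBall_subset_ball hρ
  obtain ⟨M, hM⟩ := (isCompact_closedBall (0 : ℂ) ρ).exists_bound_of_continuousOn
    (h.continuousOn.mono hs)
  obtain ⟨M', hM'⟩ := (isCompact_closedBall (0 : ℂ) ρ).exists_bound_of_continuousOn
    ((h.deriv isOpen_ball).continuousOn.mono hs)
  refine ⟨max 0 (max M M'), le_max_left _ _, fun x hx => ?_⟩
  have hx' : x ∈ closedBall (0 : ℂ) ρ := by simpa using hx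
  exact ⟨(hM x hx').trans ((le_max_left _ _).trans (le_max_right _ _)),
    (hM' x hx').trans ((le_max_right _ _).trans (le_max_right _ _))⟩

end KernelFun

/-! ### The reproducing formula and holomorphy of the projection -/

section Reproducing

variable {n : ℕ} {a b : ℝ}

/-- The normalizing constant of the Bergman kernel. -/
def kernelConst (n : ℕ) (a b : ℝ) : ℝ :=
  ((∫ w : EuclideanSpace ℂ (Fin n), Real.exp (-‖w‖ ^ 2)) * (((n - 1).factorial : ℝ) /
    (π ^ n * ProbabilityTheory.beta (a + 1) (b + n))) * Gamma (a + 1))⁻¹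

theorem kernelConst_pos (ha : -1 < a) (hb : -(n : ℝ) < b) : 0 < kernelConst n a b := by
  have h1 := bergmanConst_pos ha hb
  have h2 := gaussian_integral_pos (n := n)
  have h3 := Real.Gamma_pos_of_pos (s := a + 1) (by linarith)
  unfold kernelConst
  positivity

theorem integral_pow_mul_bergmanDensity (hn : 1 ≤ n) (ha : -1 < a) (hb : -(n : ℝ) < b) (k : ℕ) :
    ∫ r in Ioi (0 : ℝ), r ^ (2 * n - 1 + 2 * k) * bergmanDensity n a b r =
      ((n - 1).factorial : ℝ) / (π ^ n * ProbabilityTheory.beta (a + 1) (b + n)) / 2 *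
        ProbabilityTheory.beta (b + n + k) (a + 1) := by
  have hk : (0 : ℝ) ≤ k := k.cast_nonneg
  set c := ((n - 1).factorial : ℝ) / (π ^ n * ProbabilityTheory.beta (a + 1) (b + n)) with hc
  rw [← integral_rpow_mul_one_sub_rpow (by linarith) (by linarith), ← integral_const_mul,
    ← integral_indicator measurableSet_Ioo]
  -- The substitution s = r² turns the radial moment into a Beta integral.
  have h := integral_comp_rpow_Ioi ((Ioo (0 : ℝ) 1).indicator fun s =>
    c / 2 * (s ^ (b + n + k - 1) * (1 - s) ^ (a + 1 - 1))) (p := 2) two_ne_zero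
  have e1 : ∫ s in Ioi (0 : ℝ), (Ioo (0 : ℝ) 1).indicator (fun s =>
      c / 2 * (s ^ (b + n + k - 1) * (1 - s) ^ (a + 1 - 1))) s =
      ∫ s : ℝ, (Ioo (0 : ℝ) 1).indicator (fun s =>
      c / 2 * (s ^ (b + n + k - 1) * (1 - s) ^ (a + 1 - 1))) s := by
    refine setIntegral_eq_integral_of_forall_compl_eq_zero fun s hs => ?_
    exact indicator_of_notMem (fun h => hs h.1) _
  rw [← e1, ← h]
  refine setIntegral_congr_fun measurableSet_Ioi fun r hr => ?_
  have hr0 : 0 < r := hr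
  simp only [smul_eq_mul]
  rcases lt_or_ge r 1 with hr1 | hr1
  · have h1 : r ^ (2 : ℝ) ∈ Ioo (0 : ℝ) 1 :=
      ⟨rpow_pos_of_pos hr0 _, rpow_lt_one hr0.le hr1 two_pos⟩
    rw [indicator_of_mem h1, bergmanDensity, indicator_of_mem (by exact ⟨hr0.le, hr1⟩), ← hc,
      ← rpow_mul hr0.le, rpow_two, add_sub_cancel_right]
    have e2 : r ^ (2 * n - 1 + 2 * k) * r ^ (2 * b) =
        r ^ ((2 : ℝ) - 1) * r ^ (2 * (b + n + k - 1)) := by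
      rw [← rpow_natCast, ← rpow_add hr0, ← rpow_add hr0]
      congr 1
      push_cast [Nat.cast_sub (show 1 ≤ 2 * n by omega)]
      ring
    rw [abs_two]
    linear_combination (c * (1 - r ^ 2) ^ a) * e2
  · rw [bergmanDensity_of_one_le hr1, indicator_of_notMem]
    · simp
    · exact fun h => absurd h.2 (not_lt.2 (one_le_rpow hr1 two_pos.le))

theorem integrable_bergmanMeasure_iff (ha : -1 < a) (hb : -(n : ℝ) < b)
    {f : EuclideanSpace ℂ (Fin n) → ℂ} : Integrable f (bergmanMeasure n a b) ↔
      Integrable fun w => f w * bergmanDensity n a b ‖w‖ := by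
  rw [bergmanMeasure_eq_withDensity, integrable_withDensity_iff_integrable_smul']
  · refine integrable_congr (Filter.Eventually.of_forall fun w => ?_)
    simp only
    rw [ENNReal.toReal_ofReal (bergmanDensity_nonneg ha hb _), Complex.real_smul, mul_comm]
  · exact (measurable_bergmanDensity.comp measurable_norm).ennreal_ofReal
  · exact Filter.Eventually.of_forall fun _ => ENNReal.ofReal_lt_top

theorem integral_bergmanMeasure (ha : -1 < a) (hb : -(n : ℝ) < b)
    (f : EuclideanSpace ℂ (Fin n) → ℂ) : ∫ w, f w ∂(bergmanMeasure n a b) =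
      ∫ w, f w * bergmanDensity n a b ‖w‖ := by
  rw [bergmanMeasure_eq_withDensity, integral_withDensity_eq_integral_toReal_smul]
  · refine integral_congr_ae (Filter.Eventually.of_forall fun w => ?_)
    simp only
    rw [ENNReal.toReal_ofReal (bergmanDensity_nonneg ha hb _), Complex.real_smul, mul_comm]
  · exact (measurable_bergmanDensity.comp measurable_norm).ennreal_ofReal
  · exact Filter.Eventually.of_forall fun _ => ENNReal.ofReal_lt_top

variable {f : EuclideanSpace ℂ (Fin n) → ℂ}

/-- This dictates `kernelCoeff` and `kernelConst`: their product is the reciprocal of `angularConst`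
times the radial moment of degree 2n-1+2k, with the k-independent part collected in `kernelConst`.
-/
theorem integral_inner_pow_mul_bergmanMeasure (hn : 1 ≤ n) (ha : -1 < a) (hb : -(n : ℝ) < b)
    (hf : DifferentiableOn ℂ f (ball 0 1)) (hfi : Integrable f (bergmanMeasure n a b)) (k : ℕ)
    (z : EuclideanSpace ℂ (Fin n)) :
    (kernelConst n a b * kernelCoeff n a (b + n) k : ℝ) *
      ∫ w, inner ℂ w z ^ k * f w ∂(bergmanMeasure n a b) = homComp f k z := by
  have hk : (0 : ℝ) ≤ k := k.cast_nonneg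
  rw [integral_bergmanMeasure ha hb]
  simp only [mul_assoc]
  rw [integral_inner_pow_mul hf hn k z (fun r hr => bergmanDensity_of_one_le hr)
    ((integrable_bergmanMeasure_iff ha hb).1 hfi), integral_pow_mul_bergmanDensity hn ha hb, ← mul_assoc]
  convert one_mul _ using 2
  norm_cast
  have h1 := bergmanConst_pos ha hb
  set c := ((n - 1).factorial : ℝ) / (π ^ n * ProbabilityTheory.beta (a + 1) (b + n)) with hc
  have h2 := gaussian_integral_pos (n := n)
  have h3 := Real.Gamma_pos_of_pos (s := a + 1) (by linarith)
  have h4 := Real.Gamma_pos_of_pos (s := b + n + a + 1 + k) (by linarith)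
  have h5 := Real.Gamma_pos_of_pos (s := b + n + k) (by linarith)
  have e : b + n + k + (a + 1) = b + n + a + 1 + k := by ring
  rw [kernelConst, ← hc, kernelCoeff, angularConst, ProbabilityTheory.beta, e]
  field_simp

theorem norm_inner_pow_mul_le {z w : EuclideanSpace ℂ (Fin n)} (hw : ‖w‖ < 1) (k : ℕ) (c : ℂ) :
    ‖inner ℂ w z ^ k * c‖ ≤ ‖z‖ ^ k * ‖c‖ := by
  rw [norm_mul, norm_pow]
  gcongr
  refine (norm_inner_le_norm _ _).trans ?_
  nlinarith [norm_nonneg z]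

/-- The weighted Bergman projection. -/
def bergmanProj (n : ℕ) (a b : ℝ) (h : EuclideanSpace ℂ (Fin n) → ℂ)
    (z : EuclideanSpace ℂ (Fin n)) : ℂ :=
  kernelConst n a b * ∫ w, kernelFun n a (b + n) (inner ℂ w z) * h w ∂(bergmanMeasure n a b)

/-- Expand K and integrate term by term: the k-th term is the k-th homogeneous component of f at z.
The interchange is legitimate because |⟨w,z⟩| ≤ |z| < 1 on the ball. -/
theorem bergmanProj_eq_self (hn : 1 ≤ n) (ha : -1 < a) (hb : -(n : ℝ) < b)
    (hf : DifferentiableOn ℂ f (ball 0 1)) (hfi : Integrable f (bergmanMeasure n a b))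
    {z : EuclideanSpace ℂ (Fin n)} (hz : ‖z‖ < 1) : bergmanProj n a b f z = f z := by
  have hB : 0 < b + n := by linarith
  have hz0 := norm_nonneg z
  have hbd : ∀ k : ℕ, ∀ᵐ w ∂(bergmanMeasure n a b),
      ‖(kernelCoeff n a (b + n) k : ℂ) * (inner ℂ w z ^ k * f w)‖ ≤
        (kernelCoeff n a (b + n) k * ‖z‖ ^ k) * ‖f w‖ := by
    intro k
    filter_upwards [ae_bergmanMeasure_mem_ball] with w hw
    have hc := (kernelCoeff_pos (n := n) ha hB k).le
    rw [norm_mul, Complex.norm_real, Real.norm_of_nonneg hc, mul_assoc]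
    exact mul_le_mul_of_nonneg_left (norm_inner_pow_mul_le hw k _) hc
  have hint : ∀ k : ℕ, Integrable (fun w => (kernelCoeff n a (b + n) k : ℂ) *
      (inner ℂ w z ^ k * f w)) (bergmanMeasure n a b) := fun k =>
    Integrable.mono' (hfi.norm.const_mul _)
      (((Continuous.aestronglyMeasurable (by fun_prop)).mul hfi.aestronglyMeasurable).const_mul _)
      (hbd k)
  have hsum := hasSum_integral_of_summable_integral_norm hint (by
    refine Summable.of_nonneg_of_le (fun k => integral_nonneg fun _ => norm_nonneg _) (fun k => ?_)
      ((summable_kernelCoeff_mul_pow (n := n) ha hB hz0 hz).mul_right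
        (∫ w, ‖f w‖ ∂(bergmanMeasure n a b)))
    rw [← integral_const_mul]
    exact integral_mono_ae (hint k).norm (hfi.norm.const_mul _) (hbd k))
  have hker : ∫ w, kernelFun n a (b + n) (inner ℂ w z) * f w ∂(bergmanMeasure n a b) =
      ∫ w, ∑' k, (kernelCoeff n a (b + n) k : ℂ) * (inner ℂ w z ^ k * f w)
        ∂(bergmanMeasure n a b) := by
    refine integral_congr_ae ?_
    filter_upwards [ae_bergmanMeasure_mem_ball] with w hw
    rw [kernelFun_of_norm_lt (norm_inner_lt_one hw hz), ← tsum_mul_right]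
    simp only [mul_assoc]
  rw [bergmanProj, hker]
  refine (hsum.mul_left (kernelConst n a b : ℂ)).unique ?_
  refine (hasSum_homComp hf (mem_ball_zero_iff.2 hz)).congr_fun fun k => ?_
  rw [integral_const_mul, ← integral_inner_pow_mul_bergmanMeasure hn ha hb hf hfi, ← mul_assoc]
  push_cast
  rfl

theorem aestronglyMeasurable_kernelFun_inner (ha : -1 < a) (hb : -(n : ℝ) < b)
    (z : EuclideanSpace ℂ (Fin n)) {μ : Measure (EuclideanSpace ℂ (Fin n))} :
    AEStronglyMeasurable (fun w => kernelFun n a (b + n) (inner ℂ w z)) μ := by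
  have : Continuous fun w : EuclideanSpace ℂ (Fin n) => inner ℂ w z := by fun_prop
  exact ((measurable_kernelFun ha (by linarith)).comp this.measurable).aestronglyMeasurable

/-- For |z| < ρ < 1 and w in the ball, ⟨w,z⟩ stays in a compact subdisc on which K and K' are
bounded, so differentiation under the integral is dominated by a multiple of |h|. -/
theorem differentiableOn_bergmanProj (ha : -1 < a) (hb : -(n : ℝ) < b)
    {h : EuclideanSpace ℂ (Fin n) → ℂ} (hh : Integrable h (bergmanMeasure n a b)) :
    DifferentiableOn ℂ (bergmanProj n a b h) (ball 0 1) := by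
  have hB : 0 < b + n := by linarith
  intro z₀ hz₀
  refine DifferentiableAt.differentiableWithinAt (DifferentiableAt.const_mul ?_ _)
  obtain ⟨ρ, hρ, hρ1⟩ := exists_between (mem_ball_zero_iff.1 hz₀)
  obtain ⟨M, hM0, hM⟩ := exists_norm_kernelFun_le (n := n) ha hB hρ1
  have hin : ∀ {w z : EuclideanSpace ℂ (Fin n)}, ‖w‖ < 1 → ‖z‖ < ρ → ‖inner ℂ w z‖ ≤ ρ := by
    intro w z hw hz
    refine (norm_inner_le_norm _ _).trans ?_
    nlinarith [norm_nonneg z, norm_nonneg w]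
  refine (hasFDerivAt_integral_of_dominated_of_fderiv_le (𝕜 := ℂ) (s := ball 0 ρ)
    (F' := fun z w => (deriv (kernelFun n a (b + n)) (inner ℂ w z) * h w) • innerSL ℂ w)
    (bound := fun w => M * ‖h w‖)
    (isOpen_ball.mem_nhds (mem_ball_zero_iff.2 hρ)) ?_ ?_ ?_ ?_ (hh.norm.const_mul M) ?_).differentiableAt
  · exact Filter.Eventually.of_forall fun z =>
      (aestronglyMeasurable_kernelFun_inner ha hb z).mul hh.aestronglyMeasurable
  · refine Integrable.mono' (hh.norm.const_mul M)
      ((aestronglyMeasurable_kernelFun_inner ha hb z₀).mul hh.aestronglyMeasurable) ?_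
    filter_upwards [ae_bergmanMeasure_mem_ball] with w hw
    rw [norm_mul]
    gcongr
    exact (hM _ (hin hw hρ)).1
  · have hc : Continuous fun w : EuclideanSpace ℂ (Fin n) => inner ℂ w z₀ := by fun_prop
    exact (((measurable_deriv _).comp hc.measurable).aestronglyMeasurable.mul
      hh.aestronglyMeasurable).smul (innerSL ℂ).continuous.aestronglyMeasurable
  · filter_upwards [ae_bergmanMeasure_mem_ball] with w hw z hz
    rw [norm_smul, norm_mul, innerSL_apply_norm]
    have := (hM _ (hin hw (mem_ball_zero_iff.1 hz))).2
    calc _ ≤ M * ‖h w‖ * 1 := by gcongr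
      _ = _ := mul_one _
  · filter_upwards [ae_bergmanMeasure_mem_ball] with w hw z hz
    have h1 : HasDerivAt (kernelFun n a (b + n)) (deriv (kernelFun n a (b + n)) (inner ℂ w z))
        (inner ℂ w z) := by
      refine ((differentiableOn_kernelFun ha hB).differentiableAt
        (isOpen_ball.mem_nhds ?_)).hasDerivAt
      rw [mem_ball_zero_iff]
      exact (hin hw (mem_ball_zero_iff.1 hz)).trans_lt hρ1
    have h2 := (h1.comp_hasFDerivAt z (innerSL ℂ w).hasFDerivAt).mul_const (h w)
    exact h2.congr_fderiv (by rw [smul_smul, mul_comm])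

end Reproducing

/-! ### The dual of L^p of a finite measure -/

section LpDual

open Filter Topology

variable {α : Type*} {mα : MeasurableSpace α} {μ : Measure α} {p q : ℝ≥0∞}

/-- Converse Hölder inequality, by testing on the extremal function. With J = ∫|g|^Q, finite by
hypothesis, the test gives J ≤ M J^(1/P); dividing yields J^(1/Q) ≤ M. -/
theorem eLpNorm_le_of_norm_integral_mul_le [Fact (1 ≤ p)] [ENNReal.HolderConjugate p q]
    (hp : p ≠ ∞) (hq : q ≠ ∞) {g : α → ℂ} (hg : MemLp g q μ) {M : ℝ} (hM : 0 ≤ M)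
    (h : ∀ f : Lp ℂ p μ, ‖∫ x, f x * g x ∂μ‖ ≤ M * ‖f‖) : eLpNorm g q μ ≤ ENNReal.ofReal M := by
  have hPQ : p.toReal.HolderConjugate q.toReal := ENNReal.HolderConjugate.toReal_of_ne_top hp hq
  have hp0 : p ≠ 0 := (one_pos.trans_le (Fact.out : 1 ≤ p)).ne'
  have hq0 : q ≠ 0 := fun h0 => by simpa [h0] using hPQ.symm.pos
  set P := p.toReal with hP
  set Q := q.toReal with hQ
  have hQ1 : 1 < Q := hPQ.symm.lt
  have hP0 : 0 < P := hPQ.pos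
  -- The equality case of Hölder: fg = |f|^P = |g|^Q. Zeros of g need separate treatment because the
  -- exponent Q-2 may be negative or zero.
  set f : α → ℂ := fun x => conj (g x) * ((‖g x‖ ^ (Q - 2) : ℝ) : ℂ) with hf
  have hfn : ∀ x, ‖f x‖ = ‖g x‖ ^ (Q - 1) := by
    intro x
    simp only [hf, norm_mul, RCLike.norm_conj, Complex.norm_real]
    rw [Real.norm_of_nonneg (by positivity)]
    rcases eq_or_ne (g x) 0 with h0 | h0
    · rw [h0, norm_zero, zero_mul, Real.zero_rpow (by linarith)]
    · rw [show Q - 1 = 1 + (Q - 2) by ring, Real.rpow_add (norm_pos_iff.2 h0), Real.rpow_one]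
  have hfP : ∀ x, ‖f x‖ ^ P = ‖g x‖ ^ Q := by
    intro x
    rw [hfn, ← Real.rpow_mul (norm_nonneg _), hPQ.symm.sub_one_mul_conj]
  have hfg : ∀ x, f x * g x = ((‖g x‖ ^ Q : ℝ) : ℂ) := by
    intro x
    have e : f x * g x = ((‖g x‖ ^ 2 * ‖g x‖ ^ (Q - 2) : ℝ) : ℂ) := by
      simp only [hf]
      rw [mul_right_comm, ← Complex.normSq_eq_conj_mul_self, Complex.normSq_eq_norm_sq]
      push_cast
      rfl
    rw [e]
    congr 1
    rcases eq_or_ne (g x) 0 with h0 | h0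
    · rw [h0, norm_zero, Real.zero_rpow (x := Q) (by linarith)]
      simp
    · rw [← Real.rpow_natCast, ← Real.rpow_add (norm_pos_iff.2 h0)]
      norm_num
  have hfm : AEStronglyMeasurable f μ := by
    have h1 : AEMeasurable g μ := hg.1.aemeasurable
    exact AEMeasurable.aestronglyMeasurable (by fun_prop)
  have hI : Integrable (fun x => ‖g x‖ ^ Q) μ := hg.integrable_norm_rpow hq0 hq
  have hfL : MemLp f p μ := by
    rw [← integrable_norm_rpow_iff hfm hp0 hp]
    simpa only [← hP, hfP] using hI
  set J := ∫ x, ‖g x‖ ^ Q ∂μ with hJ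
  have hJ0 : 0 ≤ J := integral_nonneg fun x => by positivity
  have e1 : ‖hfL.toLp f‖ = J ^ P⁻¹ := by
    rw [Lp.norm_toLp, hfL.eLpNorm_eq_integral_rpow_norm hp0 hp, ENNReal.toReal_ofReal (by positivity)]
    simp only [← hP, hfP, hJ]
  have e2 : ∫ x, hfL.toLp f x * g x ∂μ = (J : ℂ) := by
    rw [hJ, ← integral_complex_ofReal]
    refine integral_congr_ae ?_
    filter_upwards [hfL.coeFn_toLp] with x hx
    rw [hx, hfg]
  have h1 := h (hfL.toLp f)
  rw [e1, e2, Complex.norm_real, Real.norm_of_nonneg hJ0] at h1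
  rw [hg.eLpNorm_eq_integral_rpow_norm hq0 hq]
  refine ENNReal.ofReal_le_ofReal ?_
  change J ^ Q⁻¹ ≤ M
  rcases hJ0.eq_or_lt with h0 | h0
  · rw [← h0, Real.zero_rpow (by have := hPQ.symm.pos; positivity)]
    exact hM
  · have h2 : J ^ Q⁻¹ * J ^ P⁻¹ = J := by
      rw [← Real.rpow_add h0, add_comm, hPQ.inv_add_inv_eq_one, Real.rpow_one]
    have h3 : 0 < J ^ P⁻¹ := by positivity
    nlinarith

variable [IsFiniteMeasure μ]

section Representation

theorem indicatorConstLp_biUnion_finset {f : ℕ → Set α} (hf : ∀ i, MeasurableSet (f i))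
    (hd : Pairwise (Function.onFun Disjoint f)) (s : Finset ℕ) :
    indicatorConstLp p (s.measurableSet_biUnion fun i _ => hf i)
      (measure_ne_top μ (⋃ i ∈ s, f i)) (1 : ℂ) =
        ∑ i ∈ s, indicatorConstLp p (hf i) (measure_ne_top μ (f i)) 1 := by
  classical
  induction s using Finset.induction_on with
  | empty => simp
  | insert a s ha ih =>
    rw [Finset.sum_insert ha, ← ih, ← indicatorConstLp_disjoint_union]
    · simp only [Finset.set_biUnion_insert]
    · rw [disjoint_iUnion₂_right]
      exact fun i hi => hd (fun h => ha (h ▸ hi))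

variable [Fact (1 ≤ p)]

/-- The tail of the union has measure tending to 0, hence small L^p norm when p < ∞. This gives
countable additivity of E ↦ φ(1_E). -/
theorem tendsto_indicatorConstLp_biUnion_finset (hp : p ≠ ∞) {f : ℕ → Set α}
    (hf : ∀ i, MeasurableSet (f i)) (hd : Pairwise (Function.onFun Disjoint f)) :
    Tendsto (fun s : Finset ℕ => indicatorConstLp p (s.measurableSet_biUnion fun i _ => hf i)
      (measure_ne_top μ (⋃ i ∈ s, f i)) (1 : ℂ)) atTop
      (𝓝 (indicatorConstLp p (MeasurableSet.iUnion hf) (measure_ne_top μ (⋃ i, f i)) 1)) := by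
  refine tendsto_indicatorConstLp_set hp ?_
  have hs : ∑' i, μ (f i) ≠ ∞ := by
    rw [← measure_iUnion hd hf]
    exact measure_ne_top _ _
  refine tendsto_of_tendsto_of_tendsto_of_le_of_le tendsto_const_nhds
    (ENNReal.tendsto_tsum_compl_atTop_zero hs) (fun s => zero_le) fun s => ?_
  refine (measure_mono (t := ⋃ i : {x // x ∉ s}, f i) ?_).trans (measure_iUnion_le _)
  rintro x (⟨h1, h2⟩ | ⟨h1, h2⟩)
  · simp only [mem_iUnion] at h1 h2
    obtain ⟨i, _, hi⟩ := h1
    exact absurd ⟨i, hi⟩ h2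
  · simp only [mem_iUnion] at h1 h2 ⊢
    obtain ⟨i, hi⟩ := h1
    exact ⟨⟨i, fun h => h2 ⟨i, h, hi⟩⟩, hi⟩

open Classical in
/-- The complex measure `E ↦ φ 1_E` attached to a bounded functional on `L^p` of a finite measure. -/
def functionalMeasure (hp : p ≠ ∞) (φ : StrongDual ℂ (Lp ℂ p μ)) : ComplexMeasure α where
  measureOf' E := if h : MeasurableSet E then
    φ (indicatorConstLp p h (measure_ne_top μ E) 1) else 0
  empty' := by simp
  not_measurable' E hE := by simp [hE]
  m_iUnion' f hf hd := by
    rw [dif_pos (MeasurableSet.iUnion hf)]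
    refine (((φ.continuous.tendsto _).comp
      (tendsto_indicatorConstLp_biUnion_finset hp hf hd)).congr fun s => ?_)
    rw [Function.comp_apply, indicatorConstLp_biUnion_finset hf hd, map_sum]
    refine Finset.sum_congr rfl fun i _ => ?_
    simp only [dif_pos (hf i)]

theorem functionalMeasure_apply (hp : p ≠ ∞) (φ : StrongDual ℂ (Lp ℂ p μ)) {E : Set α}
    (hE : MeasurableSet E) : functionalMeasure hp φ E =
      φ (indicatorConstLp p hE (measure_ne_top μ E) 1) :=
  dif_pos hE

/-- A μ-null set has zero indicator in L^p, so E ↦ φ(1_E) is absolutely continuous; Radon–Nikodym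
applies to its real and imaginary parts. -/
theorem exists_integrable_setIntegral_eq (hp : p ≠ ∞) (φ : StrongDual ℂ (Lp ℂ p μ)) :
    ∃ h : α → ℂ, Measurable h ∧ Integrable h μ ∧ ∀ (E : Set α) (hE : MeasurableSet E),
      φ (indicatorConstLp p hE (measure_ne_top μ E) 1) = ∫ x in E, h x ∂μ := by
  set c := functionalMeasure hp φ with hc
  have h0 : ∀ E, μ E = 0 → c E = 0 := by
    intro E h
    by_cases hE : MeasurableSet E
    · rw [hc, functionalMeasure_apply hp φ hE]
      have : indicatorConstLp p hE (measure_ne_top μ E) (1 : ℂ) = 0 := by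
        rw [← norm_eq_zero, norm_indicatorConstLp (one_pos.trans_le (Fact.out : 1 ≤ p)).ne' hp]
        have : (1 / p.toReal) ≠ 0 := by
          have := ENNReal.toReal_pos (one_pos.trans_le (Fact.out : 1 ≤ p)).ne' hp
          positivity
        rw [Measure.real, h, ENNReal.toReal_zero, Real.zero_rpow this, mul_zero]
      rw [this, map_zero]
    · exact c.not_measurable hE
  have key : ∀ E, MeasurableSet E → μ.toENNRealVectorMeasure E = 0 → c E = 0 := fun E hE h =>
    h0 E (by rwa [Measure.toENNRealVectorMeasure_apply_measurable hE] at h)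
  have hre : c.re ≪ᵥ μ.toENNRealVectorMeasure := VectorMeasure.AbsolutelyContinuous.mk
    fun E hE h => (congrArg Complex.re (key E hE h) :)
  have him : c.im ≪ᵥ μ.toENNRealVectorMeasure := VectorMeasure.AbsolutelyContinuous.mk
    fun E hE h => (congrArg Complex.im (key E hE h) :)
  rw [SignedMeasure.absolutelyContinuous_iff_withDensityᵥ_rnDeriv_eq] at hre him
  have hi := c.integrable_rnDeriv μ
  refine ⟨c.rnDeriv μ, ?_, hi, fun E hE => ?_⟩
  · have h1 := SignedMeasure.measurable_rnDeriv c.re μ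
    have h2 := SignedMeasure.measurable_rnDeriv c.im μ
    have e : c.rnDeriv μ = fun x => (c.re.rnDeriv μ x : ℂ) + c.im.rnDeriv μ x * Complex.I := by
      ext x
      exact Complex.mk_eq_add_mul_I _ _
    rw [e]
    fun_prop
  · rw [← functionalMeasure_apply hp φ hE, ← hc]
    apply Complex.ext
    · rw [← RCLike.re_eq_complex_re, ← integral_re hi.integrableOn]
      have : (μ.withDensityᵥ (c.re.rnDeriv μ)) E = c.re E := by rw [hre]
      rw [withDensityᵥ_apply (SignedMeasure.integrable_rnDeriv _ _) hE] at this
      exact this.symm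
    · rw [← RCLike.im_eq_complex_im, ← integral_im hi.integrableOn]
      have : (μ.withDensityᵥ (c.im.rnDeriv μ)) E = c.im E := by rw [him]
      rw [withDensityᵥ_apply (SignedMeasure.integrable_rnDeriv _ _) hE] at this
      exact this.symm

variable [Fact (1 ≤ q)] [ENNReal.HolderConjugate p q]

/-- Two continuous linear functionals on `L^p` that agree on indicators are equal. -/
theorem functional_ext (hp : p ≠ ∞) {φ ψ : StrongDual ℂ (Lp ℂ p μ)}
    (h : ∀ (E : Set α) (hE : MeasurableSet E),
      φ (indicatorConstLp p hE (measure_ne_top μ E) 1) =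
        ψ (indicatorConstLp p hE (measure_ne_top μ E) 1)) : φ = ψ := by
  ext f
  induction f using Lp.induction hp with
  | @indicatorConst c E hs hμs =>
    have e : indicatorConstLp p hs hμs.ne c = c • indicatorConstLp p hs hμs.ne (1 : ℂ) := by
      ext1
      filter_upwards [indicatorConstLp_coeFn (p := p) (hs := hs) (hμs := hμs.ne) (c := c),
        indicatorConstLp_coeFn (p := p) (hs := hs) (hμs := hμs.ne) (c := (1 : ℂ)),
        Lp.coeFn_smul c (indicatorConstLp p hs hμs.ne (1 : ℂ))] with x h1 h2 h3
      rw [h1, h3, Pi.smul_apply, h2]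
      by_cases hx : x ∈ E <;> simp [hx]
    rw [Lp.simpleFunc.coe_indicatorConst, e, map_smul, map_smul, h _ hs]
  | add hf hg _ h1 h2 => rw [map_add, map_add, h1, h2]
  | isClosed => exact isClosed_eq φ.continuous ψ.continuous

theorem functional_eq_lpPairing (hp : p ≠ ∞) (φ : StrongDual ℂ (Lp ℂ p μ)) {h : α → ℂ}
    (hh : MemLp h q μ) (hφ : ∀ (E : Set α) (hE : MeasurableSet E),
      φ (indicatorConstLp p hE (measure_ne_top μ E) 1) = ∫ x in E, h x ∂μ) (f : Lp ℂ p μ) :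
    φ f = ∫ x, f x * h x ∂μ := by
  have e : φ = ((ContinuousLinearMap.mul ℂ ℂ).lpPairing μ p q).flip (hh.toLp h) := by
    refine functional_ext hp fun E hE => ?_
    rw [hφ, ContinuousLinearMap.flip_apply, ContinuousLinearMap.lpPairing_eq_integral,
      ← integral_indicator hE]
    refine integral_congr_ae ?_
    filter_upwards [hh.coeFn_toLp, indicatorConstLp_coeFn (p := p) (hs := hE)
      (hμs := measure_ne_top μ E) (c := (1 : ℂ))] with x h1 h2
    rw [h1, h2]
    by_cases hx : x ∈ E <;> simp [hx]
  rw [e, ContinuousLinearMap.flip_apply, ContinuousLinearMap.lpPairing_eq_integral]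
  refine integral_congr_ae ?_
  filter_upwards [hh.coeFn_toLp] with x h1
  rw [h1]
  rfl

end Representation

/-- The Radon–Nikodym density h is a priori only integrable. Its truncations to |h| ≤ N are bounded
and represent φ composed with a contraction, so converse Hölder bounds their L^q norms by ‖φ‖; Fatou
passes the bound to h. -/
theorem exists_memLp_functional_eq [Fact (1 ≤ p)] [Fact (1 ≤ q)] [ENNReal.HolderConjugate p q]
    (hp : p ≠ ∞) (hq : q ≠ ∞) (φ : StrongDual ℂ (Lp ℂ p μ)) :
    ∃ h : α → ℂ, MemLp h q μ ∧ eLpNorm h q μ ≤ ENNReal.ofReal ‖φ‖ ∧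
      ∀ f : Lp ℂ p μ, φ f = ∫ x, f x * h x ∂μ := by
  obtain ⟨h, hm, hi, hφ⟩ := exists_integrable_setIntegral_eq hp φ
  have hA : ∀ N : ℕ, MeasurableSet {x | ‖h x‖ ≤ N} := fun N =>
    measurableSet_le hm.norm measurable_const
  have hbd : ∀ N : ℕ, MemLp ({x | ‖h x‖ ≤ N}.indicator h) q μ := fun N =>
    MemLp.of_bound (hm.indicator (hA N)).aestronglyMeasurable N
      (Eventually.of_forall fun x => by
        by_cases hx : ‖h x‖ ≤ N <;> simp [hx])
  have htr : ∀ N : ℕ, eLpNorm ({x | ‖h x‖ ≤ N}.indicator h) q μ ≤ ENNReal.ofReal ‖φ‖ := by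
    intro N
    refine eLpNorm_le_of_norm_integral_mul_le (p := p) hp hq (hbd N) (norm_nonneg _) fun f => ?_
    set A := {x | ‖h x‖ ≤ N} with hAdef
    -- Multiplication by the indicator of A, which does not increase the L^p norm.
    set T : Lp ℂ p μ →L[ℂ] Lp ℂ p μ := (ContinuousLinearMap.mul ℂ ℂ).holderL μ ∞ p p
      (indicatorConstLp ∞ (hA N) (measure_ne_top μ _) 1) with hT
    have hTf : ∀ f : Lp ℂ p μ, T f =ᵐ[μ] A.indicator f := by
      intro f
      filter_upwards [(ContinuousLinearMap.mul ℂ ℂ).coeFn_holder (r := p)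
        (indicatorConstLp ∞ (hA N) (measure_ne_top μ _) 1) f,
        indicatorConstLp_coeFn (p := ∞) (hs := hA N) (hμs := measure_ne_top μ _) (c := (1 : ℂ))]
        with x h1 h2
      refine Eq.trans h1 ?_
      rw [h2, ContinuousLinearMap.mul_apply']
      by_cases hx : x ∈ A
      · rw [indicator_of_mem hx, indicator_of_mem hx, one_mul]
      · rw [indicator_of_notMem hx, indicator_of_notMem hx, zero_mul]
    rw [← functional_eq_lpPairing hp (φ ∘L T) (hbd N)]
    · refine (φ.le_opNorm _).trans ?_
      gcongr
      refine Lp.norm_le_norm_of_ae_le ?_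
      filter_upwards [hTf f] with x hx
      refine (congrArg norm hx).trans_le ?_
      exact norm_indicator_le_norm_self _ _
    · intro E hE
      have e : T (indicatorConstLp p hE (measure_ne_top μ E) 1) =
          indicatorConstLp p (hE.inter (hA N)) (measure_ne_top μ _) 1 := by
        ext1
        filter_upwards [hTf (indicatorConstLp p hE (measure_ne_top μ E) 1),
          indicatorConstLp_coeFn (p := p) (hs := hE) (hμs := measure_ne_top μ _) (c := (1 : ℂ)),
          indicatorConstLp_coeFn (p := p) (hs := hE.inter (hA N)) (hμs := measure_ne_top μ _)
            (c := (1 : ℂ))] with x h1 h2 h3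
        rw [h1, h3]
        by_cases hx : x ∈ A
        · rw [indicator_of_mem hx, h2]
          by_cases hx' : x ∈ E
          · rw [indicator_of_mem hx', indicator_of_mem (mem_inter hx' hx)]
          · rw [indicator_of_notMem hx', indicator_of_notMem fun h => hx' h.1]
        · rw [indicator_of_notMem hx, indicator_of_notMem fun h => hx h.2]
      rw [ContinuousLinearMap.comp_apply, e, hφ, setIntegral_indicator (hA N)]
  have hle : eLpNorm h q μ ≤ ENNReal.ofReal ‖φ‖ := by
    refine (Lp.eLpNorm_lim_le_liminf_eLpNorm
      (f := fun N : ℕ => {x | ‖h x‖ ≤ N}.indicator h) (fun N => (hbd N).1) h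
      (Eventually.of_forall fun x => ?_)).trans ?_
    · refine tendsto_const_nhds.congr' ?_
      filter_upwards [eventually_ge_atTop ⌈‖h x‖⌉₊] with N hN
      rw [indicator_of_mem]
      exact Nat.ceil_le.1 hN
    · exact (liminf_le_liminf (Eventually.of_forall htr)).trans_eq (liminf_const _)
  have hL : MemLp h q μ := ⟨hm.aestronglyMeasurable, hle.trans_lt ENNReal.ofReal_lt_top⟩
  exact ⟨h, hL, hle, functional_eq_lpPairing hp φ hL hφ⟩

end LpDual

/-! ### Schur's test -/

section Schur

/-- **Schur's test** on `L^Q`, for a nonnegative kernel. -/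
theorem lintegral_lintegral_rpow_le_of_schur {α : Type*} {mα : MeasurableSpace α} {μ : Measure α}
    [SFinite μ] {K : α → α → ℝ≥0∞} (hK : Measurable (Function.uncurry K)) {P Q : ℝ}
    (hPQ : P.HolderConjugate Q) {ω : α → ℝ≥0∞} (hω : Measurable ω) (hω0 : ∀ᵐ w ∂μ, ω w ≠ 0)
    (hωt : ∀ᵐ w ∂μ, ω w ≠ ∞) {C : ℝ≥0∞}
    (h1 : ∀ᵐ z ∂μ, ∫⁻ w, K z w * ω w ^ P ∂μ ≤ C * ω z ^ P)
    (h2 : ∀ᵐ w ∂μ, ∫⁻ z, K z w * ω z ^ Q ∂μ ≤ C * ω w ^ Q)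
    {h : α → ℝ≥0∞} (hh : Measurable h) :
    ∫⁻ z, (∫⁻ w, K z w * h w ∂μ) ^ Q ∂μ ≤ C ^ (Q / P) * C * ∫⁻ w, h w ^ Q ∂μ := by
  have hP := hPQ.pos
  have hQ := hPQ.symm.pos
  have hKz : ∀ z, Measurable (K z) := fun z => hK.comp measurable_prodMk_left
  have hKw : ∀ w, Measurable fun z => K z w := fun w => hK.comp measurable_prodMk_right
  have step : ∀ᵐ z ∂μ, (∫⁻ w, K z w * h w ∂μ) ^ Q ≤
      C ^ (Q / P) * ∫⁻ w, ω z ^ Q * (K z w * ((ω w)⁻¹ * h w) ^ Q) ∂μ := by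
    filter_upwards [h1] with z hz
    -- Split K h as (K^(1/P) ω)(K^(1/Q) ω⁻¹ h) before Hölder; the first factor is then controlled by
    -- `h1`, and `h2` is used after exchanging the integrals.
    have e : ∫⁻ w, K z w * h w ∂μ =
        ∫⁻ w, ((fun w => K z w ^ P⁻¹ * ω w) * fun w => K z w ^ Q⁻¹ * ((ω w)⁻¹ * h w)) w ∂μ := by
      refine lintegral_congr_ae ?_
      filter_upwards [hω0, hωt] with w hw0 hwt
      rw [Pi.mul_apply]
      calc K z w * h w = (K z w ^ P⁻¹ * K z w ^ Q⁻¹) * (ω w * (ω w)⁻¹) * h w := by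
            rw [← ENNReal.rpow_add_of_nonneg _ _ (by positivity) (by positivity),
              hPQ.inv_add_inv_eq_one, ENNReal.rpow_one, ENNReal.mul_inv_cancel hw0 hwt, mul_one]
        _ = _ := by ring
    have hH := ENNReal.lintegral_mul_le_Lp_mul_Lq μ hPQ
      (f := fun w => K z w ^ P⁻¹ * ω w) (g := fun w => K z w ^ Q⁻¹ * ((ω w)⁻¹ * h w))
      (((hKz z).pow_const _).mul hω).aemeasurable
      (((hKz z).pow_const _).mul (hω.inv.mul hh)).aemeasurable
    rw [← e] at hH
    have e1 : ∀ w, (K z w ^ P⁻¹ * ω w) ^ P = K z w * ω w ^ P := fun w => by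
      rw [ENNReal.mul_rpow_of_nonneg _ _ hP.le, ENNReal.rpow_inv_rpow hP.ne']
    have e2 : ∀ w, (K z w ^ Q⁻¹ * ((ω w)⁻¹ * h w)) ^ Q = K z w * ((ω w)⁻¹ * h w) ^ Q := fun w => by
      rw [ENNReal.mul_rpow_of_nonneg _ _ hQ.le, ENNReal.rpow_inv_rpow hQ.ne']
    simp only [e1, e2] at hH
    calc (∫⁻ w, K z w * h w ∂μ) ^ Q ≤ ((C * ω z ^ P) ^ (1 / P) *
          (∫⁻ w, K z w * ((ω w)⁻¹ * h w) ^ Q ∂μ) ^ (1 / Q)) ^ Q := by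
            refine ENNReal.rpow_le_rpow (hH.trans ?_) hQ.le
            gcongr
      _ = C ^ (Q / P) * (ω z ^ Q * ∫⁻ w, K z w * ((ω w)⁻¹ * h w) ^ Q ∂μ) := by
            rw [ENNReal.mul_rpow_of_nonneg _ _ hQ.le, ← ENNReal.rpow_mul, ← ENNReal.rpow_mul,
              one_div_mul_cancel hQ.ne', ENNReal.rpow_one,
              ENNReal.mul_rpow_of_nonneg _ _ (by positivity), ← ENNReal.rpow_mul, mul_assoc]
            rw [show 1 / P * Q = Q / P by ring, show P * (Q / P) = Q by field_simp]
      _ = _ := by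
            rw [lintegral_const_mul]
            exact (hKz z).mul ((hω.inv.mul hh).pow_const _)
  have hm : Measurable (Function.uncurry fun z w => ω z ^ Q * (K z w * ((ω w)⁻¹ * h w) ^ Q)) := by
    refine ((hω.comp measurable_fst).pow_const _).mul (hK.mul ?_)
    exact ((hω.inv.mul hh).comp measurable_snd).pow_const _
  calc ∫⁻ z, (∫⁻ w, K z w * h w ∂μ) ^ Q ∂μ
      ≤ ∫⁻ z, C ^ (Q / P) * ∫⁻ w, ω z ^ Q * (K z w * ((ω w)⁻¹ * h w) ^ Q) ∂μ ∂μ :=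
        lintegral_mono_ae step
    _ = C ^ (Q / P) * ∫⁻ w, ∫⁻ z, ω z ^ Q * (K z w * ((ω w)⁻¹ * h w) ^ Q) ∂μ ∂μ := by
        rw [lintegral_const_mul _ hm.lintegral_prod_right, lintegral_lintegral_swap hm.aemeasurable]
    _ ≤ C ^ (Q / P) * ∫⁻ w, C * h w ^ Q ∂μ := by
        refine mul_le_mul_right ?_ _
        refine lintegral_mono_ae ?_
        filter_upwards [h2, hω0, hωt] with w hw hw0 hwt
        calc ∫⁻ z, ω z ^ Q * (K z w * ((ω w)⁻¹ * h w) ^ Q) ∂μ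
            = ∫⁻ z, K z w * ω z ^ Q * ((ω w)⁻¹ * h w) ^ Q ∂μ := by
              refine lintegral_congr fun z => by ring
          _ = (∫⁻ z, K z w * ω z ^ Q ∂μ) * ((ω w)⁻¹ * h w) ^ Q :=
              lintegral_mul_const _ ((hKw w).mul (hω.pow_const _))
          _ ≤ C * ω w ^ Q * ((ω w)⁻¹ * h w) ^ Q := by gcongr
          _ = C * h w ^ Q := by
              rw [mul_assoc, ← ENNReal.mul_rpow_of_nonneg _ _ hQ.le, ← mul_assoc,
                ENNReal.mul_inv_cancel hw0 hwt, one_mul]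
    _ = _ := by rw [lintegral_const_mul _ (hh.pow_const _), mul_assoc]

end Schur

/-! ### L^q boundedness and symmetry of the projection -/

section ProjectionBound

variable {n : ℕ} {a b : ℝ}

theorem measurable_kernelFun_inner (ha : -1 < a) (hb : -(n : ℝ) < b) :
    Measurable (Function.uncurry fun z w : EuclideanSpace ℂ (Fin n) =>
      kernelFun n a (b + n) (inner ℂ w z)) := by
  have : Continuous fun x : EuclideanSpace ℂ (Fin n) × EuclideanSpace ℂ (Fin n) =>
    inner ℂ x.2 x.1 := by fun_prop
  exact (measurable_kernelFun ha (by linarith)).comp this.measurable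

theorem kernelFun_inner_comm {B : ℝ} (z w : EuclideanSpace ℂ (Fin n)) :
    conj (kernelFun n a B (inner ℂ w z)) = kernelFun n a B (inner ℂ z w) := by
  rw [← kernelFun_conj, inner_conj_symm]

theorem exists_lintegral_kernelFun_rpow_le (hn : 1 ≤ n) (ha : -1 < a) (hb : -(n : ℝ) < b)
    {P Q : ℝ} (hPQ : P.HolderConjugate Q) :
    ∃ C : ℝ≥0∞, C ≠ ∞ ∧ ∀ h : EuclideanSpace ℂ (Fin n) → ℂ, Measurable h →
      ∫⁻ z, (∫⁻ w, ‖kernelFun n a (b + n) (inner ℂ w z)‖ₑ * ‖h w‖ₑ ∂(bergmanMeasure n a b)) ^ Q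
        ∂(bergmanMeasure n a b) ≤ C * ∫⁻ w, ‖h w‖ₑ ^ Q ∂(bergmanMeasure n a b) := by
  have := isFiniteMeasure_bergmanMeasure hn ha hb
  have hP := hPQ.pos
  have hQ := hPQ.symm.pos
  -- Small enough that both sP and sQ lie in (0, a+1), the range of admissible ε in the kernel
  -- estimate.
  set s := (a + 1) / (2 * (P + Q)) with hs
  have ha1 : 0 < a + 1 := by linarith
  have hs0 : 0 < s := by positivity
  have hsP : s * P < a + 1 := by
    rw [hs, div_mul_eq_mul_div, div_lt_iff₀ (by positivity)]
    nlinarith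
  have hsQ : s * Q < a + 1 := by
    rw [hs, div_mul_eq_mul_div, div_lt_iff₀ (by positivity)]
    nlinarith
  obtain ⟨C₁, hC₁, h1⟩ := exists_lintegral_kernelFun_le hn ha hb (mul_pos hs0 hP) hsP
  obtain ⟨C₂, hC₂, h2⟩ := exists_lintegral_kernelFun_le hn ha hb (mul_pos hs0 hQ) hsQ
  set ω : EuclideanSpace ℂ (Fin n) → ℝ≥0∞ := fun z => ENNReal.ofReal ((1 - ‖z‖) ^ (-s)) with hω
  have hωr : ∀ z : EuclideanSpace ℂ (Fin n), ‖z‖ < 1 → ∀ R : ℝ,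
      ω z ^ R = ENNReal.ofReal ((1 - ‖z‖) ^ (-(s * R))) := by
    intro z hz R
    have : 0 < 1 - ‖z‖ := by linarith
    simp only [hω]
    rw [ENNReal.ofReal_rpow_of_pos (by positivity), ← Real.rpow_mul this.le, neg_mul]
  have hball := ae_bergmanMeasure_mem_ball (n := n) (a := a) (b := b)
  have bound : ∀ {R C' : ℝ}, 0 < C' → C' ≤ max C₁ C₂ → (∀ z : EuclideanSpace ℂ (Fin n), ‖z‖ < 1 →
      ∫⁻ w, ‖kernelFun n a (b + n) (inner ℂ w z)‖ₑ * ENNReal.ofReal ((1 - ‖w‖) ^ (-(s * R)))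
        ∂(bergmanMeasure n a b) ≤ ENNReal.ofReal (C' * (1 - ‖z‖) ^ (-(s * R)))) →
      ∀ z : EuclideanSpace ℂ (Fin n), ‖z‖ < 1 →
        ∫⁻ w, ‖kernelFun n a (b + n) (inner ℂ w z)‖ₑ * ω w ^ R ∂(bergmanMeasure n a b) ≤
          ENNReal.ofReal (max C₁ C₂) * ω z ^ R := by
    intro R C' hC' hle h z hz
    rw [lintegral_congr_ae (g := fun w => ‖kernelFun n a (b + n) (inner ℂ w z)‖ₑ *
      ENNReal.ofReal ((1 - ‖w‖) ^ (-(s * R)))) (by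
        filter_upwards [hball] with w hw
        rw [hωr w hw])]
    refine (h z hz).trans ?_
    rw [hωr z hz, ENNReal.ofReal_mul hC'.le]
    gcongr
  refine ⟨ENNReal.ofReal (max C₁ C₂) ^ (Q / P) * ENNReal.ofReal (max C₁ C₂), by finiteness,
    fun h hh => ?_⟩
  refine lintegral_lintegral_rpow_le_of_schur (ω := ω)
    (K := fun z w => ‖kernelFun n a (b + n) (inner ℂ w z)‖ₑ)
    (measurable_kernelFun_inner ha hb).enorm hPQ ?_ ?_ ?_ ?_ ?_ hh.enorm
  · simp only [hω]
    fun_prop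
  · filter_upwards [hball] with w hw
    have : 0 < 1 - ‖w‖ := by linarith
    simp only [hω]
    positivity
  · exact Filter.Eventually.of_forall fun w => ENNReal.ofReal_ne_top
  · filter_upwards [hball] with z hz using bound hC₁ (le_max_left _ _) h1 z hz
  · filter_upwards [hball] with w hw
    -- The second Schur condition is the first with the variables exchanged, as |K(⟨w,z⟩)| =
    -- |K(⟨z,w⟩)|.
    refine le_trans (lintegral_mono fun z => ?_) (bound hC₂ (le_max_right _ _) h2 w hw)
    rw [← kernelFun_inner_comm, RCLike.enorm_conj]

theorem enorm_bergmanProj_le (ha : -1 < a) (hb : -(n : ℝ) < b)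
    (h : EuclideanSpace ℂ (Fin n) → ℂ) (z : EuclideanSpace ℂ (Fin n)) :
    ‖bergmanProj n a b h z‖ₑ ≤ ENNReal.ofReal (kernelConst n a b) *
      ∫⁻ w, ‖kernelFun n a (b + n) (inner ℂ w z)‖ₑ * ‖h w‖ₑ ∂(bergmanMeasure n a b) := by
  rw [bergmanProj, enorm_mul]
  gcongr
  · rw [← ofReal_norm, Complex.norm_real, Real.norm_of_nonneg (kernelConst_pos ha hb).le]
  · refine (enorm_integral_le_lintegral_enorm _).trans_eq ?_
    simp only [enorm_mul]

theorem bergmanProj_congr {h h' : EuclideanSpace ℂ (Fin n) → ℂ}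
    (e : h =ᵐ[bergmanMeasure n a b] h') : bergmanProj n a b h = bergmanProj n a b h' := by
  ext z
  unfold bergmanProj
  congr 1
  refine integral_congr_ae ?_
  filter_upwards [e] with w hw
  rw [hw]

theorem aestronglyMeasurable_bergmanProj (hn : 1 ≤ n) (ha : -1 < a) (hb : -(n : ℝ) < b)
    {h : EuclideanSpace ℂ (Fin n) → ℂ} (hh : AEStronglyMeasurable h (bergmanMeasure n a b)) :
    AEStronglyMeasurable (bergmanProj n a b h) (bergmanMeasure n a b) := by
  have := isFiniteMeasure_bergmanMeasure hn ha hb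
  refine AEStronglyMeasurable.const_mul ?_ _
  exact ((measurable_kernelFun_inner ha hb).aestronglyMeasurable.mul
    hh.comp_snd).integral_prod_right'

variable {p q : ℝ≥0∞}

/-- The bound is stated for the positive operator with kernel |K|: it dominates the projection and
also supplies the absolute integrability behind Fubini in `integral_mul_conj_bergmanProj`. -/
theorem exists_eLpNorm_bergmanProj_le (hn : 1 ≤ n) (ha : -1 < a) (hb : -(n : ℝ) < b)
    [ENNReal.HolderConjugate p q] (hp : p ≠ ∞) (hq : q ≠ ∞) :
    ∃ C : ℝ≥0∞, C ≠ ∞ ∧ ∀ h : EuclideanSpace ℂ (Fin n) → ℂ, MemLp h q (bergmanMeasure n a b) →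
      eLpNorm (fun z => ∫⁻ w, ‖kernelFun n a (b + n) (inner ℂ w z)‖ₑ * ‖h w‖ₑ
        ∂(bergmanMeasure n a b)) q (bergmanMeasure n a b) ≤
        C * eLpNorm h q (bergmanMeasure n a b) := by
  have hPQ : p.toReal.HolderConjugate q.toReal := ENNReal.HolderConjugate.toReal_of_ne_top hp hq
  have hQ := hPQ.symm.pos
  have hq0 : q ≠ 0 := fun h0 => by simp [h0] at hQ
  obtain ⟨C, hC, h⟩ := exists_lintegral_kernelFun_rpow_le hn ha hb hPQ
  refine ⟨C ^ (1 / q.toReal), by finiteness, fun u hu => ?_⟩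
  obtain ⟨v, hv, huv⟩ := hu.1.aemeasurable
  have e : ∀ z, ∫⁻ w, ‖kernelFun n a (b + n) (inner ℂ w z)‖ₑ * ‖u w‖ₑ ∂(bergmanMeasure n a b) =
      ∫⁻ w, ‖kernelFun n a (b + n) (inner ℂ w z)‖ₑ * ‖v w‖ₑ ∂(bergmanMeasure n a b) := fun z =>
    lintegral_congr_ae (by filter_upwards [huv] with w hw; rw [hw])
  simp only [e]
  rw [eLpNorm_congr_ae huv, eLpNorm_eq_lintegral_rpow_enorm_toReal hq0 hq,
    eLpNorm_eq_lintegral_rpow_enorm_toReal hq0 hq, ← ENNReal.mul_rpow_of_nonneg _ _ (by positivity)]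
  exact ENNReal.rpow_le_rpow (h v hv) (by positivity)

theorem exists_memLp_bergmanProj (hn : 1 ≤ n) (ha : -1 < a) (hb : -(n : ℝ) < b)
    [ENNReal.HolderConjugate p q] (hp : p ≠ ∞) (hq : q ≠ ∞) :
    ∃ C : ℝ, 0 ≤ C ∧ ∀ h : EuclideanSpace ℂ (Fin n) → ℂ, MemLp h q (bergmanMeasure n a b) →
      MemLp (bergmanProj n a b h) q (bergmanMeasure n a b) ∧
      eLpNorm (bergmanProj n a b h) q (bergmanMeasure n a b) ≤
        ENNReal.ofReal C * eLpNorm h q (bergmanMeasure n a b) := by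
  obtain ⟨C, hC, h⟩ := exists_eLpNorm_bergmanProj_le hn ha hb (p := p) hp hq
  refine ⟨kernelConst n a b * C.toReal, mul_nonneg (kernelConst_pos ha hb).le ENNReal.toReal_nonneg,
    fun u hu => ?_⟩
  have key : eLpNorm (bergmanProj n a b u) q (bergmanMeasure n a b) ≤
      ENNReal.ofReal (kernelConst n a b * C.toReal) * eLpNorm u q (bergmanMeasure n a b) := by
    rw [ENNReal.ofReal_mul (kernelConst_pos ha hb).le, ENNReal.ofReal_toReal hC, mul_assoc]
    refine le_trans ?_ (mul_le_mul_right (h u hu) _)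
    exact eLpNorm_le_mul_eLpNorm_of_ae_le_mul'
      (Filter.Eventually.of_forall fun z => enorm_bergmanProj_le ha hb u z) _
  exact ⟨⟨aestronglyMeasurable_bergmanProj hn ha hb hu.1, key.trans_lt
    (ENNReal.mul_lt_top ENNReal.ofReal_lt_top hu.2)⟩, key⟩

/-- Symmetry of the projection: Fubini together with the Hermitian symmetry of the kernel. -/
theorem integral_mul_conj_bergmanProj (hn : 1 ≤ n) (ha : -1 < a) (hb : -(n : ℝ) < b)
    [ENNReal.HolderConjugate p q] (hp : p ≠ ∞) (hq : q ≠ ∞) {f h : EuclideanSpace ℂ (Fin n) → ℂ}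
    (hf : MemLp f p (bergmanMeasure n a b)) (hh : MemLp h q (bergmanMeasure n a b)) :
    ∫ z, f z * conj (bergmanProj n a b h z) ∂(bergmanMeasure n a b) =
      ∫ w, bergmanProj n a b f w * conj (h w) ∂(bergmanMeasure n a b) := by
  have := isFiniteMeasure_bergmanMeasure hn ha hb
  have hPQ : p.toReal.HolderConjugate q.toReal := ENNReal.HolderConjugate.toReal_of_ne_top hp hq
  have hq0 : q ≠ 0 := fun h0 => by have := hPQ.symm.pos; simp [h0] at this
  have hp0 : p ≠ 0 := fun h0 => by have := hPQ.pos; simp [h0] at this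
  obtain ⟨C, hC, hbd⟩ := exists_eLpNorm_bergmanProj_le hn ha hb (p := p) hp hq
  have hk := measurable_kernelFun_inner (n := n) ha hb
  set F : EuclideanSpace ℂ (Fin n) → EuclideanSpace ℂ (Fin n) → ℂ := fun z w =>
    f z * conj (kernelFun n a (b + n) (inner ℂ w z) * h w) with hF
  have hFm : AEStronglyMeasurable (Function.uncurry F)
      ((bergmanMeasure n a b).prod (bergmanMeasure n a b)) :=
    hf.1.comp_fst.mul (RCLike.continuous_conj.comp_aestronglyMeasurable
      (hk.aestronglyMeasurable.mul hh.1.comp_snd))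
  have hFi : Integrable (Function.uncurry F)
      ((bergmanMeasure n a b).prod (bergmanMeasure n a b)) := by
    -- Absolute integrability is Hölder applied to |f| in L^p and the |K|-transform of |h| in L^q.
    refine ⟨hFm, ?_⟩
    rw [HasFiniteIntegral, lintegral_prod _ hFm.enorm]
    have e : ∀ z, ∫⁻ w, ‖Function.uncurry F (z, w)‖ₑ ∂(bergmanMeasure n a b) = ‖f z‖ₑ *
        ∫⁻ w, ‖kernelFun n a (b + n) (inner ℂ w z)‖ₑ * ‖h w‖ₑ ∂(bergmanMeasure n a b) := by
      intro z
      rw [← lintegral_const_mul']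
      · refine lintegral_congr fun w => ?_
        simp only [hF, Function.uncurry_apply_pair, enorm_mul, RCLike.enorm_conj]
      · exact enorm_ne_top
    simp only [e]
    refine (ENNReal.lintegral_mul_le_Lp_mul_Lq _ hPQ hf.1.enorm
      (hk.enorm.aemeasurable.mul hh.1.comp_snd.enorm).lintegral_prod_right').trans_lt ?_
    refine ENNReal.mul_lt_top ?_ ?_
    · rw [← eLpNorm_eq_lintegral_rpow_enorm_toReal hp0 hp]
      exact hf.2
    · refine lt_of_le_of_lt ?_ (ENNReal.mul_lt_top hC.lt_top hh.2)
      refine le_trans (le_of_eq ?_) (hbd h hh)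
      rw [eLpNorm_eq_lintegral_rpow_enorm_toReal hq0 hq]
      rfl
  have e1 : ∀ z, f z * conj (bergmanProj n a b h z) =
      kernelConst n a b * ∫ w, F z w ∂(bergmanMeasure n a b) := by
    intro z
    simp only [hF, bergmanProj]
    rw [integral_const_mul, integral_conj, map_mul, Complex.conj_ofReal]
    ring
  have e2 : ∀ w, bergmanProj n a b f w * conj (h w) =
      kernelConst n a b * ∫ z, F z w ∂(bergmanMeasure n a b) := by
    intro w
    simp only [hF, bergmanProj]
    rw [mul_assoc, ← integral_mul_const]
    congr 1
    refine integral_congr_ae (Filter.Eventually.of_forall fun z => ?_)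
    simp only
    rw [map_mul, kernelFun_inner_comm]
    ring
  simp only [e1, e2]
  rw [integral_const_mul, integral_const_mul, integral_integral_swap hFi]

end ProjectionBound

/-! ### The pairing is an isomorphism onto the dual -/

section Duality

variable {n : ℕ} {a b : ℝ} {p q : ℝ≥0∞}

theorem MeasureTheory.MemLp.complex_conj {α : Type*} {mα : MeasurableSpace α} {μ : Measure α}
    {f : α → ℂ} (hf : MemLp f p μ) : MemLp (fun x => conj (f x)) p μ :=
  hf.star

theorem integrable_mul_conj {α : Type*} {mα : MeasurableSpace α} {μ : Measure α}
    [ENNReal.HolderConjugate p q] (f : Lp ℂ p μ) (g : Lp ℂ q μ) :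
    Integrable (fun z => f z * conj (g z)) μ :=
  (Lp.memLp f).integrable_mul (Lp.memLp g).complex_conj

/-- Complex conjugation on `L^q`. -/
def conjLp {α : Type*} {mα : MeasurableSpace α} (μ : Measure α) (q : ℝ≥0∞) [Fact (1 ≤ q)] :
    Lp ℂ q μ →SL[starRingEnd ℂ] Lp ℂ q μ :=
  LinearMap.mkContinuous
    { toFun := fun f => (Lp.memLp f).complex_conj.toLp _
      map_add' := fun f g => by
        rw [← MemLp.toLp_add]
        refine MemLp.toLp_congr _ _ ?_
        filter_upwards [Lp.coeFn_add f g] with x hx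
        rw [hx, Pi.add_apply, Pi.add_apply, map_add]
      map_smul' := fun c f => by
        rw [← MemLp.toLp_const_smul]
        refine MemLp.toLp_congr _ _ ?_
        filter_upwards [Lp.coeFn_smul c f] with x hx
        rw [hx, Pi.smul_apply, Pi.smul_apply, smul_eq_mul, smul_eq_mul, map_mul] }
    1 fun f => by
      refine (le_of_eq ?_).trans (one_mul ‖f‖).ge
      change ‖(Lp.memLp f).complex_conj.toLp _‖ = _
      rw [Lp.norm_toLp, Lp.norm_def]
      congr 1
      exact eLpNorm_congr_norm_ae (Filter.Eventually.of_forall fun x => RCLike.norm_conj _)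

theorem coeFn_conjLp {α : Type*} {mα : MeasurableSpace α} {μ : Measure α} [Fact (1 ≤ q)]
    (f : Lp ℂ q μ) : conjLp μ q f =ᵐ[μ] fun x => conj (f x) :=
  (Lp.memLp f).complex_conj.coeFn_toLp

/-- The sesquilinear pairing `(g, f) ↦ ∫ f ḡ` between Bergman spaces. -/
def bergmanPairing (n : ℕ) (a b : ℝ) (p q : ℝ≥0∞) [Fact (1 ≤ p)] [Fact (1 ≤ q)]
    [ENNReal.HolderConjugate p q] :
    bergmanSpace n a b q →SL[starRingEnd ℂ] StrongDual ℂ (bergmanSpace n a b p) :=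
  ((ContinuousLinearMap.precomp ℂ (bergmanSpace n a b p).subtypeL).comp
    ((ContinuousLinearMap.mul ℂ ℂ).lpPairing (bergmanMeasure n a b) p q).flip).comp
    ((conjLp (bergmanMeasure n a b) q).comp (bergmanSpace n a b q).subtypeL)

theorem bergmanPairing_apply [Fact (1 ≤ p)] [Fact (1 ≤ q)] [ENNReal.HolderConjugate p q]
    (g : bergmanSpace n a b q) (f : bergmanSpace n a b p) :
    bergmanPairing n a b p q g f = ∫ z, f.1 z * conj (g.1 z) ∂(bergmanMeasure n a b) := by
  refine (ContinuousLinearMap.lpPairing_eq_integral (ContinuousLinearMap.mul ℂ ℂ) f.1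
    (conjLp _ q g.1)).trans ?_
  refine integral_congr_ae ?_
  filter_upwards [coeFn_conjLp g.1] with z hz
  rw [hz]
  rfl

theorem integrable_coe_bergmanSpace (hn : 1 ≤ n) (ha : -1 < a) (hb : -(n : ℝ) < b)
    [Fact (1 ≤ p)] (f : Lp ℂ p (bergmanMeasure n a b)) : Integrable f (bergmanMeasure n a b) := by
  have := isFiniteMeasure_bergmanMeasure hn ha hb
  exact (Lp.memLp f).integrable Fact.out

theorem bergmanProj_coe_ae_eq (hn : 1 ≤ n) (ha : -1 < a) (hb : -(n : ℝ) < b)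
    [Fact (1 ≤ p)] (f : bergmanSpace n a b p) :
    bergmanProj n a b f.1 =ᵐ[bergmanMeasure n a b] f.1 := by
  obtain ⟨F, hF, hfF⟩ := f.2
  have hFi := (integrable_coe_bergmanSpace hn ha hb f.1).congr hfF
  rw [bergmanProj_congr hfF]
  filter_upwards [hfF, ae_bergmanMeasure_mem_ball] with z h1 h2
  rw [h1, bergmanProj_eq_self hn ha hb hF hFi h2]

theorem exists_bergmanSpace_ae_eq_kernelFun (hn : 1 ≤ n) (ha : -1 < a) (hb : -(n : ℝ) < b)
    [Fact (1 ≤ p)] {z : EuclideanSpace ℂ (Fin n)} (hz : ‖z‖ < 1) :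
    ∃ f : bergmanSpace n a b p,
      f.1 =ᵐ[bergmanMeasure n a b] fun w => kernelFun n a (b + n) (inner ℂ z w) := by
  have := isFiniteMeasure_bergmanMeasure hn ha hb
  have hB : 0 < b + n := by linarith
  obtain ⟨M, _, hM⟩ := exists_norm_kernelFun_le (n := n) ha hB hz
  have hm : Measurable fun w : EuclideanSpace ℂ (Fin n) =>
      kernelFun n a (b + n) (inner ℂ z w) :=
    (measurable_kernelFun ha hB).comp (by fun_prop : Continuous _).measurable
  have hL : MemLp (fun w : EuclideanSpace ℂ (Fin n) => kernelFun n a (b + n) (inner ℂ z w)) p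
      (bergmanMeasure n a b) := by
    refine MemLp.of_bound hm.aestronglyMeasurable M ?_
    filter_upwards [ae_bergmanMeasure_mem_ball] with w hw
    refine (hM _ ?_).1
    refine (norm_inner_le_norm _ _).trans ?_
    nlinarith [norm_nonneg z]
  refine ⟨⟨hL.toLp _, _, ?_, hL.coeFn_toLp⟩, hL.coeFn_toLp⟩
  refine (differentiableOn_kernelFun ha hB).comp
    (t := ball (0 : ℂ) 1) (innerSL ℂ z).differentiable.differentiableOn fun w hw => ?_
  exact mem_ball_zero_iff.2 (norm_inner_lt_one hz (mem_ball_zero_iff.1 hw))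

/-- For |z| < 1 the function K(⟨z,·⟩) is bounded and holomorphic on the ball, hence a legitimate
test function; pairing it with g gives, up to conjugation and a constant, Pg(z) = g(z). -/
theorem bergmanPairing_injective (hn : 1 ≤ n) (ha : -1 < a) (hb : -(n : ℝ) < b)
    [Fact (1 ≤ p)] [Fact (1 ≤ q)] [ENNReal.HolderConjugate p q] :
    Function.Injective (bergmanPairing n a b p q) := by
  rw [injective_iff_map_eq_zero]
  intro g hg
  have key : ∀ z : EuclideanSpace ℂ (Fin n), ‖z‖ < 1 → bergmanProj n a b g.1 z = 0 := by
    intro z hz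
    obtain ⟨f, hf⟩ := exists_bergmanSpace_ae_eq_kernelFun (p := p) hn ha hb hz
    have h0 : ∫ w, f.1 w * conj (g.1 w) ∂(bergmanMeasure n a b) = 0 := by
      rw [← bergmanPairing_apply, hg, zero_apply]
    have e : ∫ w, f.1 w * conj (g.1 w) ∂(bergmanMeasure n a b) =
        conj (∫ w, kernelFun n a (b + n) (inner ℂ w z) * g.1 w ∂(bergmanMeasure n a b)) := by
      rw [← integral_conj]
      refine integral_congr_ae ?_
      filter_upwards [hf] with w hw
      rw [hw, map_mul, kernelFun_inner_comm]
    rw [e, map_eq_zero] at h0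
    rw [bergmanProj, h0, mul_zero]
  have h1 : g.1 = 0 := by
    rw [Lp.eq_zero_iff_ae_eq_zero]
    filter_upwards [bergmanProj_coe_ae_eq hn ha hb g, ae_bergmanMeasure_mem_ball] with z hz hz1
    rw [← hz, key z hz1, Pi.zero_apply]
  exact Subtype.ext h1

/-- Extend by Hahn–Banach, represent by h in L^q, and project h̄. Symmetry moves the projection onto
f, which it fixes, so projecting does not alter the functional on 𝒜^p. The constant is that of the
projection on L^q. -/
theorem exists_bergmanPairing_eq (hn : 1 ≤ n) (ha : -1 < a) (hb : -(n : ℝ) < b)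
    [Fact (1 ≤ p)] [Fact (1 ≤ q)] [ENNReal.HolderConjugate p q] (hp : p ≠ ∞) (hq : q ≠ ∞) :
    ∃ C : ℝ, ∀ φ : StrongDual ℂ (bergmanSpace n a b p), ∃ g : bergmanSpace n a b q,
      bergmanPairing n a b p q g = φ ∧ ‖g‖ ≤ C * ‖φ‖ := by
  have := isFiniteMeasure_bergmanMeasure hn ha hb
  obtain ⟨C, hC, hP⟩ := exists_memLp_bergmanProj hn ha hb (p := p) (q := q) hp hq
  refine ⟨C, fun φ => ?_⟩
  obtain ⟨ψ, hψ, hψn⟩ := exists_extension_norm_eq (bergmanSpace n a b p) φ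
  obtain ⟨h, hh, hhn, hψh⟩ := exists_memLp_functional_eq (q := q) hp hq ψ
  -- The representation of ψ is bilinear while the pairing conjugates its second argument, so h̄ is
  -- projected.
  have hu := hh.complex_conj
  set u : EuclideanSpace ℂ (Fin n) → ℂ := fun x => conj (h x) with hu_def
  have hun : eLpNorm u q (bergmanMeasure n a b) = eLpNorm h q (bergmanMeasure n a b) :=
    eLpNorm_congr_norm_ae (Filter.Eventually.of_forall fun x => RCLike.norm_conj _)
  obtain ⟨hPL, hPn⟩ := hP u hu
  refine ⟨⟨hPL.toLp _, _, differentiableOn_bergmanProj ha hb (hu.integrable Fact.out),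
    hPL.coeFn_toLp⟩, ?_, ?_⟩
  · ext f
    rw [bergmanPairing_apply, ← hψ f, hψh]
    calc ∫ z, f.1 z * conj (hPL.toLp _ z) ∂(bergmanMeasure n a b)
        = ∫ z, f.1 z * conj (bergmanProj n a b u z) ∂(bergmanMeasure n a b) := by
          refine integral_congr_ae ?_
          filter_upwards [hPL.coeFn_toLp] with z hz
          rw [hz]
      _ = ∫ w, bergmanProj n a b f.1 w * conj (u w) ∂(bergmanMeasure n a b) :=
          integral_mul_conj_bergmanProj hn ha hb hp hq (Lp.memLp f.1) hu
      _ = ∫ w, f.1 w * h w ∂(bergmanMeasure n a b) := by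
          refine integral_congr_ae ?_
          filter_upwards [bergmanProj_coe_ae_eq hn ha hb f] with w hw
          rw [hw, hu_def, Complex.conj_conj]
  · change ‖hPL.toLp _‖ ≤ _
    rw [Lp.norm_toLp]
    refine ENNReal.toReal_le_of_le_ofReal (by positivity) (hPn.trans ?_)
    rw [hun, ENNReal.ofReal_mul hC, ← hψn]
    gcongr

end Duality

end

theorem theorem2p7 (n : ℕ) (hn : 1 ≤ n) (a b : ℝ) (ha : -1 < a) (hb : -(n : ℝ) < b)
    (p q : ℝ≥0∞) [Fact (1 ≤ p)] [Fact (1 ≤ q)] (hp1 : 1 < p) (hp : p < ∞)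
    (hpq : 1 / p + 1 / q = 1) :
    (∀ (f : bergmanSpace n a b p) (g : bergmanSpace n a b q),
      Integrable (fun z => f.1 z * conj (g.1 z)) (bergmanMeasure n a b)) ∧
    ∃ Φ : bergmanSpace n a b q ≃SL[starRingEnd ℂ] StrongDual ℂ (bergmanSpace n a b p),
      ∀ (g : bergmanSpace n a b q) (f : bergmanSpace n a b p),
        Φ g f = ∫ z, f.1 z * conj (g.1 z) ∂(bergmanMeasure n a b) := by
  have hconj : ENNReal.HolderConjugate p q := by
    rw [ENNReal.holderConjugate_iff]
    simpa using hpq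
  have hq : q ≠ ∞ := by
    rintro rfl
    have : p = 1 := by simpa using hpq
    exact hp1.ne' this
  refine ⟨fun f g => integrable_mul_conj f.1 g.1, ?_⟩
  obtain ⟨C, hC⟩ := exists_bergmanPairing_eq hn ha hb (p := p) (q := q) hp.ne hq
  have hinj := bergmanPairing_injective hn ha hb (p := p) (q := q)
  have hsurj : Function.Surjective (bergmanPairing n a b p q) := fun φ =>
    (hC φ).imp fun _ h => h.1
  let e : bergmanSpace n a b q ≃ₛₗ[starRingEnd ℂ] StrongDual ℂ (bergmanSpace n a b p) :=
    LinearEquiv.ofBijective (bergmanPairing n a b p q).toLinearMap ⟨hinj, hsurj⟩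
  refine ⟨⟨e, (bergmanPairing n a b p q).continuous,
    -- By injectivity, the inverse image of φ is the very g whose norm was bounded by C‖φ‖.
    AddMonoidHomClass.continuous_of_bound e.symm C fun φ => ?_⟩, fun g f => bergmanPairing_apply g f⟩
  obtain ⟨g, hg, hgn⟩ := hC φ
  have : e.symm φ = g := e.symm_apply_eq.2 hg.symm
  rwa [this]
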